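/- Let $\mathcal A=\{L_1,\dots,L_n\}$ and $\mathcal A'=\{L'_1,\dots,L'_k\}$ be ordered arrangements of pairwise distinct lines in $\mathbb{CP}^2$, $n,k\ge 3$, and let $\xi,\xi'$ be characters on them: maps from the sets of lines to $\mathbb C^*$ whose values have product $1$. Write $m_i$ for the meridian of $L_i$ and $E_{\mathcal A}=\mathbb{CP}^2\setminus\bigcup_i L_i$; the character induced by $\xi$ on $H_1(E_{\mathcal A})$, sending $m_i$ to $\xi(L_i)$, is again denoted $\xi$. The incidence graph $\Gamma_{\mathcal A}$ has one vertex $v_L$ for each line and one vertex $v_P$ for each singular point, $v_L$ and $v_P$ being joined if and only if $P\in L$. Put $\xi_*(v_L)=\xi(L)$ and $\xi_*(v_P)=\prod_{L\ni P}\xi(L)$. For a cycle $\gamma\in H_1(\Gamma_{\mathcal A};\mathbb Z)$, the triple $(\mathcal A,\xi,\gamma)$ is *inner-cyclic* if $\gamma\neq 0$ and $\xi_*(v)=1$ for every vertex $v$ at distance at most $1$ from $\gamma$. It is *triangular* if moreover $L_1,L_2,L_3$ are not concurrent and $\gamma$ is the oriented cycle $$v_{L_1}\to v_{L_1\cap L_2}\to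 v_{L_2}\to v_{L_2\cap L_3}\to v_{L_3}\to v_{L_3\cap L_1}\to v_{L_1}.$$ Let $B_{\mathcal A}\subset E_{\mathcal A}$ be the boundary of a sufficiently small regular neighbourhood of $\bigcup_i L_i$, namely of the union of the tubes of radius $\varepsilon$ around the lines and of the balls of radius $\delta$ around the singular points for the Fubini–Study metric, where $\delta$ is small and $\varepsilon$ is small with respect to $\delta$. It is the union of pieces $\mathcal N_L$ (the part of $B_{\mathcal A}$ on the boundary of the tube around $L$) and $\mathcal B_P$ (the part on the boundary of the ball around $P$), and is a graph manifold over $\Gamma_{\mathcal A}$. A *nearby cycle* associated with $\gamma$ is an embedded circle $\tilde\gamma$ in $B_{\mathcal A}$ that is disjoint from the pieces of all vertices not on $\gamma$ and that runs through finitely many successive arcs, each contained in one piece, the pieces forming a closed walk in $\Gamma_{\mathcal A}$ whose class in $H_1(\Gamma_{\mathcal A})$ is $\gamma$. The invariant is $\mathcal I(\mathcal A,\xi,\gamma)=\xi([\tilde\gamma])\in\mathbb C^*$, where $[\tilde\gamma]\in H_1(E_{\mathcal A})$. It is *well defined* if for all sufficiently small $\delta$, and all $\varepsilon$ sufficiently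 small with respect to $\delta$, nearby cycles exist, and the value $\xi([\tilde\gamma])$ is the same for all of them and for all these $\delta,\varepsilon$. A *gluing* of $\mathcal A$ and $\mathcal A'$ is a projective transformation $\phi\in PGL_3(\mathbb C)$ such that, for some $l$ with $3\le l\le\min(n,k)$, $\phi(L'_i)=L_i$ for $1\le i\le l$, and $\phi(L'_i)\neq L_j$ for all $i,j>l$. The *glued arrangement* is the ordered arrangement $$\mathcal A\bowtie_\phi\mathcal A'=\{D_1,\dots,D_d\}=\{L_1,\dots,L_n,\phi(L'_{l+1}),\dots,\phi(L'_k)\},\qquad d=n+k-l,$$ and the *glued character* $\xi\bowtie_\phi\xi'$ takes the value $\xi(L_i)\xi'(L'_i)$ at $D_i$ for $i\le l$, $\xi(L_i)$ for $l<i\le n$, and $\xi'(L'_{i-n+l})$ for $n<i\le d$. **Theorem.** Let $(\mathcal A,\xi,\gamma)$ and $(\mathcal A',\xi',\gamma')$ be triangular inner-cyclic arrangements, let $\phi$ be a gluing of $\mathcal A$ and $\mathcal A'$, and let $\mu$ be the oriented cycle $v_{D_1}\to v_{D_1\cap D_2}\to v_{D_2}\to v_{D_2\cap D_3}\to v_{D_3}\to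 v_{D_3\cap D_1}\to v_{D_1}$ of the incidence graph of $\mathcal A\bowtie_\phi\mathcal A'$. Then $(\mathcal A\bowtie_\phi\mathcal A',\xi\bowtie_\phi\xi',\mu)$ is a triangular inner-cyclic arrangement, the invariants of the three triples are well defined, and $$\mathcal I(\mathcal A\bowtie_\phi\mathcal A',\xi\bowtie_\phi\xi',\mu)=\mathcal I(\mathcal A,\xi,\gamma)\cdot\mathcal I(\mathcal A',\xi',\gamma').$$ -/

import Mathlib

open scoped LinearAlgebra.Projectivization Topology
open Filter

noncomputable section

/-! ### The complex projective plane and its lines -/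

/-- The vector space `ℂ³` with its standard Hermitian inner product. -/
abbrev C3 : Type := EuclideanSpace ℂ (Fin 3)

/-- The complex projective plane. -/
abbrev CP2 : Type := ℙ ℂ C3

/-- The quotient topology on the complex projective plane. -/
instance CP2.topology : TopologicalSpace CP2 :=
  TopologicalSpace.coinduced (Projectivization.mk' ℂ) inferInstance

/-- A line of the complex projective plane, given as a point of the dual projective plane:
the class `[f]` of a nonzero linear form `f` is the line `{f = 0}`. -/
abbrev ProjLine : Type := ℙ ℂ (StrongDual ℂ C3)

/-- The point `p` lies on the line `L`. -/
def OnLine (p : CP2) (L : ProjLine) : Prop := L.rep p.rep = 0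

/-- Composition `f ↦ f ∘ φ⁻¹` of linear forms with the inverse of a linear automorphism. -/
def formMap (φ : C3 ≃L[ℂ] C3) : StrongDual ℂ C3 →ₗ[ℂ] StrongDual ℂ C3 where
  toFun f := f.comp (φ.symm : C3 →L[ℂ] C3)
  map_add' _ _ := rfl
  map_smul' _ _ := rfl

theorem formMap_injective (φ : C3 ≃L[ℂ] C3) : Function.Injective (formMap φ) := by
  intro f g h
  ext1 v
  have h1 : f (φ.symm (φ v)) = g (φ.symm (φ v)) :=
    congrArg (fun u : StrongDual ℂ C3 => u (φ v)) h
  rwa [φ.symm_apply_apply] at h1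

/-- The image of the line `L = {f = 0}` under the projective transformation induced by `φ`,
that is the line `{f ∘ φ⁻¹ = 0}`. -/
def mapLine (φ : C3 ≃L[ℂ] C3) (L : ProjLine) : ProjLine :=
  Projectivization.map (formMap φ) (formMap_injective φ) L

theorem mapLine_injective (φ : C3 ≃L[ℂ] C3) : Function.Injective (mapLine φ) :=
  Projectivization.map_injective (τ := RingHom.id ℂ) _ (formMap_injective φ)

/-- The sine of the Fubini–Study distance between two points. -/
def pointDist (p q : CP2) : ℝ :=
  Real.sqrt (1 - ‖inner ℂ p.rep q.rep‖ ^ 2 / (‖p.rep‖ ^ 2 * ‖q.rep‖ ^ 2))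

/-- The sine of the Fubini–Study distance from the line `L` to the point `p`. -/
def lineDist (L : ProjLine) (p : CP2) : ℝ :=
  ‖L.rep p.rep‖ / (‖L.rep‖ * ‖p.rep‖)

/-! ### Ordered line arrangements -/

/-- An ordered arrangement of `n ≥ 3` pairwise distinct lines of the complex projective plane.
The lines are numbered from `0`. -/
structure Arrangement (n : ℕ) where
  line : Fin n → ProjLine
  injective : Function.Injective line
  three_le : 3 ≤ n

/-- A character on an ordered combinatorics with `n` lines: nonzero complex numbers attached to
the lines, with product `1`. -/
structure LineCharacter (n : ℕ) where
  toFun : Fin n → ℂˣ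
  prod_eq_one : ∏ i, toFun i = 1

theorem exists_onLine (L M : ProjLine) : ∃ p : CP2, OnLine p L ∧ OnLine p M := by
  let f : C3 →ₗ[ℂ] ℂ × ℂ := (L.rep : C3 →ₗ[ℂ] ℂ).prod (M.rep : C3 →ₗ[ℂ] ℂ)
  have hf : LinearMap.ker f ≠ ⊥ := by
    apply LinearMap.ker_ne_bot_of_finrank_lt
    simp
  obtain ⟨v, hv, hv0⟩ := (Submodule.ne_bot_iff _).1 hf
  have h : L.rep v = 0 ∧ M.rep v = 0 := by simpa [f, LinearMap.mem_ker] using hv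
  obtain ⟨a, ha⟩ := Projectivization.exists_smul_eq_mk_rep ℂ v hv0
  refine ⟨Projectivization.mk ℂ v hv0, ?_, ?_⟩ <;>
    simp [OnLine, ← ha, Units.smul_def, h.1, h.2]

/-! ### One-cycles of a graph -/

section Graph

variable {V : Type*}

/-- The elementary integral 1-chain of an edge oriented from `u` to `v`. A 1-chain of a graph is
an antisymmetric function on oriented edges. -/
def edgeChain (u v : V) : V × V →₀ ℤ := Finsupp.single (u, v) 1 - Finsupp.single (v, u) 1

/-- The first homology group `H₁(G; ℤ)` of a graph: the antisymmetric, finitely supported integral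
functions on the oriented edges whose boundary vanishes (the values on the edges leaving any given
vertex have sum zero). -/
def graphH1 (G : SimpleGraph V) : AddSubgroup (V × V →₀ ℤ) where
  carrier := {c | (∀ u v, c (u, v) = -c (v, u)) ∧ (∀ u v, c (u, v) ≠ 0 → G.Adj u v) ∧
    c.mapDomain Prod.fst = 0}
  zero_mem' := by simp
  add_mem' := by
    rintro a b ⟨ha, ha', ha''⟩ ⟨hb, hb', hb''⟩
    refine ⟨fun u v => ?_, fun u v h => ?_, ?_⟩
    · simp [ha u v, hb u v, add_comm]
    · by_contra hn
      exact h (by simp [not_imp_comm.1 (ha' u v) hn, not_imp_comm.1 (hb' u v) hn])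
    · rw [Finsupp.mapDomain_add, ha'', hb'', add_zero]
  neg_mem' := by
    rintro a ⟨ha, ha', ha''⟩
    refine ⟨fun u v => ?_, fun u v h => ha' u v (by simpa using h), ?_⟩
    · simp [ha u v]
    · have := Finsupp.mapDomain_add (f := (Prod.fst : V × V → V)) (v₁ := a) (v₂ := -a)
      rw [add_neg_cancel, Finsupp.mapDomain_zero, ha'', zero_add] at this
      exact this.symm

/-- The set of vertices through which the chain `c` passes. -/
def chainVertices (c : V × V →₀ ℤ) : Set V := {u | ∃ v, c (u, v) ≠ 0}

/-- The 1-chain traversed by a walk. -/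
def walkChain {G : SimpleGraph V} {u v : V} (w : G.Walk u v) : V × V →₀ ℤ :=
  (w.darts.map fun d => edgeChain d.fst d.snd).sum

end Graph

/-! ### First homology and winding numbers -/

/-- The first homology group of a path-connected space, as the abelianized fundamental group. -/
abbrev H1 (X : Type*) [TopologicalSpace X] (x : X) : Type _ :=
  Abelianization (FundamentalGroup X x)

/-- The homology class of a loop. -/
def loopClass {X : Type*} [TopologicalSpace X] {x : X} (c : Path x x) : H1 X x :=
  Abelianization.of (FundamentalGroup.fromPath (Path.Homotopic.Quotient.mk c))

/-- The punctured plane `ℂ ∖ {0}`. -/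
abbrev Cstar : Type := {z : ℂ // z ≠ 0}

theorem Cstar.start (w : Cstar) : w = (⟨_, Complex.exp_ne_zero (Complex.log w)⟩ : Cstar) :=
  Subtype.ext (Complex.exp_log w.2).symm

/-- The end point of the lift, through the exponential, of a path of `ℂ ∖ {0}`, the lift starting
at the principal logarithm of the starting point. -/
def logEnd {w w' : Cstar} (c : Path w w') : ℂ :=
  Complex.isCoveringMap_exp.liftPath (c : C(unitInterval, Cstar)) (Complex.log w)
    (by simpa using Cstar.start w) 1

theorem exists_winding {w : Cstar} (c : Path w w) :
    ∃ n : ℤ, logEnd c = Complex.log w + n * (2 * Real.pi * Complex.I) := by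
  apply Complex.exp_eq_exp_iff_exists_int.1
  have h := congrArg Subtype.val (congrFun (Complex.isCoveringMap_exp.liftPath_lifts
    (c : C(unitInterval, Cstar)) (Complex.log w) (by simpa using Cstar.start w)) 1)
  simp only [Function.comp_apply] at h
  rw [Complex.exp_log w.2]
  simpa [logEnd] using h

/-- The winding number around `0` of a loop of `ℂ ∖ {0}`: the total increment of a continuous
logarithm along the loop, divided by `2πi`. -/
def winding {w : Cstar} (c : Path w w) : ℤ := (exists_winding c).choose

theorem logEnd_eq {w : Cstar} (c : Path w w) :
    logEnd c = Complex.log w + winding c * (2 * Real.pi * Complex.I) :=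
  (exists_winding c).choose_spec

theorem two_pi_I_cancel {m n : ℤ} {z : ℂ}
    (h : z + m * (2 * Real.pi * Complex.I) = z + n * (2 * Real.pi * Complex.I)) : m = n := by
  have h1 := mul_right_cancel₀ Complex.two_pi_I_ne_zero (add_left_cancel h)
  exact_mod_cast h1

/-- The winding number can be computed from any continuous logarithm along the loop. -/
theorem winding_eq {w : Cstar} (c : Path w w) (θ : C(unitInterval, ℂ))
    (hθ : ∀ t, Complex.exp (θ t) = (c t : ℂ)) (n : ℤ)
    (hn : θ 1 = θ 0 + n * (2 * Real.pi * Complex.I)) : winding c = n := by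
  have h0 : Complex.exp (Complex.log w) = Complex.exp (θ 0) := by
    rw [hθ 0, Complex.exp_log w.2, c.source]
  obtain ⟨m, hm⟩ := Complex.exp_eq_exp_iff_exists_int.1 h0
  let Γ : C(unitInterval, ℂ) := ⟨fun t => θ t + m * (2 * Real.pi * Complex.I), by fun_prop⟩
  have hΓ : Γ = Complex.isCoveringMap_exp.liftPath (c : C(unitInterval, Cstar)) (Complex.log w)
      (by simpa using Cstar.start w) := by
    rw [IsCoveringMap.eq_liftPath_iff']
    refine ⟨?_, hm.symm⟩
    funext t
    apply Subtype.ext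
    show Complex.exp (θ t + m * (2 * Real.pi * Complex.I)) = _
    rw [Complex.exp_add, Complex.exp_int_mul_two_pi_mul_I, mul_one, hθ t]
    rfl
  have h1 : logEnd c = θ 1 + m * (2 * Real.pi * Complex.I) := by
    unfold logEnd; rw [← hΓ]; rfl
  have h2 := logEnd_eq c
  refine two_pi_I_cancel (z := Complex.log w) ?_
  rw [← h2, h1, hn, hm]
  ring

theorem exists_log {w : Cstar} (c : Path w w) : ∃ θ : C(unitInterval, ℂ),
    (∀ t, Complex.exp (θ t) = (c t : ℂ)) ∧ θ 0 = Complex.log w ∧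
    θ 1 = Complex.log w + winding c * (2 * Real.pi * Complex.I) := by
  refine ⟨Complex.isCoveringMap_exp.liftPath (c : C(unitInterval, Cstar)) (Complex.log w)
      (by simpa using Cstar.start w), fun t => ?_, IsCoveringMap.liftPath_zero _ _ _ _,
      logEnd_eq c⟩
  exact congrArg Subtype.val (congrFun (Complex.isCoveringMap_exp.liftPath_lifts
    (c : C(unitInterval, Cstar)) (Complex.log w) (by simpa using Cstar.start w)) t)

theorem winding_homotopic {w : Cstar} {c d : Path w w} (h : c.Homotopic d) :
    winding c = winding d := by
  have h1 : logEnd c = logEnd d :=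
    Complex.isCoveringMap_exp.liftPath_apply_one_eq_of_homotopicRel h _ _ _
  apply two_pi_I_cancel (z := Complex.log w)
  rw [← logEnd_eq c, ← logEnd_eq d, h1]

theorem winding_refl (w : Cstar) : winding (Path.refl w) = 0 :=
  winding_eq _ (ContinuousMap.const _ (Complex.log (w : ℂ)))
    (fun _ => by simp [Complex.exp_log w.2]) 0 (by simp)

theorem winding_trans {w : Cstar} (c d : Path w w) :
    winding (c.trans d) = winding c + winding d := by
  obtain ⟨θ, h, h0, h1⟩ := exists_log c
  obtain ⟨η, k, k0, k1⟩ := exists_log d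
  let p : Path (Complex.log w) (θ 1) := ⟨θ, h0, rfl⟩
  let q : Path (θ 1) (η 1 + winding c * (2 * Real.pi * Complex.I)) :=
    ⟨⟨fun t => η t + winding c * (2 * Real.pi * Complex.I), by fun_prop⟩, by
      simp [k0, h1], rfl⟩
  refine winding_eq _ ((p.trans q : Path _ _) : C(unitInterval, ℂ)) (fun t => ?_) _ ?_
  · show Complex.exp ((p.trans q) t) = ((c.trans d) t : ℂ)
    rw [Path.trans_apply, Path.trans_apply]
    split_ifs with ht
    · exact h _
    · show Complex.exp (η _ + winding c * (2 * Real.pi * Complex.I)) = _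
      rw [Complex.exp_add, Complex.exp_int_mul_two_pi_mul_I, mul_one, k]
  · show (p.trans q) 1 = (p.trans q) 0 + _
    rw [Path.target, Path.source, k1]
    push_cast
    ring

/-- The winding number as a homomorphism on the fundamental group of `ℂ ∖ {0}`. -/
def windingHom (w : Cstar) : FundamentalGroup Cstar w →* Multiplicative ℤ where
  toFun q := Multiplicative.ofAdd
    (Quotient.lift winding (fun _ _ h => winding_homotopic h) (FundamentalGroup.toPath q))
  map_one' := congrArg Multiplicative.ofAdd (winding_refl w)
  map_mul' p q := by
    induction p using Quotient.inductionOn with | h c =>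
    induction q using Quotient.inductionOn with | h d =>
    exact congrArg Multiplicative.ofAdd ((winding_trans d c).trans (add_comm _ _))


/-! ### The complement of an arrangement and the character on its first homology -/

theorem CP2.isOpenQuotientMap_mk : IsOpenQuotientMap (Projectivization.mk' ℂ : _ → CP2) := by
  refine ⟨fun p => ⟨⟨p.rep, p.rep_nonzero⟩, p.mk_rep⟩, continuous_coinduced_rng, fun U hU => ?_⟩
  rw [isOpen_coinduced]
  have h : Projectivization.mk' ℂ ⁻¹' (Projectivization.mk' ℂ '' U) =
      ⋃ a : ℂˣ, (fun v : {v : C3 // v ≠ 0} => (⟨a • (v : C3),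
        (smul_ne_zero_iff_ne a).2 v.2⟩ : {v : C3 // v ≠ 0})) ⁻¹' U := by
    ext v
    simp only [Set.mem_preimage, Set.mem_image, Set.mem_iUnion]
    constructor
    · rintro ⟨u, hu, huv⟩
      obtain ⟨a, ha⟩ := (Projectivization.mk_eq_mk_iff ℂ _ _ u.2 v.2).1 huv
      refine ⟨a, ?_⟩
      convert hu
    · rintro ⟨a, ha⟩
      exact ⟨_, ha, (Projectivization.mk_eq_mk_iff ℂ _ _ _ v.2).2 ⟨a, rfl⟩⟩
  rw [h]
  refine isOpen_iUnion fun a => hU.preimage ?_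
  exact Continuous.subtype_mk (continuous_subtype_val.const_smul a) _

/-- The quotient of two linear forms does not depend on the representative of the point. -/
theorem form_div_rep (f g : StrongDual ℂ C3) (v : C3) (hv : v ≠ 0) :
    f (Projectivization.mk ℂ v hv).rep / g (Projectivization.mk ℂ v hv).rep = f v / g v := by
  obtain ⟨a, ha⟩ := Projectivization.exists_smul_eq_mk_rep ℂ v hv
  rw [← ha, Units.smul_def, map_smul, map_smul, smul_eq_mul, smul_eq_mul,
    mul_div_mul_left _ _ a.ne_zero]

theorem onLine_mk_iff (L : ProjLine) (v : C3) (hv : v ≠ 0) :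
    OnLine (Projectivization.mk ℂ v hv) L ↔ L.rep v = 0 := by
  obtain ⟨a, ha⟩ := Projectivization.exists_smul_eq_mk_rep ℂ v hv
  rw [OnLine, ← ha, Units.smul_def, map_smul, smul_eq_mul, mul_eq_zero]
  simp

/-- The point `φ p` lies on the line `φ L` if and only if `p` lies on `L`. -/
theorem onLine_map_iff (φ : C3 ≃L[ℂ] C3) (p : CP2) (L : ProjLine) :
    OnLine (Projectivization.map (φ.toLinearEquiv : C3 →ₗ[ℂ] C3) φ.injective p) (mapLine φ L) ↔
      OnLine p L := by
  obtain ⟨v, hv, rfl⟩ : ∃ v, ∃ hv : v ≠ 0, Projectivization.mk ℂ v hv = p :=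
    ⟨p.rep, p.rep_nonzero, p.mk_rep⟩
  rw [Projectivization.map_mk, onLine_mk_iff, onLine_mk_iff]
  have h0 : formMap φ L.rep ≠ 0 :=
    fun h => L.rep_nonzero (formMap_injective φ (h.trans (map_zero _).symm))
  obtain ⟨a, ha⟩ := Projectivization.exists_smul_eq_mk_rep ℂ (formMap φ L.rep) h0
  have h1 : mapLine φ L = Projectivization.mk ℂ (formMap φ L.rep) h0 := by
    conv_lhs => rw [← L.mk_rep]
    rfl
  rw [h1, ← ha]
  show (a : ℂ) • L.rep (φ.symm (φ v)) = 0 ↔ _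
  simp

theorem continuousAt_form_div (f g : StrongDual ℂ C3) (p : CP2) (hp : g p.rep ≠ 0) :
    ContinuousAt (fun q : CP2 => f q.rep / g q.rep) p := by
  have h := CP2.isOpenQuotientMap_mk.continuousAt_comp_iff
    (g := fun q : CP2 => f q.rep / g q.rep) (x := ⟨p.rep, p.rep_nonzero⟩)
  rw [show Projectivization.mk' ℂ ⟨p.rep, p.rep_nonzero⟩ = p from p.mk_rep] at h
  rw [← h]
  have h2 : ((fun q : CP2 => f q.rep / g q.rep) ∘ Projectivization.mk' ℂ) =
      fun v : {v : C3 // v ≠ 0} => f v / g v := by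
    funext v
    exact form_div_rep f g v v.2
  rw [h2]
  exact ContinuousAt.div (by fun_prop) (by fun_prop) hp

namespace Arrangement

variable {n k l : ℕ}

/-- The complement of the arrangement in the projective plane. -/
abbrev Complement (A : Arrangement n) : Type := {p : CP2 // ∀ i, ¬ OnLine p (A.line i)}

/-- The nowhere vanishing function `ℓᵢ / ℓⱼ` on the complement, where `ℓᵢ` and `ℓⱼ` are equations
of the lines of indices `i` and `j`. -/
def ratio (A : Arrangement n) (i j : Fin n) : C(A.Complement, Cstar) where
  toFun p := ⟨(A.line i).rep p.1.rep / (A.line j).rep p.1.rep, div_ne_zero (p.2 i) (p.2 j)⟩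
  continuous_toFun := by
    refine Continuous.subtype_mk (continuous_iff_continuousAt.2 fun p => ?_) _
    exact ContinuousAt.comp (f := Subtype.val)
      (continuousAt_form_div (A.line i).rep (A.line j).rep p.1 (p.2 j))
      continuous_subtype_val.continuousAt

/-- The index of the first line. -/
def first (A : Arrangement n) : Fin n := ⟨0, by have := A.three_le; omega⟩

/-- The index of the second line. -/
def second (A : Arrangement n) : Fin n := ⟨1, by have := A.three_le; omega⟩

/-- The index of the third line. -/
def third (A : Arrangement n) : Fin n := ⟨2, by have := A.three_le; omega⟩

/-- The character on the first homology of the complement that sends the meridian of the line of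
index `i` to `ξ i`. The exponent of `ξ i` is the winding number of `ℓᵢ / ℓ₀`, with `ℓ₀` an equation
of the first line; since the product of the `ξ i` is `1`, the meridian of the first line, along
which the other exponents are all equal to `-1`, is sent to `ξ 0`: see `character_meridian`. -/
def character (A : Arrangement n) (ξ : LineCharacter n) (b : A.Complement) :
    H1 A.Complement b →* ℂˣ :=
  Abelianization.lift (∏ i, (zpowersHom ℂˣ (ξ.toFun i)).comp
    ((windingHom _).comp (FundamentalGroup.map (A.ratio i A.first) b)))

theorem character_loopClass (A : Arrangement n) (ξ : LineCharacter n) {b : A.Complement}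
    (c : Path b b) : A.character ξ b (loopClass c) =
      ∏ i, ξ.toFun i ^ winding (c.map (A.ratio i A.first).continuous) := by
  unfold character loopClass
  rw [Abelianization.lift_apply_of, MonoidHom.finsetProd_apply]
  rfl

/-- A logarithm of a linear form along a small circle `x + r exp(2πit) y`: if `f` has no zero in the
disc other than possibly the center. -/
theorem exists_log_circle (f : StrongDual ℂ C3) (x y : C3) (r : ℝ) (hr : 0 < r) (m : ℤ)
    (hf : (m = 0 ∧ ∀ s : ℂ, ‖s‖ ≤ r → f (x + s • y) ≠ 0) ∨ (m = 1 ∧ f x = 0 ∧ f y ≠ 0)) :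
    ∃ θ : C(unitInterval, ℂ),
      (∀ t : unitInterval, Complex.exp (θ t) =
        f (x + ((r : ℂ) * Complex.exp (2 * Real.pi * Complex.I * (t : ℝ))) • y)) ∧
      θ 1 = θ 0 + m * (2 * Real.pi * Complex.I) := by
  rcases hf with ⟨rfl, hf⟩ | ⟨rfl, hx, hy⟩
  · have hx : f x ≠ 0 := by simpa using hf 0 (by simpa using hr.le)
    have key : ∀ s : ℂ, ‖s‖ ≤ r → ‖s * (f y / f x)‖ < 1 := by
      intro s hs
      by_contra hlt
      push Not at hlt
      have hz : f y / f x ≠ 0 := by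
        intro h0
        rw [h0] at hlt
        norm_num at hlt
      have hy : f y ≠ 0 := fun h0 => hz (by simp [h0])
      refine hf (-(f x / f y)) ?_ ?_
      · rw [norm_mul, norm_div] at hlt
        rw [norm_neg, norm_div]
        have h1 : 0 < ‖f x‖ := norm_pos_iff.2 hx
        have h2 : 0 < ‖f y‖ := norm_pos_iff.2 hy
        rw [div_le_iff₀ h2]
        rw [mul_div_assoc', le_div_iff₀ h1] at hlt
        nlinarith
      · rw [map_add, map_smul, smul_eq_mul]
        field_simp
        ring
    have hs : ∀ t : ℝ, ‖(r : ℂ) * Complex.exp (2 * Real.pi * Complex.I * t)‖ ≤ r := by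
      intro t
      rw [norm_mul, show 2 * Real.pi * Complex.I * (t : ℂ) =
        ((2 * Real.pi * t : ℝ) : ℂ) * Complex.I by push_cast; ring,
        Complex.norm_exp_ofReal_mul_I, Complex.norm_real, mul_one, Real.norm_of_nonneg hr.le]
    have hsl : ∀ t : ℝ, 1 + (r : ℂ) * Complex.exp (2 * Real.pi * Complex.I * t) * (f y / f x) ∈
        Complex.slitPlane := fun t => Complex.mem_slitPlane_of_norm_lt_one (key _ (hs t))
    refine ⟨⟨fun t : unitInterval => Complex.log (f x) + Complex.log
      (1 + (r : ℂ) * Complex.exp (2 * Real.pi * Complex.I * (t : ℝ)) * (f y / f x)), ?_⟩, ?_, ?_⟩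
    · refine continuous_const.add (Continuous.clog (by fun_prop) fun t => hsl t)
    · intro t
      simp only [ContinuousMap.coe_mk]
      rw [Complex.exp_add, Complex.exp_log hx, Complex.exp_log (Complex.slitPlane_ne_zero (hsl t)),
        map_add, map_smul, smul_eq_mul]
      field_simp
    · simp [Complex.exp_two_pi_mul_I]
  · refine ⟨⟨fun t : unitInterval => Complex.log (r * f y) + 2 * Real.pi * Complex.I * (t : ℝ),
      by fun_prop⟩, ?_, ?_⟩
    · intro t
      simp only [ContinuousMap.coe_mk]
      rw [Complex.exp_add, Complex.exp_log (mul_ne_zero (by exact_mod_cast hr.ne') hy), map_add,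
        map_smul, smul_eq_mul, hx]
      ring
    · simp

/-- The character sends the meridians of the lines to the prescribed values: a meridian of the line
of index `i` is a loop `[x + r exp(2πit) y]`, where the point `[x]` of the line is the only common
point of the arrangement and of the disc `{[x + s y] : |s| ≤ r}`. -/
theorem character_meridian (A : Arrangement n) (ξ : LineCharacter n) (i : Fin n)
    (x y : C3) (r : ℝ) (hr : 0 < r) (hx : (A.line i).rep x = 0)
    (hxy : ∀ (j : Fin n) (s : ℂ), ‖s‖ ≤ r → (A.line j).rep (x + s • y) = 0 → j = i ∧ s = 0)
    {b : A.Complement} (c : Path b b)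
    (hc : ∀ t : unitInterval, ∃ h, (c t).1 = Projectivization.mk ℂ
      (x + ((r : ℂ) * Complex.exp (2 * Real.pi * Complex.I * (t : ℝ))) • y) h) :
    A.character ξ b (loopClass c) = ξ.toFun i := by
  have hlog : ∀ j : Fin n, ∃ θ : C(unitInterval, ℂ),
      (∀ t : unitInterval, Complex.exp (θ t) = (A.line j).rep
        (x + ((r : ℂ) * Complex.exp (2 * Real.pi * Complex.I * (t : ℝ))) • y)) ∧
      θ 1 = θ 0 + (if j = i then (1 : ℤ) else 0) * (2 * Real.pi * Complex.I) := by
    intro j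
    obtain ⟨θ, h1, h2⟩ := exists_log_circle (A.line j).rep x y r hr (if j = i then (1 : ℤ) else 0) (by
      by_cases hji : j = i
      · subst hji
        refine Or.inr ⟨by simp, hx, fun hy => ?_⟩
        have := (hxy j r (by simp [abs_of_pos hr]) (by simp [hx, hy])).2
        exact hr.ne' (by exact_mod_cast this)
      · exact Or.inl ⟨by simp [hji], fun s hs h0 => hji (hxy j s hs h0).1⟩)
    exact ⟨θ, h1, by simpa using h2⟩
  choose θ hθ hθ1 using hlog
  have hw : ∀ j, winding (c.map (A.ratio j A.first).continuous) =
      (if j = i then 1 else 0) - (if A.first = i then 1 else 0) := by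
    intro j
    refine winding_eq _ (θ j - θ A.first) (fun t => ?_) _ ?_
    · obtain ⟨h, ht⟩ := hc t
      rw [ContinuousMap.sub_apply, Complex.exp_sub, hθ, hθ]
      show _ = (A.line j).rep (c t).1.rep / (A.line A.first).rep (c t).1.rep
      rw [ht, form_div_rep]
    · rw [ContinuousMap.sub_apply, ContinuousMap.sub_apply, hθ1, hθ1 A.first]
      push_cast
      ring
  rw [character_loopClass]
  simp only [hw, zpow_sub]
  rw [Finset.prod_mul_distrib, Finset.prod_inv_distrib, Finset.prod_zpow, ξ.prod_eq_one, one_zpow,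
    inv_one, mul_one, Finset.prod_eq_single i (fun j _ hj => by simp [hj]) (by simp)]
  simp

/-! ### The incidence graph and inner-cyclic characters -/

/-- The singular points of the arrangement. -/
abbrev SingularPoint (A : Arrangement n) : Type :=
  {p : CP2 // ∃ i j, i ≠ j ∧ OnLine p (A.line i) ∧ OnLine p (A.line j)}

/-- The vertices of the incidence graph: the lines (through their indices) and the singular
points. -/
abbrev Vertex (A : Arrangement n) : Type := Fin n ⊕ A.SingularPoint

/-- The incidence graph of the arrangement: a line and a singular point on it are adjacent. -/
def incidenceGraph (A : Arrangement n) : SimpleGraph A.Vertex where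
  Adj
    | .inl i, .inr P => OnLine P.1 (A.line i)
    | .inr P, .inl i => OnLine P.1 (A.line i)
    | _, _ => False
  symm := ⟨by rintro (i | P) (j | Q) h <;> exact h⟩
  loopless := ⟨by rintro (i | P) h <;> exact h⟩

open Classical in
/-- The extension of a character to the vertices of the incidence graph: the value at a singular
point is the product of the values at the lines through it. -/
def vertexValue (A : Arrangement n) (ξ : LineCharacter n) : A.Vertex → ℂˣ
  | .inl i => ξ.toFun i
  | .inr P => ∏ i, if OnLine P.1 (A.line i) then ξ.toFun i else 1

/-- The triple `(A, ξ, γ)` is an inner-cyclic arrangement: `γ` is a nontrivial cycle of the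
incidence graph, and `ξ` is `1` at every vertex at distance at most `1` from `γ`. -/
def IsInnerCyclic (A : Arrangement n) (ξ : LineCharacter n)
    (γ : A.Vertex × A.Vertex →₀ ℤ) : Prop :=
  γ ∈ graphH1 A.incidenceGraph ∧ γ ≠ 0 ∧
    ∀ v, (∃ w ∈ chainVertices γ, A.incidenceGraph.edist v w ≤ 1) → A.vertexValue ξ v = 1

/-- The intersection point of two distinct lines of the arrangement. -/
def meet (A : Arrangement n) (i j : Fin n) (hij : i ≠ j) : A.SingularPoint :=
  ⟨(exists_onLine (A.line i) (A.line j)).choose,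
    i, j, hij, (exists_onLine (A.line i) (A.line j)).choose_spec⟩

/-- The cycle `L₁ → L₁ ∩ L₂ → L₂ → L₂ ∩ L₃ → L₃ → L₃ ∩ L₁ → L₁` of the incidence graph, where
`L₁, L₂, L₃` are the first three lines. It is zero if these lines are concurrent. -/
def triangle (A : Arrangement n) : A.Vertex × A.Vertex →₀ ℤ :=
  let P := A.meet A.first A.second (by simp [first, second])
  let Q := A.meet A.second A.third (by simp [second, third])
  let R := A.meet A.third A.first (by simp [first, third])
  edgeChain (.inl A.first) (.inr P) + edgeChain (.inr P) (.inl A.second) +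
    edgeChain (.inl A.second) (.inr Q) + edgeChain (.inr Q) (.inl A.third) +
    edgeChain (.inl A.third) (.inr R) + edgeChain (.inr R) (.inl A.first)

/-! ### The boundary manifold, nearby cycles and the invariant -/

/-- The union of the open tubes of radius `ε` around the lines and of the open balls of radius `δ`
around the singular points. It is a regular neighbourhood of the arrangement when `δ` is small and
`ε` is small with respect to `δ`. -/
def tube (A : Arrangement n) (δ ε : ℝ) : Set CP2 :=
  {p | (∃ i, lineDist (A.line i) p < ε) ∨ ∃ P : A.SingularPoint, pointDist P.1 p < δ}

/-- The boundary manifold of the arrangement. -/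
def boundary (A : Arrangement n) (δ ε : ℝ) : Set CP2 := frontier (A.tube δ ε)

/-- The pieces of the boundary manifold, a graph manifold over the incidence graph: the piece of a
line is a circle bundle over the line with discs around the singular points removed, the piece of
a singular point is the boundary of a ball with the open tubes around the lines removed. The pieces
of adjacent vertices meet in a torus. -/
def piece (A : Arrangement n) (δ ε : ℝ) : A.Vertex → Set CP2
  | .inl i => {p | p ∈ A.boundary δ ε ∧ lineDist (A.line i) p = ε}
  | .inr P => {p | p ∈ A.boundary δ ε ∧ pointDist P.1 p = δ}

/-- The loop `c` runs successively through the pieces of the boundary manifold that belong to the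
vertices of the closed walk `w` of the incidence graph. Its image in the first homology of the
incidence graph is then the class of `w`. -/
def Follows (A : Arrangement n) (δ ε : ℝ) {b : A.Complement} (c : Path b b) {v : A.Vertex}
    (w : A.incidenceGraph.Walk v v) : Prop :=
  ∃ t : ℕ → unitInterval, Monotone t ∧ t 0 = 0 ∧ t (w.length + 1) = 1 ∧
    ∀ j ≤ w.length, ∀ s ∈ Set.Icc (t j) (t (j + 1)), (c s).1 ∈ A.piece δ ε (w.getVert j)

/-- The loop `c` is a nearby cycle associated with the cycle `γ` of the incidence graph: it is an
embedded circle in the boundary manifold, it avoids the pieces of the vertices that are not on `γ`,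
and its projection to the first homology of the incidence graph is `γ`. -/
structure IsNearbyCycle (A : Arrangement n) (δ ε : ℝ) (γ : A.Vertex × A.Vertex →₀ ℤ)
    {b : A.Complement} (c : Path b b) : Prop where
  mem_boundary : ∀ t, (c t).1 ∈ A.boundary δ ε
  embedded : ∀ s t, c s = c t → s = t ∨ (s = 0 ∧ t = 1) ∨ (s = 1 ∧ t = 0)
  avoids : ∀ v ∉ chainVertices γ, ∀ t, (c t).1 ∉ A.piece δ ε v
  projects : ∃ (v : A.Vertex) (w : A.incidenceGraph.Walk v v),
    A.Follows δ ε c w ∧ walkChain w = γ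

/-- The number `z` is the value of `ξ` at the class, in the first homology of the complement, of
the nearby cycles associated with `γ`: in the boundary of any sufficiently small regular
neighbourhood there are nearby cycles, and `ξ` takes the value `z` at all of them. -/
def IsInvariantValue (A : Arrangement n) (ξ : LineCharacter n) (γ : A.Vertex × A.Vertex →₀ ℤ)
    (z : ℂˣ) : Prop :=
  ∀ᶠ δ in 𝓝[>] (0 : ℝ), ∀ᶠ ε in 𝓝[>] (0 : ℝ),
    (∃ (b : A.Complement) (c : Path b b), A.IsNearbyCycle δ ε γ c) ∧
    ∀ (b : A.Complement) (c : Path b b), A.IsNearbyCycle δ ε γ c →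
      A.character ξ b (loopClass c) = z

/-- The invariant `I(A, ξ, γ)`. -/
def invariant (A : Arrangement n) (ξ : LineCharacter n) (γ : A.Vertex × A.Vertex →₀ ℤ) : ℂˣ :=
  Classical.epsilon (A.IsInvariantValue ξ γ)

/-! ### Gluing -/

/-- The projective transformation induced by `φ` is a gluing of `A` and `A'`, with `l ≥ 3` common
lines: it sends the first `l` lines of `A'` to the first `l` lines of `A`, in order, and none of
the other lines of `A'` to one of the other lines of `A`. -/
structure IsGluing (A : Arrangement n) (A' : Arrangement k) (l : ℕ) (φ : C3 ≃L[ℂ] C3) : Prop where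
  three_le : 3 ≤ l
  le_left : l ≤ n
  le_right : l ≤ k
  map_eq : ∀ (i : ℕ) (hi : i < l), mapLine φ (A'.line ⟨i, hi.trans_le le_right⟩) =
    A.line ⟨i, hi.trans_le le_left⟩
  map_ne : ∀ (i : Fin k) (j : Fin n), l ≤ i → l ≤ j → mapLine φ (A'.line i) ≠ A.line j

/-- The glued arrangement `L₁, …, Lₙ, φ(L'ₗ₊₁), …, φ(L'ₖ)`. -/
def glue (A : Arrangement n) (A' : Arrangement k) (φ : C3 ≃L[ℂ] C3) (h : IsGluing A A' l φ) :
    Arrangement (n + (k - l)) where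
  line := Fin.addCases A.line (fun j => mapLine φ (A'.line ⟨l + j, by omega⟩))
  injective := by
    have key : ∀ (i : Fin n) (j : Fin (k - l)),
        A.line i ≠ mapLine φ (A'.line ⟨l + j, by omega⟩) := by
      intro i j hij
      by_cases hi : (i : ℕ) < l
      · have h1 := A'.injective (mapLine_injective φ ((h.map_eq i hi).trans hij))
        simp only [Fin.mk.injEq] at h1
        omega
      · exact h.map_ne ⟨l + j, by omega⟩ i (by simp) (by omega) hij.symm
    intro x y hxy
    induction x using Fin.addCases with
    | left i =>
      induction y using Fin.addCases with
      | left i' => simpa [A.injective.eq_iff] using hxy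
      | right j =>
        beta_reduce at hxy
        rw [Fin.addCases_left, Fin.addCases_right] at hxy
        exact absurd hxy (key i j)
    | right j =>
      induction y using Fin.addCases with
      | left i =>
        beta_reduce at hxy
        rw [Fin.addCases_left, Fin.addCases_right] at hxy
        exact absurd hxy.symm (key i j)
      | right j' =>
        have h1 := A'.injective (mapLine_injective φ (by simpa using hxy))
        simp only [Fin.mk.injEq] at h1
        congr 1
        exact Fin.ext (by omega)
  three_le := by have := A.three_le; omega

end Arrangement

/-- The glued character: `ξ i * ξ' i` at the `l` common lines, `ξ` at the other lines of the first
arrangement, `ξ'` at the other lines of the second arrangement. -/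
def LineCharacter.glue {n k : ℕ} (l : ℕ) (hn : l ≤ n) (hk : l ≤ k)
    (ξ : LineCharacter n) (ξ' : LineCharacter k) : LineCharacter (n + (k - l)) where
  toFun := Fin.addCases
    (fun i => if hi : (i : ℕ) < l then ξ.toFun i * ξ'.toFun ⟨i, hi.trans_le hk⟩ else ξ.toFun i)
    (fun j => ξ'.toFun ⟨l + j, by omega⟩)
  prod_eq_one := by
    let g : ℕ → ℂˣ := fun i => if h : i < k then ξ'.toFun ⟨i, h⟩ else 1
    have hg : ∏ i ∈ Finset.range k, g i = 1 := by
      rw [← Fin.prod_univ_eq_prod_range, ← ξ'.prod_eq_one]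
      exact Finset.prod_congr rfl fun i _ => by simp [g]
    have h1 : ∏ i : Fin n, (if (i : ℕ) < l then g i else 1) = ∏ i ∈ Finset.range l, g i := by
      rw [Fin.prod_univ_eq_prod_range (fun i => if i < l then g i else 1), ← Finset.prod_filter]
      refine Finset.prod_congr ?_ fun _ _ => rfl
      ext i
      simp only [Finset.mem_filter, Finset.mem_range]
      omega
    have h2 : ∏ j : Fin (k - l), g (l + j) = ∏ j ∈ Finset.range (k - l), g (l + j) :=
      Fin.prod_univ_eq_prod_range (fun j => g (l + j)) _
    rw [Fin.prod_univ_add]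
    simp only [Fin.addCases_left, Fin.addCases_right]
    have h3 : ∀ i : Fin n, (if hi : (i : ℕ) < l then
        ξ.toFun i * ξ'.toFun ⟨i, hi.trans_le hk⟩ else ξ.toFun i) =
        ξ.toFun i * (if (i : ℕ) < l then g i else 1) := by
      intro i
      split_ifs with hi
      · simp [g, hi.trans_le hk]
      · simp
    have h4 : ∀ j : Fin (k - l), ξ'.toFun ⟨l + j, by omega⟩ = g (l + j) := by
      intro j
      have : l + (j : ℕ) < k := by omega
      simp [g, this]
    simp only [h3, h4]
    rw [Finset.prod_mul_distrib, ξ.prod_eq_one, one_mul, h1, h2, ← Finset.prod_range_add,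
      Nat.add_sub_cancel' hk, hg]

end

noncomputable section

/-! ### Distances in terms of vectors -/

/-! The invariant of a triangular inner-cyclic arrangement is given by a closed formula in the
values of the line equations at the three vertices of the triangle, and this formula is visibly
multiplicative under gluing.

To obtain the formula, follow the phases of the functions ℓᵢ/ℓ₀ along a nearby cycle, keeping only
the lines with ξᵢ ≠ 1. Such a line passes through no vertex of the triangle. Hence on the sphere
around a vertex each ℓᵢ is, up to a factor of positive real part, its value at the vertex times a
factor common to all lines. On the tube around a side, two lines that meet the side at the same
point have nearly proportional equations, because their suitably normalized difference is a multiple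
of the equation of the side, which is small there. So on each piece the phase of ℓᵢ is a reference
phase, plus a term depending only on the class of i, plus an error less than π/2, plus 2πmᵢ. The mᵢ
are not determined, but ∏ ξᵢ^mᵢ is: inner-cyclicity says exactly that ξ has product 1 over each
class (`PhaseValue.unique`, `TriangleTrivial.prod_class`). Being locally constant, this product does
not move along a piece. Passing from one piece to the next changes the reference phases and
multiplies it by an explicit factor (`TriangleTrivial.phaseValue_line_of_corner`). After a full turn
the product has changed by ∏ ξᵢ^(winding of ℓᵢ/ℓ₀), which is the value of the character, and also by
the product of the edge factors. The latter depends only on the 1-chain of the walk, that is on the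
triangle (`walk_transport`, `TriangleTrivial.character_nearbyCycle`). This yields `triangleValue`.

Nearby cycles must also be shown to exist. After rotating the phases of the vertex vectors, the real
segments joining them avoid the other lines. In the real triangle that they span, three short arcs
around the vertices and three arcs along the sides fit together into an embedded circle in the
boundary manifold (`SmallRadii.exists_nearbyCycle`).

In `triangleValue` the exponent of ξ at a line depends only on the line, is unchanged when its
equation is rescaled, and is transported by projective maps. The glued character multiplies the two
characters on common lines, so the values multiply (`IsGluing.triangleValue_glue`); the same product
argument gives inner-cyclicity of the glued triple. -/

theorem lineDist_mk (L : ProjLine) (v : C3) (hv : v ≠ 0) :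
    lineDist L (Projectivization.mk ℂ v hv) = ‖L.rep v‖ / (‖L.rep‖ * ‖v‖) := by
  obtain ⟨a, ha⟩ := Projectivization.exists_smul_eq_mk_rep ℂ v hv
  have h0 : ‖(a : ℂ)‖ ≠ 0 := norm_ne_zero_iff.2 a.ne_zero
  rw [lineDist, ← ha, Units.smul_def, map_smul, norm_smul, norm_smul, mul_left_comm,
    mul_div_mul_left _ _ h0]

theorem pointDist_mk (u v : C3) (hu : u ≠ 0) (hv : v ≠ 0) :
    pointDist (Projectivization.mk ℂ u hu) (Projectivization.mk ℂ v hv) =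
      Real.sqrt (1 - ‖inner ℂ u v‖ ^ 2 / (‖u‖ ^ 2 * ‖v‖ ^ 2)) := by
  obtain ⟨a, ha⟩ := Projectivization.exists_smul_eq_mk_rep ℂ u hu
  obtain ⟨b, hb⟩ := Projectivization.exists_smul_eq_mk_rep ℂ v hv
  have ha0 : ‖(a : ℂ)‖ ≠ 0 := norm_ne_zero_iff.2 a.ne_zero
  have hb0 : ‖(b : ℂ)‖ ≠ 0 := norm_ne_zero_iff.2 b.ne_zero
  have hu0 : ‖u‖ ≠ 0 := norm_ne_zero_iff.2 hu
  have hv0 : ‖v‖ ≠ 0 := norm_ne_zero_iff.2 hv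
  rw [pointDist, ← ha, ← hb, Units.smul_def, Units.smul_def, inner_smul_left, inner_smul_right,
    norm_smul, norm_smul, norm_mul, norm_mul, RCLike.norm_conj]
  congr 2
  field_simp

theorem mk_surjective (p : CP2) : ∃ (v : C3) (hv : v ≠ 0), Projectivization.mk ℂ v hv = p :=
  ⟨p.rep, p.rep_nonzero, p.mk_rep⟩

theorem mk_surjective_unit (p : CP2) :
    ∃ (v : C3) (hv : v ≠ 0), Projectivization.mk ℂ v hv = p ∧ ‖v‖ = 1 := by
  obtain ⟨v, hv, rfl⟩ := mk_surjective p
  have h : ((‖v‖ : ℂ)⁻¹) ≠ 0 := inv_ne_zero (by simpa using hv)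
  refine ⟨(‖v‖ : ℂ)⁻¹ • v, smul_ne_zero h hv, ?_, ?_⟩
  · rw [Projectivization.mk_eq_mk_iff']
    exact ⟨(‖v‖ : ℂ)⁻¹, rfl⟩
  · rw [norm_smul, norm_inv, Complex.norm_real, norm_norm,
      inv_mul_cancel₀ (norm_ne_zero_iff.2 hv)]

theorem CP2.continuous_iff {Y : Type*} [TopologicalSpace Y] {f : CP2 → Y} :
    Continuous f ↔ Continuous fun v : {v : C3 // v ≠ 0} => f (Projectivization.mk ℂ v v.2) :=
  CP2.isOpenQuotientMap_mk.isQuotientMap.continuous_iff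

theorem continuous_lineDist (L : ProjLine) : Continuous (lineDist L) := by
  rw [CP2.continuous_iff]
  simp only [lineDist_mk]
  refine Continuous.div (by fun_prop) (by fun_prop) fun v => ?_
  exact mul_ne_zero (norm_ne_zero_iff.2 L.rep_nonzero) (norm_ne_zero_iff.2 v.2)

theorem continuous_pointDist (p : CP2) : Continuous (pointDist p) := by
  obtain ⟨u, hu, rfl⟩ := mk_surjective p
  rw [CP2.continuous_iff]
  simp only [pointDist_mk]
  refine Real.continuous_sqrt.comp (continuous_const.sub ?_)
  refine Continuous.div (by fun_prop) (by fun_prop) fun v => ?_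
  exact mul_ne_zero (pow_ne_zero 2 (norm_ne_zero_iff.2 hu))
    (pow_ne_zero 2 (norm_ne_zero_iff.2 v.2))


/-- The component of `z` orthogonal to the unit vector `u`. -/
def perp (u z : C3) : C3 := z - (inner ℂ u z : ℂ) • u

theorem inner_perp {u : C3} (hu : ‖u‖ = 1) (z : C3) : inner ℂ u (perp u z) = 0 := by
  rw [perp, inner_sub_right, inner_smul_right, inner_self_eq_norm_sq_to_K, hu]
  simp

theorem norm_sq_eq_perp {u : C3} (hu : ‖u‖ = 1) (z : C3) :
    ‖z‖ ^ 2 = ‖(inner ℂ u z : ℂ)‖ ^ 2 + ‖perp u z‖ ^ 2 := by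
  have h := norm_add_sq_eq_norm_sq_add_norm_sq_of_inner_eq_zero (𝕜 := ℂ)
    ((inner ℂ u z : ℂ) • u) (perp u z) (by rw [inner_smul_left, inner_perp hu, mul_zero])
  rw [norm_smul, hu, mul_one] at h
  have h2 : (inner ℂ u z : ℂ) • u + perp u z = z := by simp [perp]
  rw [h2] at h
  nlinarith

/-- By Pythagoras the sine of the angle is the length of the orthogonal component. This removes the
square root from all later estimates. -/
theorem pointDist_mk_perp {u z : C3} (hu : ‖u‖ = 1) (hu0 : u ≠ 0) (hz0 : z ≠ 0) :
    pointDist (Projectivization.mk ℂ u hu0) (Projectivization.mk ℂ z hz0) =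
      ‖perp u z‖ / ‖z‖ := by
  have hz : ‖z‖ ≠ 0 := norm_ne_zero_iff.2 hz0
  rw [pointDist_mk, hu, show 1 - ‖(inner ℂ u z : ℂ)‖ ^ 2 / (1 ^ 2 * ‖z‖ ^ 2) =
    (‖perp u z‖ / ‖z‖) ^ 2 by
      have := norm_sq_eq_perp hu z
      rw [div_pow, one_pow, one_mul]
      field_simp
      linarith]
  exact Real.sqrt_sq (by positivity)

theorem isLinearMap_perp (u : C3) : IsLinearMap ℂ (perp u) where
  map_add x y := by simp only [perp, inner_add_right, add_smul]; abel
  map_smul c x := by simp only [perp, inner_smul_right, smul_sub, mul_smul]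

theorem continuous_perp (u : C3) : Continuous (perp u) := by
  unfold perp; fun_prop

theorem norm_perp_le {u : C3} (hu : ‖u‖ = 1) (z : C3) : ‖perp u z‖ ≤ ‖z‖ := by
  have := norm_sq_eq_perp hu z
  nlinarith [sq_nonneg ‖(inner ℂ u z : ℂ)‖, norm_nonneg z, norm_nonneg (perp u z)]

/-! ### Linear forms on a line -/

/-- A linear form vanishing at two distinct points of the line `{h = 0}` is a multiple of `h`. -/
theorem form_eq_mul {f h : StrongDual ℂ C3} {s y : C3} (h0 : h ≠ 0)
    (hys : LinearIndependent ℂ ![y, s]) (hy : h y = 0) (hs : h s = 0) (fy : f y = 0)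
    (fs : f s = 0) : ∃ d : ℂ, ∀ v, f v = d * h v := by
  obtain ⟨w, hw⟩ : ∃ w, h w ≠ 0 := by
    by_contra! H
    exact h0 (ContinuousLinearMap.ext H)
  have hli : LinearIndependent ℂ ![w, y, s] := by
    rw [Fintype.linearIndependent_iff]
    intro c hc
    simp only [Fin.sum_univ_three, Matrix.cons_val] at hc
    have c0 : c 0 = 0 := by
      have := congrArg h hc
      simpa [hs, hy, hw] using this
    have c12 := LinearIndependent.pair_iff.1 hys (c 1) (c 2) (by simpa [c0] using hc)
    intro i
    fin_cases i
    exacts [c0, c12.1, c12.2]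
  let b := basisOfLinearIndependentOfCardEqFinrank hli (by simp)
  refine ⟨f w / h w, fun v => ?_⟩
  have key : (f : C3 →ₗ[ℂ] ℂ) = (f w / h w) • (h : C3 →ₗ[ℂ] ℂ) := by
    refine b.ext fun i => ?_
    fin_cases i
    · simp [b, hw]
    · simp [b, hy, fy]
    · simp [b, hs, fs]
  simpa using LinearMap.congr_fun key v

/-- Two linear forms vanishing at the same point `s` of the line `{h = 0}`, normalized to be `1` at
another point `y` of that line, differ by a multiple of `h`. -/
theorem form_div_sub_eq_mul {f g h : StrongDual ℂ C3} {s y : C3} (h0 : h ≠ 0) (hs0 : s ≠ 0)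
    (hs : h s = 0) (hy : h y = 0) (fs : f s = 0) (gs : g s = 0) (fy : f y ≠ 0) (gy : g y ≠ 0) :
    ∃ d : ℂ, ∀ v, f v / f y - g v / g y = d * h v := by
  have hys : LinearIndependent ℂ ![y, s] := by
    rw [LinearIndependent.pair_iff]
    intro a b hab
    have ha : a = 0 := by
      have := congrArg f hab
      simpa [fs, fy] using this
    exact ⟨ha, by simpa [ha, hs0] using hab⟩
  obtain ⟨d, hd⟩ := form_eq_mul (f := (f y)⁻¹ • f - (g y)⁻¹ • g) h0 hys hy hs
    (by simp [fy, gy]) (by simp [fs, gs])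
  exact ⟨d, fun v => by simpa [div_eq_inv_mul] using hd v⟩

/-- Two distinct lines have a unique common point. -/
theorem onLine_unique {L M : ProjLine} {p q : CP2} (hLM : L ≠ M) (pL : OnLine p L)
    (pM : OnLine p M) (qL : OnLine q L) (qM : OnLine q M) : p = q := by
  by_contra hpq
  have hli : LinearIndependent ℂ ![p.rep, q.rep] := by
    rw [LinearIndependent.pair_iff' p.rep_nonzero]
    intro a ha
    apply hpq
    rw [← p.mk_rep, ← q.mk_rep, Eq.comm, Projectivization.mk_eq_mk_iff']
    exact ⟨a, ha⟩
  obtain ⟨d, hd⟩ := form_eq_mul M.rep_nonzero hli pM qM pL qL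
  apply hLM
  rw [← L.mk_rep, ← M.mk_rep, Projectivization.mk_eq_mk_iff']
  exact ⟨d, ContinuousLinearMap.ext fun v => (hd v).symm⟩

/-! ### The triangle formed by the first three lines -/

namespace Arrangement

variable {n : ℕ}

/-- The indices of the first three lines. -/
def tri (A : Arrangement n) : Fin 3 → Fin n := ![A.first, A.second, A.third]

theorem tri_injective (A : Arrangement n) : Function.Injective A.tri := by
  intro a b h
  fin_cases a <;> fin_cases b <;> simp_all [tri, first, second, third]

/-- The vertices of the triangle formed by the first three lines, each one numbered as the
opposite side. -/
def corner (A : Arrangement n) : Fin 3 → A.SingularPoint :=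
  ![A.meet A.second A.third (by simp [second, third]),
    A.meet A.third A.first (by simp [first, third]),
    A.meet A.first A.second (by simp [first, second])]

theorem meet_onLine (A : Arrangement n) (i j : Fin n) (h : i ≠ j) :
    OnLine (A.meet i j h).1 (A.line i) ∧ OnLine (A.meet i j h).1 (A.line j) :=
  (exists_onLine (A.line i) (A.line j)).choose_spec

theorem corner_onLine (A : Arrangement n) {a b : Fin 3} (h : a ≠ b) :
    OnLine (A.corner a).1 (A.line (A.tri b)) := by
  have h0 := A.meet_onLine A.second A.third (by simp [second, third])
  have h1 := A.meet_onLine A.third A.first (by simp [first, third])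
  have h2 := A.meet_onLine A.first A.second (by simp [first, second])
  fin_cases a <;> fin_cases b
  exacts [absurd rfl h, h0.1, h0.2, h1.2, absurd rfl h, h1.1, h2.1, h2.2, absurd rfl h]

theorem triangle_eq (A : Arrangement n) : A.triangle =
    edgeChain (.inl (A.tri 0)) (.inr (A.corner 2)) +
    edgeChain (.inr (A.corner 2)) (.inl (A.tri 1)) +
    edgeChain (.inl (A.tri 1)) (.inr (A.corner 0)) +
    edgeChain (.inr (A.corner 0)) (.inl (A.tri 2)) +
    edgeChain (.inl (A.tri 2)) (.inr (A.corner 1)) +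
    edgeChain (.inr (A.corner 1)) (.inl (A.tri 0)) := rfl

/-- Vectors representing the vertices of the triangle formed by the first three lines. -/
structure Frame (A : Arrangement n) (x : Fin 3 → C3) : Prop where
  diag : ∀ a, (A.line (A.tri a)).rep (x a) ≠ 0
  off_diag : ∀ {a b}, a ≠ b → (A.line (A.tri b)).rep (x a) = 0

namespace Frame

variable {A : Arrangement n} {x : Fin 3 → C3}

theorem ne_zero (h : A.Frame x) (a : Fin 3) : x a ≠ 0 := by
  intro h0
  apply h.diag a
  rw [h0, map_zero]

/-- The equations of the three sides form, up to scalars, the dual basis of a frame; they read off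
coordinates. -/
theorem rep_sum (h : A.Frame x) (c : Fin 3 → ℂ) (a : Fin 3) :
    (A.line (A.tri a)).rep (∑ b, c b • x b) = c a * (A.line (A.tri a)).rep (x a) := by
  rw [map_sum, Finset.sum_eq_single a]
  · simp
  · intro b _ hb
    rw [map_smul, h.off_diag hb, smul_zero]
  · simp

theorem linearIndependent (h : A.Frame x) : LinearIndependent ℂ x := by
  rw [Fintype.linearIndependent_iff]
  intro c hc a
  have := congrArg (A.line (A.tri a)).rep hc
  rw [h.rep_sum, map_zero] at this
  exact (mul_eq_zero.1 this).resolve_right (h.diag a)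

theorem exists_coord (h : A.Frame x) (v : C3) : ∃ c : Fin 3 → ℂ, v = ∑ a, c a • x a := by
  let b := basisOfLinearIndependentOfCardEqFinrank h.linearIndependent (by simp)
  refine ⟨b.repr v, ?_⟩
  have := (b.sum_repr v).symm
  simpa [b] using this

theorem eq_smul (h : A.Frame x) (a : Fin 3) (v : C3)
    (hv : ∀ b ≠ a, (A.line (A.tri b)).rep v = 0) : ∃ c : ℂ, v = c • x a := by
  obtain ⟨c, rfl⟩ := h.exists_coord v
  refine ⟨c a, ?_⟩
  rw [Finset.sum_eq_single a _ (by simp)]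
  intro b _ hb
  have := hv b hb
  rw [h.rep_sum] at this
  rw [(mul_eq_zero.1 this).resolve_right (h.diag b), zero_smul]

theorem eq_mk (h : A.Frame x) (a : Fin 3) (p : CP2)
    (hp : ∀ b ≠ a, OnLine p (A.line (A.tri b))) : p = Projectivization.mk ℂ (x a) (h.ne_zero a) := by
  obtain ⟨v, hv, rfl⟩ := mk_surjective p
  obtain ⟨c, hc⟩ := h.eq_smul a v fun b hb => (onLine_mk_iff _ _ _).1 (hp b hb)
  rw [Projectivization.mk_eq_mk_iff']
  exact ⟨c, hc.symm⟩

theorem corner_eq (h : A.Frame x) (a : Fin 3) :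
    (A.corner a).1 = Projectivization.mk ℂ (x a) (h.ne_zero a) :=
  h.eq_mk a _ fun _ hb => A.corner_onLine hb.symm

theorem corner_onLine_iff (h : A.Frame x) (a : Fin 3) (i : Fin n) :
    OnLine (A.corner a).1 (A.line i) ↔ (A.line i).rep (x a) = 0 := by
  rw [h.corner_eq, onLine_mk_iff]

theorem corner_injective (h : A.Frame x) : Function.Injective A.corner := by
  intro a b hab
  by_contra hne
  apply h.diag a
  rw [← h.corner_onLine_iff, hab]
  exact A.corner_onLine (Ne.symm hne)

/-- In a frame the three vertices are distinct, so no two of the six edges cancel. -/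
theorem mem_chainVertices (h : A.Frame x) (v : A.Vertex) : v ∈ chainVertices A.triangle ↔
    (∃ a, v = .inl (A.tri a)) ∨ ∃ a, v = .inr (A.corner a) := by
  have ht : ∀ a b, A.tri a = A.tri b ↔ a = b := fun a b => A.tri_injective.eq_iff
  have hc : ∀ a b, A.corner a = A.corner b ↔ a = b := fun a b => h.corner_injective.eq_iff
  classical
  constructor
  · rintro ⟨w, hw⟩
    by_contra! hn
    obtain ⟨h1, h2⟩ := hn
    apply hw
    have h1' : ∀ a, ¬ Sum.inl (A.tri a) = v := fun a => (h1 a).symm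
    have h2' : ∀ a, ¬ Sum.inr (A.corner a) = v := fun a => (h2 a).symm
    simp [triangle_eq, edgeChain, h1', h2']
  · rintro (⟨a, rfl⟩ | ⟨a, rfl⟩)
    · refine ⟨.inr (A.corner (a + 2)), ?_⟩
      fin_cases a <;> simp [triangle_eq, edgeChain, ht, hc]
    · refine ⟨.inl (A.tri (a + 2)), ?_⟩
      fin_cases a <;> simp [triangle_eq, edgeChain, ht, hc]

theorem triangle_ne_zero (h : A.Frame x) : A.triangle ≠ 0 := by
  intro h0
  obtain ⟨w, hw⟩ := (h.mem_chainVertices (.inl (A.tri 0))).2 (Or.inl ⟨0, rfl⟩)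
  exact hw (by rw [h0]; rfl)

end Frame

theorem triangle_mem_graphH1 (A : Arrangement n) : A.triangle ∈ graphH1 A.incidenceGraph := by
  classical
  refine ⟨fun u v => ?_, fun u v => ?_, ?_⟩
  · simp only [triangle_eq, edgeChain, Finsupp.add_apply, Finsupp.sub_apply,
      Finsupp.single_apply, Prod.mk.injEq]
    simp only [and_comm]
    ring
  · intro h
    by_contra hn
    apply h
    have key : ∀ a b, a ≠ b → edgeChain (V := A.Vertex) (.inl (A.tri a)) (.inr (A.corner b)) (u, v) = 0 ∧
        edgeChain (V := A.Vertex) (.inr (A.corner b)) (.inl (A.tri a)) (u, v) = 0 := by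
      intro a b hab
      have h1 : A.incidenceGraph.Adj (.inl (A.tri a)) (.inr (A.corner b)) :=
        A.corner_onLine hab.symm
      have h2 : ((Sum.inl (A.tri a) : A.Vertex), (Sum.inr (A.corner b) : A.Vertex)) ≠ (u, v) := by
        rintro ⟨⟩; exact hn h1
      have h3 : ((Sum.inr (A.corner b) : A.Vertex), (Sum.inl (A.tri a) : A.Vertex)) ≠ (u, v) := by
        rintro ⟨⟩; exact hn h1.symm
      simp [edgeChain, h2, h3]
    simp only [triangle_eq, Finsupp.add_apply]
    rw [(key 0 2 (by decide)).1, (key 1 2 (by decide)).2, (key 1 0 (by decide)).1,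
      (key 2 0 (by decide)).2, (key 2 1 (by decide)).1, (key 0 1 (by decide)).2]
    simp
  · simp only [triangle_eq, edgeChain, sub_eq_add_neg, Finsupp.mapDomain_add,
      Finsupp.mapDomain_single, ← Finsupp.single_neg]
    simp only [Finsupp.single_neg]
    abel

/-- If the first three lines are concurrent, the triangle is the zero chain. -/
theorem exists_frame (A : Arrangement n) (hA : A.triangle ≠ 0) : ∃ x, A.Frame x := by
  refine ⟨fun a => (A.corner a).1.rep, ?_, fun h => A.corner_onLine h⟩
  by_contra! hn
  obtain ⟨a, ha⟩ := hn
  have hall : ∀ b, OnLine (A.corner a).1 (A.line (A.tri b)) := by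
    intro b
    by_cases hb : a = b
    · subst hb; exact ha
    · exact A.corner_onLine hb
  -- A vertex lying on its opposite side lies on all three sides, and then any two sides meet there;
  -- with all vertices equal, the six edges cancel in pairs.
  have hc : ∀ b, A.corner b = A.corner a := by
    intro b
    obtain ⟨c, d, hcd, hc, hd⟩ : ∃ c d, c ≠ d ∧ b ≠ c ∧ b ≠ d := by
      fin_cases b
      · exact ⟨1, 2, by decide⟩
      · exact ⟨0, 2, by decide⟩
      · exact ⟨0, 1, by decide⟩
    exact Subtype.ext (onLine_unique (A.injective.ne (A.tri_injective.ne hcd)) (A.corner_onLine hc)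
      (A.corner_onLine hd) (hall c) (hall d))
  apply hA
  rw [triangle_eq, hc 0, hc 1, hc 2]
  simp only [edgeChain]
  abel

/-! ### Inner-cyclicity of the triangle in terms of lines and points -/

open Classical in
/-- The product of the values of a character at the lines through a point. -/
def pointValue (A : Arrangement n) (ξ : LineCharacter n) (p : CP2) : ℂˣ :=
  ∏ i, if OnLine p (A.line i) then ξ.toFun i else 1

/-- The conditions on a character that make the triangle inner-cyclic, in terms of lines and
points. -/
structure TriangleTrivial (A : Arrangement n) (ξ : LineCharacter n) (x : Fin 3 → C3) : Prop where
  line : ∀ i a, (A.line i).rep (x a) = 0 → ξ.toFun i = 1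
  point : ∀ p a, OnLine p (A.line (A.tri a)) → A.pointValue ξ p = 1

/-- The neighbours of the cycle are the lines through the vertices of the triangle and the singular
points on its sides. Asking the point condition at every point of the sides, singular or not, costs
nothing and lets classes be indexed by arbitrary points. -/
theorem Frame.isInnerCyclic_iff {A : Arrangement n} {x : Fin 3 → C3} (h : A.Frame x)
    (ξ : LineCharacter n) :
    A.IsInnerCyclic ξ A.triangle ↔ A.TriangleTrivial ξ x := by
  constructor
  · rintro ⟨-, -, H⟩
    have hl : ∀ i a, (A.line i).rep (x a) = 0 → ξ.toFun i = 1 := by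
      intro i a hia
      refine H (.inl i) ⟨.inr (A.corner a), (h.mem_chainVertices _).2 (.inr ⟨a, rfl⟩), ?_⟩
      rw [SimpleGraph.edist_le_one_iff_adj_or_eq]
      exact .inl ((h.corner_onLine_iff a i).2 hia)
    refine ⟨hl, fun p a hp => ?_⟩
    by_cases hs : ∃ i j, i ≠ j ∧ OnLine p (A.line i) ∧ OnLine p (A.line j)
    · refine H (.inr ⟨p, hs⟩) ⟨.inl (A.tri a), (h.mem_chainVertices _).2 (.inl ⟨a, rfl⟩), ?_⟩
      rw [SimpleGraph.edist_le_one_iff_adj_or_eq]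
      exact .inl hp
    -- A nonsingular point of a side lies on that side only, where the character is 1 because the
    -- side passes through a vertex.
    · push Not at hs
      refine Finset.prod_eq_one fun i _ => ?_
      split_ifs with hi
      · by_cases hia : i = A.tri a
        · subst hia
          exact hl _ (a + 1) (h.off_diag (by fin_cases a <;> decide))
        · exact absurd hp (hs i _ hia hi)
      · rfl
  · rintro ⟨hl, hp⟩
    refine ⟨A.triangle_mem_graphH1, h.triangle_ne_zero, ?_⟩
    have hl' : ∀ a, ξ.toFun (A.tri a) = 1 := fun a =>
      hl _ (a + 1) (h.off_diag (by fin_cases a <;> decide))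
    have hp' : ∀ a, A.vertexValue ξ (.inr (A.corner a)) = 1 := fun a =>
      hp _ (a + 1) (A.corner_onLine (by fin_cases a <;> decide))
    rintro v ⟨w, hw, hvw⟩
    rw [SimpleGraph.edist_le_one_iff_adj_or_eq] at hvw
    rw [h.mem_chainVertices] at hw
    obtain ⟨a, rfl⟩ | ⟨a, rfl⟩ := hw
    · obtain hvw | rfl := hvw
      · obtain i | P := v
        · exact hvw.elim
        · exact hp P.1 a hvw
      · exact hl' a
    · obtain hvw | rfl := hvw
      · obtain i | P := v
        · exact hl i a ((h.corner_onLine_iff a i).1 hvw)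
        · exact hvw.elim
      · exact hp' a

theorem TriangleTrivial.ne_zero {A : Arrangement n} {ξ : LineCharacter n} {x : Fin 3 → C3}
    (h : A.TriangleTrivial ξ x) {i : Fin n} (hi : ξ.toFun i ≠ 1) (a : Fin 3) :
    (A.line i).rep (x a) ≠ 0 := fun h0 => hi (h.line i a h0)

/-! ### The boundary manifold -/

theorem isOpen_tube (A : Arrangement n) (δ ε : ℝ) : IsOpen (A.tube δ ε) := by
  have : A.tube δ ε = (⋃ i, {p | lineDist (A.line i) p < ε}) ∪
      ⋃ P : A.SingularPoint, {p | pointDist P.1 p < δ} := by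
    ext p; simp [tube]
  rw [this]
  exact (isOpen_iUnion fun i => isOpen_lt (continuous_lineDist _) continuous_const).union
    (isOpen_iUnion fun P => isOpen_lt (continuous_pointDist _) continuous_const)

/-- The tube is open, so its frontier is its closure minus itself. -/
theorem mem_boundary_iff (A : Arrangement n) (δ ε : ℝ) (p : CP2) : p ∈ A.boundary δ ε ↔
    p ∈ closure (A.tube δ ε) ∧ (∀ i, ε ≤ lineDist (A.line i) p) ∧
      ∀ P : A.SingularPoint, δ ≤ pointDist P.1 p := by
  rw [boundary, (A.isOpen_tube δ ε).frontier_eq, Set.mem_sdiff]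
  simp [tube]

end Arrangement

/-! ### Phases up to classes -/

section PhaseValue

variable {ι τ τ' G : Type*} [Fintype ι] [CommGroup G]

open Classical in
/-- If the product of the `ξ i` over every class is `1`, so is the product of the `ξ i ^ m i` when
the exponent is constant on the classes. -/
theorem prod_zpow_eq_one_of_classes (cl : ι → τ) (ξ : ι → G)
    (h : ∀ t, ∏ i, (if cl i = t then ξ i else 1) = 1) (m : ι → ℤ)
    (hm : ∀ i j, ξ i ≠ 1 → ξ j ≠ 1 → cl i = cl j → m i = m j) : ∏ i, ξ i ^ m i = 1 := by
  rw [← Finset.prod_fiberwise_of_maps_to (s := Finset.univ) (t := Finset.univ.image cl) (g := cl)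
    (fun i _ => Finset.mem_image_of_mem _ (Finset.mem_univ i))]
  refine Finset.prod_eq_one fun t _ => ?_
  by_cases ht : ∃ i, cl i = t ∧ ξ i ≠ 1
  · obtain ⟨i, rfl, hi⟩ := ht
    have h1 : ∀ j ∈ Finset.univ.filter (fun j => cl j = cl i), ξ j ^ m j = ξ j ^ m i := by
      intro j hj
      by_cases hξ : ξ j = 1
      · simp [hξ]
      · rw [hm j i hξ hi (Finset.mem_filter.1 hj).2]
    rw [Finset.prod_congr rfl h1, Finset.prod_zpow, Finset.prod_filter, h, one_zpow]
  · push Not at ht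
    refine Finset.prod_eq_one fun j hj => ?_
    rw [ht j (Finset.mem_filter.1 hj).2, one_zpow]

/-- The product of the `ξ i ^ m i`, where the phase `θ i` is `μ i + 2π m i` up to an error less than
`π / 2` and a term that depends only on the class of `i`. -/
def PhaseValue (cl : ι → τ) (μ : ι → ℝ) (ξ : ι → G) (θ : ι → ℝ) (z : G) : Prop :=
  ∃ (m : ι → ℤ) (ψ : ι → ℝ), (∀ i j, ξ i ≠ 1 → ξ j ≠ 1 → cl i = cl j → ψ i = ψ j) ∧
    (∀ i, ξ i ≠ 1 → |θ i - μ i - 2 * Real.pi * m i - ψ i| < Real.pi / 2) ∧ z = ∏ i, ξ i ^ m i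

variable {cl : ι → τ} {μ : ι → ℝ} {ξ : ι → G} {θ : ι → ℝ} {z z' : G}

-- For two lines of one class the terms ψ cancel in the comparison of two choices of exponents. Four
-- errors below π/2 remain, so the exponent differences differ by less than 1, hence are equal. They
-- are thus constant on classes, where the product of ξ is 1.
open Classical in
theorem PhaseValue.unique (h : ∀ t, ∏ i, (if cl i = t then ξ i else 1) = 1)
    (hz : PhaseValue cl μ ξ θ z) (hz' : PhaseValue cl μ ξ θ z') : z = z' := by
  obtain ⟨m, ψ, hψ, hm, rfl⟩ := hz
  obtain ⟨m', ψ', hψ', hm', rfl⟩ := hz'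
  rw [← div_eq_one, ← Finset.prod_div_distrib]
  simp only [div_eq_mul_inv, ← zpow_sub]
  refine prod_zpow_eq_one_of_classes cl ξ h _ fun i j hi hj hij => ?_
  have a1 := abs_lt.1 (hm i hi)
  have a2 := abs_lt.1 (hm j hj)
  have a3 := abs_lt.1 (hm' i hi)
  have a4 := abs_lt.1 (hm' j hj)
  rw [hψ i j hi hj hij] at a1
  rw [hψ' i j hi hj hij] at a3
  have hpi := Real.pi_pos
  have key : |((m i - m' i - (m j - m' j) : ℤ) : ℝ)| < 1 := by
    rw [abs_lt]
    push_cast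
    constructor
    · nlinarith
    · nlinarith
  have : |m i - m' i - (m j - m' j)| < 1 := by exact_mod_cast key
  have := Int.abs_lt_one_iff.1 this
  linarith

/-- The inequalities are strict and finite in number, so the same m and ψ serve nearby phases. -/
theorem PhaseValue.eventually (hz : PhaseValue cl μ ξ θ z) :
    ∀ᶠ θ' in 𝓝 θ, PhaseValue cl μ ξ θ' z := by
  obtain ⟨m, ψ, hψ, hm, rfl⟩ := hz
  have : ∀ᶠ θ' : ι → ℝ in 𝓝 θ, ∀ i, ξ i ≠ 1 →
      |θ' i - μ i - 2 * Real.pi * m i - ψ i| < Real.pi / 2 := by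
    rw [eventually_all]
    intro i
    by_cases hi : ξ i = 1
    · simp [hi]
    · have hc : Continuous fun θ' : ι → ℝ => |θ' i - μ i - 2 * Real.pi * m i - ψ i| := by fun_prop
      filter_upwards [hc.continuousAt.eventually_lt continuousAt_const (hm i hi)] with θ' h _
      exact h
  filter_upwards [this] with θ' h
  exact ⟨m, ψ, hψ, h, rfl⟩

-- Openness and uniqueness make the value a locally constant function on an interval, which is
-- connected.
open Classical in
theorem PhaseValue.constant (h : ∀ t, ∏ i, (if cl i = t then ξ i else 1) = 1)
    {Θ : unitInterval → ι → ℝ} (hΘ : Continuous Θ) {s t : unitInterval} (hst : s ≤ t)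
    (hex : ∀ r ∈ Set.Icc s t, ∃ z, PhaseValue cl μ ξ (Θ r) z) (hz : PhaseValue cl μ ξ (Θ s) z) :
    PhaseValue cl μ ξ (Θ t) z := by
  choose! v hv using hex
  have : PreconnectedSpace (Set.Icc s t) := isPreconnected_iff_preconnectedSpace.1 isPreconnected_Icc
  have hloc : IsLocallyConstant fun r : Set.Icc s t => v r := by
    rw [IsLocallyConstant.iff_eventually_eq]
    intro r
    have hc : ContinuousAt (fun q : Set.Icc s t => Θ q) r := by fun_prop
    filter_upwards [hc.eventually (hv r r.2).eventually] with q hq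
    exact (hv q q.2).unique h hq
  have h1 : v s = v t := hloc.apply_eq_of_preconnectedSpace ⟨s, ⟨le_rfl, hst⟩⟩ ⟨t, ⟨hst, le_rfl⟩⟩
  rw [hz.unique h (hv s ⟨le_rfl, hst⟩), h1]
  exact hv t ⟨hst, le_rfl⟩

theorem PhaseValue.shift (hz : PhaseValue cl μ ξ θ z) (w : ι → ℤ) :
    PhaseValue cl μ ξ (fun i => θ i + 2 * Real.pi * w i) (z * ∏ i, ξ i ^ w i) := by
  obtain ⟨m, ψ, hψ, hm, rfl⟩ := hz
  refine ⟨m + w, ψ, hψ, fun i hi => ?_, ?_⟩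
  · convert hm i hi using 2
    push_cast [Pi.add_apply]
    ring
  · rw [← Finset.prod_mul_distrib]
    simp only [Pi.add_apply, zpow_add]

/-- A change of reference phases is harmless if, up to the integers g, it amounts to a function of
the class, absorbed by ψ. The classes may only become finer, since ψ must stay constant on them. -/
theorem PhaseValue.change {cl' : ι → τ'} {μ' : ι → ℝ} (hz : PhaseValue cl μ ξ θ z) (g : ι → ℤ)
    (hcl : ∀ i j, cl' i = cl' j → cl i = cl j)
    (hg : ∀ i j, ξ i ≠ 1 → ξ j ≠ 1 → cl' i = cl' j →
      μ' i - μ i - 2 * Real.pi * g i = μ' j - μ j - 2 * Real.pi * g j) :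
    PhaseValue cl' μ' ξ θ (z * ∏ i, ξ i ^ (-g i)) := by
  obtain ⟨m, ψ, hψ, hm, rfl⟩ := hz
  refine ⟨fun i => m i - g i, fun i => ψ i - (μ' i - μ i - 2 * Real.pi * g i), ?_, ?_, ?_⟩
  · intro i j hi hj hij
    beta_reduce
    rw [hψ i j hi hj (hcl i j hij), hg i j hi hj hij]
  · intro i hi
    convert hm i hi using 2
    push_cast
    ring
  · rw [← Finset.prod_mul_distrib]
    simp only [sub_eq_add_neg, zpow_add]

end PhaseValue

/-! ### Transport along a walk -/

theorem walkChain_cons {V : Type*} {G : SimpleGraph V} {u v w : V} (h : G.Adj u v)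
    (p : G.Walk v w) : walkChain (SimpleGraph.Walk.cons h p) = edgeChain u v + walkChain p := by
  simp [walkChain]

/-- A value that is constant within a piece and multiplied by a homomorphism of the edge chain at
each passage ends up multiplied by that homomorphism of the whole chain. Only the chain matters, not
the walk, so all nearby cycles of one homology class give the same factor. -/
theorem walk_transport {V M : Type*} [CommGroup M] {G : SimpleGraph V}
    (R : V → unitInterval → M → Prop) (H : (V × V →₀ ℤ) →+ Additive M)
    (hconst : ∀ v s t z, s ≤ t → (∀ r ∈ Set.Icc s t, ∃ z, R v r z) → R v s z → R v t z)
    (htrans : ∀ u v s z, G.Adj u v → R u s z → (∃ z', R v s z') →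
      R v s (z * (H (edgeChain u v)).toMul))
    {u v : V} (w : G.Walk u v) (t : ℕ → unitInterval) (ht : Monotone t)
    (hw : ∀ j ≤ w.length, ∀ s ∈ Set.Icc (t j) (t (j + 1)), ∃ z, R (w.getVert j) s z)
    {z : M} (hz : R u (t 0) z) : R v (t (w.length + 1)) (z * (H (walkChain w)).toMul) := by
  induction w generalizing t z with
  | nil =>
    have := hconst _ _ _ z (ht zero_le_one) (hw 0 le_rfl) hz
    simpa [walkChain] using this
  | cons h p ih =>
    have h1 := hconst _ _ _ z (ht zero_le_one) (by simpa using hw 0 (Nat.zero_le _)) hz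
    have hw' : ∀ j ≤ p.length, ∀ s ∈ Set.Icc (t (j + 1)) (t (j + 1 + 1)),
        ∃ z, R (p.getVert j) s z := fun j hj => hw (j + 1) (by simpa using hj)
    have h2 := htrans _ _ _ z h h1 (by
      have := hw' 0 (Nat.zero_le _) (t 1) ⟨le_rfl, ht (by norm_num)⟩
      simpa using this)
    have h3 := ih (fun j => t (j + 1)) (fun a b hab => ht (by omega)) hw' h2
    rw [walkChain_cons, map_add, toMul_add, ← mul_assoc]
    exact h3

/-- The homomorphism on 1-chains with given values on the oriented edges. -/
def chainHom {V M : Type*} [CommGroup M] (g : V × V → M) : (V × V →₀ ℤ) →+ Additive M :=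
  Finsupp.liftAddHom fun e => zmultiplesHom (Additive M) (Additive.ofMul (g e))

theorem chainHom_edgeChain {V M : Type*} [CommGroup M] (g : V × V → M) (u v : V) :
    (chainHom g (edgeChain u v)).toMul = g (u, v) / g (v, u) := by
  simp only [chainHom, edgeChain, map_sub, Finsupp.liftAddHom_apply_single, zmultiplesHom_apply,
    one_zsmul, toMul_sub, toMul_ofMul]

/-! ### Comparison of arguments -/

/-- The error is the argument of the factor a, which lies in the open right half-plane. -/
theorem exists_int_of_exp_eq {w a b c : ℂ} (h : Complex.exp w = a * b * c) (ha : 0 < a.re)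
    (hb : b ≠ 0) (hc : c ≠ 0) : ∃ m : ℤ,
      |w.im - Complex.arg b - 2 * Real.pi * m - Complex.arg c| < Real.pi / 2 := by
  have ha0 : a ≠ 0 := by rintro rfl; simp at ha
  have h1 : Complex.exp w = Complex.exp (Complex.log a + Complex.log b + Complex.log c) := by
    rw [h, Complex.exp_add, Complex.exp_add, Complex.exp_log ha0, Complex.exp_log hb,
      Complex.exp_log hc]
  obtain ⟨m, hm⟩ := Complex.exp_eq_exp_iff_exists_int.1 h1
  refine ⟨m, ?_⟩
  have h2 := congrArg Complex.im hm
  simp [Complex.log_im] at h2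
  have h3 := Complex.abs_arg_lt_pi_div_two_iff.2 (Or.inl ha)
  convert h3 using 2
  rw [h2]
  ring

/-- The integer `g` with `arg a - arg b = arg (a / b) + 2πg`. -/
def argDefect (a b : ℂ) : ℤ :=
  round ((Complex.arg a - Complex.arg b - Complex.arg (a / b)) / (2 * Real.pi))

theorem round_div_two_pi {x : ℝ} {m : ℤ} (h : x = 2 * Real.pi * m) :
    round (x / (2 * Real.pi)) = m := by
  rw [h, mul_div_cancel_left₀ _ Real.two_pi_pos.ne', round_intCast]

theorem argDefect_spec {a b : ℂ} (ha : a ≠ 0) (hb : b ≠ 0) :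
    Complex.arg a - Complex.arg b = Complex.arg (a / b) + 2 * Real.pi * argDefect a b := by
  have h1 : Complex.exp (Complex.log a) = Complex.exp (Complex.log (a / b) + Complex.log b) := by
    rw [Complex.exp_add, Complex.exp_log ha, Complex.exp_log hb, Complex.exp_log (div_ne_zero ha hb),
      div_mul_cancel₀ _ hb]
  obtain ⟨m, hm⟩ := Complex.exp_eq_exp_iff_exists_int.1 h1
  have h2 := congrArg Complex.im hm
  simp [Complex.log_im] at h2
  have h3 : Complex.arg a - Complex.arg b - Complex.arg (a / b) = 2 * Real.pi * m := by linarith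
  rw [argDefect, round_div_two_pi h3]
  linarith

theorem re_pos_of_norm_sub_lt {a b : ℂ} (h : ‖a - b‖ < ‖b‖) : 0 < (a / b).re := by
  have hb : b ≠ 0 := by rintro rfl; simp at h; linarith [norm_nonneg a]
  have h1 : ‖a / b - 1‖ < 1 := by
    rw [div_sub_one hb, norm_div, div_lt_one (norm_pos_iff.2 hb)]
    exact h
  have h2 := (Complex.abs_re_le_norm (a / b - 1)).trans_lt h1
  rw [abs_lt, Complex.sub_re, Complex.one_re] at h2
  linarith

/-! ### Linear forms near the arrangement -/

/-- Near the point `[u]`, a linear form is almost a constant multiple of the coordinate along `u`. -/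
theorem eventually_form_near_point {u : C3} (hu : ‖u‖ = 1) (f : StrongDual ℂ C3) (hf : f u ≠ 0) :
    ∀ᶠ δ in 𝓝[>] (0 : ℝ), ∀ z : C3, z ≠ 0 → ‖perp u z‖ = δ * ‖z‖ →
      (inner ℂ u z : ℂ) ≠ 0 ∧ 0 < (f z / (f u * (inner ℂ u z : ℂ))).re := by
  -- Negativity of this function means that f is smaller on the orthogonal component, of length
  -- δ‖z‖, than on the component along u, of squared length (1 - δ²)‖z‖².
  have hc : ContinuousAt (fun δ : ℝ => ‖f‖ ^ 2 * δ ^ 2 - (1 - δ ^ 2) * ‖f u‖ ^ 2) 0 := by fun_prop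
  have h0 : (fun δ : ℝ => ‖f‖ ^ 2 * δ ^ 2 - (1 - δ ^ 2) * ‖f u‖ ^ 2) 0 < 0 := by
    have := norm_pos_iff.2 hf
    simp
    positivity
  filter_upwards [nhdsWithin_le_nhds (hc.eventually_lt continuousAt_const h0)] with δ hδ z hz hzδ
  have hz' := norm_pos_iff.2 hz
  have h1 := norm_sq_eq_perp hu z
  have h2 : f z = inner ℂ u z * f u + f (perp u z) := by simp [perp]
  have h3 := f.le_opNorm (perp u z)
  have h4 : ‖f (perp u z)‖ < ‖f u * (inner ℂ u z : ℂ)‖ := by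
    refine h3.trans_lt ?_
    refine lt_of_pow_lt_pow_left₀ 2 (norm_nonneg _) ?_
    rw [norm_mul, mul_pow, mul_pow, hzδ]
    rw [hzδ] at h1
    have h5 : ‖(inner ℂ u z : ℂ)‖ ^ 2 = (1 - δ ^ 2) * ‖z‖ ^ 2 := by linarith
    rw [h5]
    nlinarith [pow_pos hz' 2]
  refine ⟨fun h => ?_, re_pos_of_norm_sub_lt ?_⟩
  · rw [h, mul_zero, norm_zero] at h4
    exact absurd h4 (norm_nonneg _).not_gt
  · rwa [h2, mul_comm (inner ℂ u z : ℂ), add_sub_cancel_left]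

/-- The map z ↦ (g z, h z, ⟨s, z⟩) is injective: a vector in its kernel, if nonzero, would span with
s the plane {h = 0} and force g to be a multiple of h. An injective linear map in finite dimension
is bounded below. Hence g cannot be small where h is small and [z] is far from [s]. -/
theorem exists_perp_le {g h : StrongDual ℂ C3} {s y : C3} (hs1 : ‖s‖ = 1) (h0 : h ≠ 0)
    (hs : h s = 0) (hy : h y = 0) (gs : g s = 0) (gy : g y ≠ 0) :
    ∃ c > 0, ∀ z, c * ‖perp s z‖ ≤ ‖g z‖ + ‖h z‖ := by
  let T : C3 →ₗ[ℂ] ℂ × ℂ × ℂ :=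
    (g : C3 →ₗ[ℂ] ℂ).prod ((h : C3 →ₗ[ℂ] ℂ).prod (innerSL ℂ s : C3 →ₗ[ℂ] ℂ))
  have hT : ∀ z, T z = (g z, h z, inner ℂ s z) := fun z => rfl
  have hys : LinearIndependent ℂ ![y, s] := by
    rw [LinearIndependent.pair_iff]
    intro a b hab
    have ha : a = 0 := by
      have := congrArg g hab
      simpa [gs, gy] using this
    have hs0 : s ≠ 0 := by rintro rfl; simp at hs1
    exact ⟨ha, by simpa [ha, hs0] using hab⟩
  have hinj : LinearMap.ker T = ⊥ := by
    rw [LinearMap.ker_eq_bot']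
    intro z hz
    rw [hT] at hz
    simp only [Prod.mk_eq_zero] at hz
    obtain ⟨hg, hh, hi⟩ := hz
    by_contra hz0
    have hsz : LinearIndependent ℂ ![s, z] := by
      rw [LinearIndependent.pair_iff]
      intro a b hab
      have hb : a = 0 := by
        have := congrArg (inner ℂ s) hab
        rw [inner_add_right, inner_smul_right, inner_smul_right, hi,
          inner_self_eq_norm_sq_to_K, hs1] at this
        simpa using this
      exact ⟨hb, by simpa [hb, hz0] using hab⟩
    obtain ⟨d, hd⟩ := form_eq_mul h0 hsz hs hh gs hg
    apply gy
    rw [hd, hy, mul_zero]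
  obtain ⟨K, hK, hanti⟩ := T.exists_antilipschitzWith hinj
  refine ⟨(K : ℝ)⁻¹, by positivity, fun z => ?_⟩
  have h1 := hanti.le_mul_norm_sub (perp s z) 0
  rw [add_zero, map_zero, add_zero, norm_neg, norm_neg, hT, inner_perp hs1] at h1
  have h2 : g (perp s z) = g z := by simp [perp, gs]
  have h3 : h (perp s z) = h z := by simp [perp, hs]
  rw [h2, h3, Prod.norm_mk, Prod.norm_mk, norm_zero] at h1
  rw [inv_mul_le_iff₀ (by positivity)]
  refine h1.trans (mul_le_mul_of_nonneg_left ?_ K.2)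
  refine max_le (by linarith [norm_nonneg (h z)]) (max_le (by linarith [norm_nonneg (g z)]) ?_)
  positivity

/-- Two lines that meet the line `{h = 0}` at the same point `[s]`: along `{h = 0}` and away from
`[s]`, the quotient of their equations is almost constant. -/
theorem eventually_form_near_line {f g h : StrongDual ℂ C3} {s y : C3} (hs1 : ‖s‖ = 1)
    (h0 : h ≠ 0) (hs : h s = 0) (hy : h y = 0) (fs : f s = 0) (gs : g s = 0) (fy : f y ≠ 0)
    (gy : g y ≠ 0) {δ : ℝ} (hδ : 0 < δ) :
    ∀ᶠ ε in 𝓝[>] (0 : ℝ), ∀ z : C3, z ≠ 0 → ‖h z‖ = ε * (‖h‖ * ‖z‖) → δ * ‖z‖ ≤ ‖perp s z‖ →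
      g z ≠ 0 ∧ 0 < (f z / (f y * (g z / g y))).re := by
  have hs0 : s ≠ 0 := by rintro rfl; simp at hs1
  obtain ⟨d, hd⟩ := form_div_sub_eq_mul h0 hs0 hs hy fs gs fy gy
  obtain ⟨c, hc, hcz⟩ := exists_perp_le hs1 h0 hs hy gs gy
  -- Per unit of ‖z‖, the first term bounds the multiple of h separating f/f(y) from g/g(y), after
  -- clearing g(y), and the bracket bounds ‖g z‖ from below.
  have hcont : ContinuousAt (fun ε : ℝ => ‖d‖ * (ε * ‖h‖) * ‖g y‖ - (c * δ - ε * ‖h‖)) 0 := by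
    fun_prop
  have hneg : (fun ε : ℝ => ‖d‖ * (ε * ‖h‖) * ‖g y‖ - (c * δ - ε * ‖h‖)) 0 < 0 := by
    simp; positivity
  filter_upwards [nhdsWithin_le_nhds (hcont.eventually_lt continuousAt_const hneg),
    self_mem_nhdsWithin] with ε hε hε0 z hz hhz hzδ
  have hz' := norm_pos_iff.2 hz
  have gy' := norm_pos_iff.2 gy
  have h1 : c * (δ * ‖z‖) ≤ ‖g z‖ + ε * (‖h‖ * ‖z‖) := by
    rw [← hhz]
    exact (mul_le_mul_of_nonneg_left hzδ hc.le).trans (hcz z)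
  have h2 : ‖d‖ * (ε * (‖h‖ * ‖z‖)) * ‖g y‖ < ‖g z‖ := by nlinarith
  have h3 : g z ≠ 0 := by
    rw [← norm_pos_iff]
    refine lt_of_le_of_lt ?_ h2
    have : 0 < ε := hε0
    positivity
  refine ⟨h3, ?_⟩
  rw [← div_div]
  refine re_pos_of_norm_sub_lt ?_
  rw [hd, norm_mul, hhz, norm_div, lt_div_iff₀ gy']
  exact h2

/-! ### Transport of phases around the triangle and the explicit value -/

namespace Arrangement

variable {n : ℕ}

/-- A reference vector for every vertex of the triangle: a point of the line, or the point
itself. -/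
def base (A : Arrangement n) (x : Fin 3 → C3) : A.Vertex → C3 := by
  classical
  exact Sum.elim (fun i => if i = A.tri 0 then x 1 else if i = A.tri 1 then x 2 else x 0)
    (fun P => if P = A.corner 0 then x 0 else if P = A.corner 1 then x 1 else x 2)

theorem base_tri (A : Arrangement n) (x : Fin 3 → C3) (a : Fin 3) :
    A.base x (.inl (A.tri a)) = x (a + 1) := by
  have ht : ∀ a b, A.tri a = A.tri b ↔ a = b := fun a b => A.tri_injective.eq_iff
  fin_cases a <;> simp [base, ht]

theorem Frame.base_corner {A : Arrangement n} {x : Fin 3 → C3} (h : A.Frame x) (a : Fin 3) :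
    A.base x (.inr (A.corner a)) = x a := by
  have ht : ∀ a b, A.corner a = A.corner b ↔ a = b := fun a b => h.corner_injective.eq_iff
  fin_cases a <;> simp [base, ht]

/-- The classes of the lines relative to a vertex: two lines are in the same class relative to a
line if they meet this line at the same point; relative to a point there is only one class. -/
def label (A : Arrangement n) : A.Vertex → Fin n → CP2
  | .inl i, j => (exists_onLine (A.line j) (A.line i)).choose
  | .inr P, _ => P.1

theorem label_spec (A : Arrangement n) (i j : Fin n) :
    OnLine (A.label (.inl i) j) (A.line j) ∧ OnLine (A.label (.inl i) j) (A.line i) :=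
  (exists_onLine (A.line j) (A.line i)).choose_spec

theorem label_eq_iff (A : Arrangement n) {i j : Fin n} (hij : j ≠ i) {p : CP2}
    (hp : OnLine p (A.line i)) : A.label (.inl i) j = p ↔ OnLine p (A.line j) := by
  constructor
  · rintro rfl
    exact (A.label_spec i j).1
  · intro h
    exact onLine_unique (A.injective.ne hij) (A.label_spec i j).1 (A.label_spec i j).2 h hp

/-- The argument of the equation of a line at the reference vector of a vertex. -/
def refArg (A : Arrangement n) (x : Fin 3 → C3) (v : A.Vertex) (i : Fin n) : ℝ :=
  Complex.arg ((A.line i).rep (A.base x v))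

theorem TriangleTrivial.tri_eq_one {A : Arrangement n} {ξ : LineCharacter n} {x : Fin 3 → C3}
    (h : A.TriangleTrivial ξ x) (hx : A.Frame x) (a : Fin 3) : ξ.toFun (A.tri a) = 1 :=
  h.line _ (a + 1) (hx.off_diag (by fin_cases a <;> decide))

theorem TriangleTrivial.ne_tri {A : Arrangement n} {ξ : LineCharacter n} {x : Fin 3 → C3}
    (h : A.TriangleTrivial ξ x) (hx : A.Frame x) {i : Fin n} (hi : ξ.toFun i ≠ 1) (a : Fin 3) :
    i ≠ A.tri a := by
  rintro rfl
  exact hi (h.tri_eq_one hx a)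

-- On a side, the class of a point consists of the lines through that point; the side itself, whose
-- label is arbitrary, does not count since its value is 1. At a vertex the only class contains all
-- lines, and the total product of a character is 1.
open Classical in
theorem TriangleTrivial.prod_class {A : Arrangement n} {ξ : LineCharacter n} {x : Fin 3 → C3}
    (h : A.TriangleTrivial ξ x) (hx : A.Frame x) {v : A.Vertex}
    (hv : v ∈ chainVertices A.triangle) (t : CP2) :
    ∏ i, (if A.label v i = t then ξ.toFun i else 1) = 1 := by
  rw [hx.mem_chainVertices] at hv
  obtain ⟨a, rfl⟩ | ⟨a, rfl⟩ := hv
  · by_cases ht : OnLine t (A.line (A.tri a))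
    · refine Eq.trans ?_ (h.point t a ht)
      refine Finset.prod_congr rfl fun i _ => ?_
      by_cases hi : ξ.toFun i = 1
      · simp [hi]
      · rw [A.label_eq_iff (h.ne_tri hx hi a) ht]
    · refine Finset.prod_eq_one fun i _ => if_neg ?_
      rintro rfl
      exact ht (A.label_spec _ i).2
  · by_cases ht : (A.corner a).1 = t
    · simp [label, ht, ξ.prod_eq_one]
    · simp [label, ht]

/-- The correction factor between the reference vectors of a line and of a point on it. -/
def edgeFactor (A : Arrangement n) (ξ : LineCharacter n) (x : Fin 3 → C3) :
    A.Vertex × A.Vertex → ℂˣ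
  | (.inl i, .inr P) => ∏ k, ξ.toFun k ^
      argDefect ((A.line k).rep (A.base x (.inl i))) ((A.line k).rep (A.base x (.inr P)))
  | _ => 1

/-- The sum of the arguments of the cyclic quotients of three complex numbers, divided by `2π`, up to
the sign. -/
def triangleExponent (α β γ : ℂ) : ℤ :=
  -round ((Complex.arg (β / γ) + Complex.arg (γ / α) + Complex.arg (α / β)) / (2 * Real.pi))

/-- The explicit value of the invariant of the triangle: the exponent of the value of the character
at a line is computed from the values of an equation of this line at the three vertices. -/
def triangleValue (A : Arrangement n) (ξ : LineCharacter n) (x : Fin 3 → C3) : ℂˣ :=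
  ∏ k, ξ.toFun k ^ triangleExponent ((A.line k).rep (x 0)) ((A.line k).rep (x 1))
    ((A.line k).rep (x 2))

/-- The differences of arguments telescope around the triangle, leaving minus the arguments of the
quotients. The right-hand side sees only quotients, which makes it independent of the scaling of the
equation. -/
theorem argDefect_sum {α β γ : ℂ} (hα : α ≠ 0) (hβ : β ≠ 0) (hγ : γ ≠ 0) :
    argDefect β γ + argDefect γ α + argDefect α β = triangleExponent α β γ := by
  have h1 := argDefect_spec hβ hγ
  have h2 := argDefect_spec hγ hα
  have h3 := argDefect_spec hα hβ
  rw [triangleExponent, round_div_two_pi (m := -(argDefect β γ + argDefect γ α + argDefect α β)),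
    neg_neg]
  push_cast
  linarith

theorem argDefect_self {α : ℂ} (hα : α ≠ 0) : argDefect α α = 0 := by
  simp [argDefect, hα]

/-- The reference point of a side is one of its two vertices, so three of the six edges contribute
nothing; the other three contribute the three defects. -/
theorem TriangleTrivial.chainHom_triangle {A : Arrangement n} {ξ : LineCharacter n}
    {x : Fin 3 → C3} (h : A.TriangleTrivial ξ x) (hx : A.Frame x) :
    (chainHom (A.edgeFactor ξ x) A.triangle).toMul = A.triangleValue ξ x := by
  have hself : ∀ a b : Fin 3, a + 1 = b →
      A.edgeFactor ξ x (.inl (A.tri a), .inr (A.corner b)) = 1 := by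
    rintro a b rfl
    refine Finset.prod_eq_one fun k _ => ?_
    by_cases hk : ξ.toFun k = 1
    · simp [hk]
    · rw [A.base_tri, hx.base_corner, argDefect_self (h.ne_zero hk _), zpow_zero]
  rw [triangle_eq]
  simp only [map_add, toMul_add, chainHom_edgeChain]
  rw [hself 0 1 (by decide), hself 1 2 (by decide), hself 2 0 (by decide)]
  simp only [edgeFactor, hx.base_corner, A.base_tri, div_one, mul_one, triangleValue]
  rw [← Finset.prod_mul_distrib, ← Finset.prod_mul_distrib]
  refine Finset.prod_congr rfl fun k _ => ?_
  by_cases hk : ξ.toFun k = 1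
  · simp [hk]
  · rw [← zpow_add, ← zpow_add]
    congr 1
    exact argDefect_sum (h.ne_zero hk 0) (h.ne_zero hk 1) (h.ne_zero hk 2)

theorem Frame.adj_iff {A : Arrangement n} {x : Fin 3 → C3} (hx : A.Frame x) (a b : Fin 3) :
    A.incidenceGraph.Adj (.inl (A.tri a)) (.inr (A.corner b)) ↔ b ≠ a := by
  refine ⟨?_, fun hab => A.corner_onLine hab⟩
  rintro hadj rfl
  exact hx.diag b ((hx.corner_onLine_iff b _).1 hadj)

/-- Once the integer defect is removed, the change of reference for a line is the argument of the
quotient of its values at two points of the side. Restricted to the side, forms vanishing at the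
same point are proportional, so this argument depends only on the class. -/
theorem TriangleTrivial.phaseValue_line_of_corner {A : Arrangement n} {ξ : LineCharacter n}
    {x : Fin 3 → C3} (h : A.TriangleTrivial ξ x) (hx : A.Frame x) {a b : Fin 3} (hab : b ≠ a)
    {θ : Fin n → ℝ} {z : ℂˣ}
    (hz : PhaseValue (A.label (.inr (A.corner b))) (A.refArg x (.inr (A.corner b))) ξ.toFun θ z) :
    PhaseValue (A.label (.inl (A.tri a))) (A.refArg x (.inl (A.tri a))) ξ.toFun θ
      (z / A.edgeFactor ξ x (.inl (A.tri a), .inr (A.corner b))) := by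
  have hdiv : z / A.edgeFactor ξ x (.inl (A.tri a), .inr (A.corner b)) = z * ∏ k, ξ.toFun k ^
      (-argDefect ((A.line k).rep (A.base x (.inl (A.tri a))))
        ((A.line k).rep (A.base x (.inr (A.corner b))))) := by
    simp only [edgeFactor, zpow_neg, Finset.prod_inv_distrib, div_eq_mul_inv]
  rw [hdiv]
  refine hz.change _ (fun _ _ _ => rfl) fun i j hi hj hij => ?_
  have key : ∀ k, ξ.toFun k ≠ 1 → A.refArg x (.inl (A.tri a)) k -
      A.refArg x (.inr (A.corner b)) k - 2 * Real.pi *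
      argDefect ((A.line k).rep (A.base x (.inl (A.tri a))))
        ((A.line k).rep (A.base x (.inr (A.corner b)))) =
      Complex.arg ((A.line k).rep (x (a + 1)) / (A.line k).rep (x b)) := by
    intro k hk
    simp only [refArg, A.base_tri, hx.base_corner]
    rw [argDefect_spec (h.ne_zero hk _) (h.ne_zero hk _)]
    ring
  rw [key i hi, key j hj]
  obtain ⟨h1, h2⟩ := A.label_spec (A.tri a) i
  have h3 := (A.label_spec (A.tri a) j).1
  rw [← hij] at h3
  obtain ⟨d, hd⟩ := form_div_sub_eq_mul (A.line (A.tri a)).rep_nonzero (Projectivization.rep_nonzero _)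
    h2 (hx.off_diag hab) h1 h3 (h.ne_zero hi b) (h.ne_zero hj b)
  have := hd (x (a + 1))
  -- The difference of the forms, both normalized at `x b`, is a multiple of the equation of the
  -- side, which vanishes at `x (a + 1)`.
  rw [hx.off_diag (by fin_cases a <;> decide), mul_zero, sub_eq_zero] at this
  rw [this]

/-- On every piece along the triangle, the equations of the lines in a same class have almost
constant quotients. -/
def NearlyConstant (A : Arrangement n) (ξ : LineCharacter n) (x : Fin 3 → C3) (v : A.Vertex)
    (p : CP2) : Prop :=
  ∃ f : Fin n → ℂ, (∀ i j, ξ.toFun i ≠ 1 → ξ.toFun j ≠ 1 → A.label v i = A.label v j → f i = f j) ∧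
    ∀ i, ξ.toFun i ≠ 1 → f i ≠ 0 ∧ 0 < ((A.line i).rep p.rep / ((A.line i).rep (A.base x v) * f i)).re

/-- The common divisor c, the equation of the first line along the cycle, only rotates the class
terms ψ and does not affect the estimate. -/
theorem NearlyConstant.exists_phaseValue {A : Arrangement n} {ξ : LineCharacter n} {x : Fin 3 → C3}
    {v : A.Vertex} {p : CP2} (h : A.NearlyConstant ξ x v p)
    (hb : ∀ i, ξ.toFun i ≠ 1 → (A.line i).rep (A.base x v) ≠ 0) {c : ℂ} (hc : c ≠ 0)
    {w : Fin n → ℂ} (hw : ∀ i, Complex.exp (w i) = (A.line i).rep p.rep / c) :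
    ∃ z, PhaseValue (A.label v) (A.refArg x v) ξ.toFun (fun i => (w i).im) z := by
  obtain ⟨f, hf, hpos⟩ := h
  have : ∀ i, ∃ m : ℤ, ξ.toFun i ≠ 1 →
      |(w i).im - A.refArg x v i - 2 * Real.pi * m - Complex.arg (f i / c)| < Real.pi / 2 := by
    intro i
    by_cases hi : ξ.toFun i = 1
    · exact ⟨0, fun h => absurd hi h⟩
    · obtain ⟨hfi, hre⟩ := hpos i hi
      obtain ⟨m, hm⟩ := exists_int_of_exp_eq (w := w i) (b := (A.line i).rep (A.base x v))
        (c := f i / c) (by rw [hw]; field_simp [hb i hi]) hre (hb i hi) (div_ne_zero hfi hc)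
      exact ⟨m, fun _ => hm⟩
  choose m hm using this
  exact ⟨_, m, fun i => Complex.arg (f i / c), fun i j hi hj hij => by
    beta_reduce; rw [hf i j hi hj hij], hm, rfl⟩

theorem TriangleTrivial.base_ne_zero {A : Arrangement n} {ξ : LineCharacter n}
    {x : Fin 3 → C3} (h : A.TriangleTrivial ξ x) (hx : A.Frame x) {v : A.Vertex}
    (hv : v ∈ chainVertices A.triangle) (i : Fin n) (hi : ξ.toFun i ≠ 1) :
    (A.line i).rep (A.base x v) ≠ 0 := by
  rw [hx.mem_chainVertices] at hv
  obtain ⟨a, rfl⟩ | ⟨a, rfl⟩ := hv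
  · rw [A.base_tri]; exact h.ne_zero hi _
  · rw [hx.base_corner]; exact h.ne_zero hi _

/-- If the quotients of equations are almost constant along the pieces of the triangle, then the
character takes the explicit value at all nearby cycles. -/
theorem TriangleTrivial.character_nearbyCycle {A : Arrangement n} {ξ : LineCharacter n}
    {x : Fin 3 → C3} (h : A.TriangleTrivial ξ x) (hx : A.Frame x) {δ ε : ℝ}
    (hnear : ∀ v ∈ chainVertices A.triangle, ∀ p ∈ A.piece δ ε v, A.NearlyConstant ξ x v p)
    {b : A.Complement} {c : Path b b} (hc : A.IsNearbyCycle δ ε A.triangle c) :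
    A.character ξ b (loopClass c) = A.triangleValue ξ x := by
  obtain ⟨v, w, ⟨t, ht, ht0, ht1, hw⟩, hwγ⟩ := hc.projects
  choose θ hθ hθ0 hθ1 using fun i => exists_log (c.map (A.ratio i A.first).continuous)
  let Θ : unitInterval → Fin n → ℝ := fun s i => (θ i s).im
  have hΘ : Continuous Θ := by fun_prop
  -- The transported relation: at time s, the phases measured with the references of v have value z.
  let R : A.Vertex → unitInterval → ℂˣ → Prop := fun v s z => v ∈ chainVertices A.triangle ∧
    PhaseValue (A.label v) (A.refArg x v) ξ.toFun (Θ s) z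
  have hex : ∀ v s, (c s).1 ∈ A.piece δ ε v → ∃ z, R v s z := by
    intro v s hs
    have hv : v ∈ chainVertices A.triangle := by
      by_contra hv
      exact hc.avoids v hv s hs
    obtain ⟨z, hz⟩ := (hnear v hv _ hs).exists_phaseValue (h.base_ne_zero hx hv)
      ((c s).2 A.first) (w := fun i => θ i s) (fun i => hθ i s)
    exact ⟨z, hv, hz⟩
  have hconst : ∀ v s t z, s ≤ t → (∀ r ∈ Set.Icc s t, ∃ z, R v r z) → R v s z → R v t z := by
    intro v s t z hst hr hz
    refine ⟨hz.1, hz.2.constant (h.prod_class hx hz.1) hΘ hst fun r hr' => ?_⟩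
    obtain ⟨z, hz⟩ := hr r hr'
    exact ⟨z, hz.2⟩
  have htrans : ∀ u v s z, A.incidenceGraph.Adj u v → R u s z → (∃ z', R v s z') →
      R v s (z * (chainHom (A.edgeFactor ξ x) (edgeChain u v)).toMul) := by
    rintro u v s z huv ⟨hu, hz⟩ ⟨z', hv, hz'⟩
    refine ⟨hv, ?_⟩
    rw [chainHom_edgeChain]
    have hu' := (hx.mem_chainVertices u).1 hu
    have hv' := (hx.mem_chainVertices v).1 hv
    obtain ⟨a, rfl⟩ | ⟨a, rfl⟩ := hu' <;> obtain ⟨b, rfl⟩ | ⟨b, rfl⟩ := hv'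
    · exact huv.elim
    -- Going from a side to a vertex merges classes, so the value cannot be pushed forward directly.
    -- Instead, a value known to exist at the vertex is carried back to the side, where uniqueness
    -- identifies it.
    · have h1 := h.phaseValue_line_of_corner hx ((hx.adj_iff a b).1 huv) hz'
      have h2 := hz.unique (h.prod_class hx hu) h1
      show PhaseValue _ _ _ _ (z * (A.edgeFactor ξ x (.inl (A.tri a), .inr (A.corner b)) / 1))
      rwa [h2, div_one, div_mul_cancel]
    · show PhaseValue _ _ _ _ (z * (1 / A.edgeFactor ξ x (.inl (A.tri b), .inr (A.corner a))))
      rw [mul_one_div]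
      exact h.phaseValue_line_of_corner hx ((hx.adj_iff b a).1 huv.symm) hz
    · exact huv.elim
  obtain ⟨z, hz⟩ := hex v (t 0) (by
    have := hw 0 (Nat.zero_le _) (t 0) ⟨le_rfl, ht zero_le_one⟩
    simpa using this)
  have h1 := walk_transport R _ hconst htrans w t ht (fun j hj s hs => hex _ _ (hw j hj s hs)) hz
  rw [hwγ, h.chainHom_triangle hx, ht1] at h1
  rw [ht0] at hz
  -- The end phases are the initial ones shifted by the winding numbers; comparing this with the
  -- transported value at the last vertex of the closed walk gives the formula.
  have h2 := hz.2.shift fun i => winding (c.map (A.ratio i A.first).continuous)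
  have h3 : (fun i => Θ 0 i + 2 * Real.pi * winding (c.map (A.ratio i A.first).continuous)) = Θ 1 := by
    funext i
    simp only [Θ, hθ0, hθ1]
    simp
    ring
  rw [h3] at h2
  have h4 := h2.unique (h.prod_class hx hz.1) h1.2
  rw [character_loopClass]
  exact mul_left_cancel h4

theorem TriangleTrivial.eventually_nearlyConstant {A : Arrangement n} {ξ : LineCharacter n}
    {x : Fin 3 → C3} (h : A.TriangleTrivial ξ x) (hx : A.Frame x) :
    ∀ᶠ δ in 𝓝[>] (0 : ℝ), ∀ᶠ ε in 𝓝[>] (0 : ℝ), ∀ v ∈ chainVertices A.triangle,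
      ∀ p ∈ A.piece δ ε v, A.NearlyConstant ξ x v p := by
  have hcorner : ∀ᶠ δ in 𝓝[>] (0 : ℝ), ∀ a, ∀ ε, ∀ p ∈ A.piece δ ε (.inr (A.corner a)),
      A.NearlyConstant ξ x (.inr (A.corner a)) p := by
    rw [eventually_all]
    intro a
    obtain ⟨u, hu0, hup, hu1⟩ := mk_surjective_unit (A.corner a).1
    obtain ⟨r, hr⟩ : ∃ r : ℂ, r • u = x a := by
      rw [hx.corner_eq, Eq.comm, Projectivization.mk_eq_mk_iff'] at hup
      exact hup
    have hr0 : r ≠ 0 := by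
      rintro rfl
      exact hx.ne_zero a (by rw [← hr, zero_smul])
    have hfu : ∀ i, (A.line i).rep (x a) = r * (A.line i).rep u := fun i => by
      rw [← hr, map_smul, smul_eq_mul]
    have hev : ∀ᶠ δ in 𝓝[>] (0 : ℝ), ∀ i, ξ.toFun i ≠ 1 → ∀ z : C3, z ≠ 0 →
        ‖perp u z‖ = δ * ‖z‖ → (inner ℂ u z : ℂ) ≠ 0 ∧
          0 < ((A.line i).rep z / ((A.line i).rep u * (inner ℂ u z : ℂ))).re := by
      rw [eventually_all]
      intro i
      by_cases hi : ξ.toFun i = 1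
      · simp [hi]
      · have hne : (A.line i).rep u ≠ 0 := by
          intro h0
          exact h.ne_zero hi a (by rw [hfu, h0, mul_zero])
        filter_upwards [eventually_form_near_point hu1 (A.line i).rep hne] with δ hδ _
        exact hδ
    filter_upwards [hev] with δ hδ ε p hp
    have hpd : ‖perp u p.rep‖ = δ * ‖p.rep‖ := by
      have h1 : pointDist (A.corner a).1 p = δ := hp.2
      rw [← hup] at h1
      conv at h1 => enter [1, 2]; rw [← p.mk_rep]
      rw [pointDist_mk_perp hu1] at h1
      rw [← h1, div_mul_cancel₀ _ (norm_ne_zero_iff.2 p.rep_nonzero)]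
    -- The coordinate along u, rescaled because the reference vector is r u and not the unit vector
    -- u.
    refine ⟨fun _ => inner ℂ u p.rep / r, fun _ _ _ _ _ => rfl, fun i hi => ?_⟩
    obtain ⟨h1, h2⟩ := hδ i hi p.rep p.rep_nonzero hpd
    refine ⟨div_ne_zero h1 hr0, ?_⟩
    rw [hx.base_corner, hfu]
    convert h2 using 3
    field_simp
  have hline : ∀ᶠ δ in 𝓝[>] (0 : ℝ), ∀ᶠ ε in 𝓝[>] (0 : ℝ), ∀ a,
      ∀ p ∈ A.piece δ ε (.inl (A.tri a)), A.NearlyConstant ξ x (.inl (A.tri a)) p := by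
    filter_upwards [self_mem_nhdsWithin] with δ hδ
    rw [eventually_all]
    intro a
    have hya : (A.line (A.tri a)).rep (x (a + 1)) = 0 := hx.off_diag (by fin_cases a <;> decide)
    have hev : ∀ᶠ ε in 𝓝[>] (0 : ℝ), ∀ i k, ξ.toFun i ≠ 1 → ξ.toFun k ≠ 1 →
        A.label (.inl (A.tri a)) k = A.label (.inl (A.tri a)) i →
        ∀ p ∈ A.piece δ ε (.inl (A.tri a)), (A.line k).rep p.rep ≠ 0 ∧
          0 < ((A.line i).rep p.rep / ((A.line i).rep (x (a + 1)) *
            ((A.line k).rep p.rep / (A.line k).rep (x (a + 1))))).re := by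
      rw [eventually_all]
      intro i
      rw [eventually_all]
      intro k
      by_cases hi : ξ.toFun i = 1
      · simp [hi]
      by_cases hk : ξ.toFun k = 1
      · simp [hk]
      by_cases hik : A.label (.inl (A.tri a)) k = A.label (.inl (A.tri a)) i
      swap
      · simp [hik]
      obtain ⟨h1, h2⟩ := A.label_spec (A.tri a) i
      have h3 := (A.label_spec (A.tri a) k).1
      rw [hik] at h3
      obtain ⟨s, hs0, hs, hs1⟩ := mk_surjective_unit (A.label (.inl (A.tri a)) i)
      -- A line with ξ ≠ 1 is not a side, so its meeting point with the side is singular and the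
      -- boundary manifold keeps at distance δ from it.
      have hS : ∃ i' j', i' ≠ j' ∧ OnLine (A.label (.inl (A.tri a)) i) (A.line i') ∧
        OnLine (A.label (.inl (A.tri a)) i) (A.line j') := ⟨_, _, h.ne_tri hx hi a, h1, h2⟩
      have hpd : ∀ p, pointDist (A.label (.inl (A.tri a)) i) p = ‖perp s p.rep‖ / ‖p.rep‖ := by
        intro p
        rw [← hs]
        conv_lhs => enter [2]; rw [← p.mk_rep]
        exact pointDist_mk_perp hs1 hs0 p.rep_nonzero
      rw [← hs, onLine_mk_iff] at h1 h2 h3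
      filter_upwards [eventually_form_near_line hs1 (A.line (A.tri a)).rep_nonzero h2 hya h1 h3
        (h.ne_zero hi _) (h.ne_zero hk _) hδ] with ε hε _ _ _ p hp
      have hp0 := norm_pos_iff.2 p.rep_nonzero
      refine hε p.rep p.rep_nonzero ?_ ?_
      · have h4 : lineDist (A.line (A.tri a)) p = ε := hp.2
        rw [lineDist, div_eq_iff] at h4
        · exact h4
        · exact mul_ne_zero (norm_ne_zero_iff.2 (Projectivization.rep_nonzero _)) hp0.ne'
      · have h4 := ((A.mem_boundary_iff δ ε p).1 hp.1).2.2 ⟨_, hS⟩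
        rwa [hpd, le_div_iff₀ hp0] at h4
    filter_upwards [hev] with ε hε p hp
    have : Nonempty (Fin n) := ⟨A.first⟩
    -- A representative line for each class; its normalized equation serves as the common factor of
    -- the class.
    let κ : CP2 → Fin n := fun S => Classical.epsilon fun k =>
      ξ.toFun k ≠ 1 ∧ A.label (.inl (A.tri a)) k = S
    have hκ : ∀ i, ξ.toFun i ≠ 1 → ξ.toFun (κ (A.label (.inl (A.tri a)) i)) ≠ 1 ∧
        A.label (.inl (A.tri a)) (κ (A.label (.inl (A.tri a)) i)) = A.label (.inl (A.tri a)) i :=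
      fun i hi => Classical.epsilon_spec (p := fun k => ξ.toFun k ≠ 1 ∧
        A.label (.inl (A.tri a)) k = A.label (.inl (A.tri a)) i) ⟨i, hi, rfl⟩
    refine ⟨fun i => (A.line (κ (A.label (.inl (A.tri a)) i))).rep p.rep /
      (A.line (κ (A.label (.inl (A.tri a)) i))).rep (x (a + 1)), fun i j _ _ hij => by
        beta_reduce; rw [hij], fun i hi => ?_⟩
    obtain ⟨h1, h2⟩ := hκ i hi
    obtain ⟨h3, h4⟩ := hε i _ hi h1 h2 p hp
    rw [A.base_tri]
    exact ⟨div_ne_zero h3 (h.ne_zero h1 _), h4⟩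
  filter_upwards [hcorner, hline] with δ h1 h2
  filter_upwards [h2] with ε h3 v hv p hp
  rw [hx.mem_chainVertices] at hv
  obtain ⟨a, rfl⟩ | ⟨a, rfl⟩ := hv
  · exact h3 a p hp
  · exact h1 a ε p hp

end Arrangement

/-! ### Generic frames -/

/-- Each nonzero value forbids a single unit phase, and the circle is infinite. -/
theorem exists_phase_avoiding {ι : Type*} [Finite ι] (f : ι → ℂ) :
    ∃ u : ℂ, ‖u‖ = 1 ∧ ∀ i, ∀ r : ℝ, 0 < r → u * f i ≠ -r := by
  have hinf : (Metric.sphere (0 : ℂ) 1).Infinite := by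
    refine (isPreconnected_sphere (by simp [Complex.rank_real_complex]) 0 1).infinite_of_nontrivial ?_
    exact ⟨1, by simp, -1, by simp, by norm_num⟩
  have hfin : (Set.range fun i => -(‖f i‖ : ℂ) / f i).Finite := Set.finite_range _
  obtain ⟨u, hu, hu'⟩ := (hinf.sdiff hfin).nonempty
  have hu1 : ‖u‖ = 1 := by simpa using hu
  refine ⟨u, hu1, fun i r hr h => hu' ⟨i, ?_⟩⟩
  have hfi : f i ≠ 0 := by
    intro h0
    rw [h0, mul_zero, zero_eq_neg] at h
    exact hr.ne' (by exact_mod_cast h)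
  have h1 := congrArg norm h
  rw [norm_mul, hu1, one_mul, norm_neg, Complex.norm_real, Real.norm_of_nonneg hr.le] at h1
  beta_reduce
  rw [h1, ← h, mul_div_cancel_right₀ _ hfi]

theorem add_ne_zero_of_not_neg {α β : ℂ} (h0 : α = 0 → β ≠ 0) (h : ∀ r : ℝ, 0 < r → β / α ≠ -r)
    {s t : ℝ} (hs : 0 < s) (ht : 0 < t) : (s : ℂ) * α + t * β ≠ 0 := by
  have ht' : (t : ℂ) ≠ 0 := by exact_mod_cast ht.ne'
  by_cases hα : α = 0
  · simpa [hα, ht'] using h0 hα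
  · intro h1
    apply h (s / t) (by positivity)
    push_cast
    field_simp
    linear_combination h1

namespace Arrangement

variable {n : ℕ}

/-- A frame of unit vectors such that the edges of the corresponding real triangle do not meet the
other lines of the arrangement. -/
structure GenericFrame (A : Arrangement n) (x : Fin 3 → C3) : Prop extends A.Frame x where
  norm_one : ∀ a, ‖x a‖ = 1
  generic : ∀ i, (∀ a, i ≠ A.tri a) → ∀ {a b}, a ≠ b → ∀ {s t : ℝ}, 0 < s → 0 < t →
    (s : ℂ) * (A.line i).rep (x a) + t * (A.line i).rep (x b) ≠ 0

theorem Frame.smul {A : Arrangement n} {x : Fin 3 → C3} (h : A.Frame x) {u : Fin 3 → ℂ}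
    (hu : ∀ a, u a ≠ 0) : A.Frame fun a => u a • x a where
  diag a := by simpa [hu a] using h.diag a
  off_diag hab := by simp [h.off_diag hab]

theorem Frame.exists_third (a b : Fin 3) (hab : a ≠ b) : ∃ c, a ≠ c ∧ b ≠ c := by
  revert a b; decide

/-- A line other than the sides shares at most one point with the side joining the two vertices. -/
theorem Frame.rep_ne_zero_of_eq_zero {A : Arrangement n} {x : Fin 3 → C3} (h : A.Frame x) {i : Fin n}
    (hi : ∀ a, i ≠ A.tri a) {a b : Fin 3} (hab : a ≠ b) (ha : (A.line i).rep (x a) = 0) :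
    (A.line i).rep (x b) ≠ 0 := by
  intro hb
  obtain ⟨c, hac, hbc⟩ := Frame.exists_third a b hab
  apply hab
  apply h.corner_injective
  refine Subtype.ext (onLine_unique (A.injective.ne (hi c)) ?_ (A.corner_onLine hac) ?_
    (A.corner_onLine hbc))
  · exact (h.corner_onLine_iff _ _).2 ha
  · exact (h.corner_onLine_iff _ _).2 hb

theorem Frame.exists_genericFrame {A : Arrangement n} {x₀ : Fin 3 → C3} (h₀ : A.Frame x₀) :
    ∃ x, A.GenericFrame x := by
  obtain ⟨x, h, h1⟩ : ∃ x, A.Frame x ∧ ∀ a, ‖x a‖ = 1 := by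
    refine ⟨fun a => ((‖x₀ a‖⁻¹ : ℝ) : ℂ) • x₀ a, h₀.smul fun a => ?_, fun a => ?_⟩
    · simpa using h₀.ne_zero a
    · rw [norm_smul, Complex.norm_real, norm_inv, norm_norm,
        inv_mul_cancel₀ (norm_ne_zero_iff.2 (h₀.ne_zero a))]
  -- The phase u of the second vector settles the edge 01; with u fixed, v settles the edges 02 and
  -- 12 at once. The first vector keeps its phase.
  obtain ⟨u, hu, hu'⟩ := exists_phase_avoiding fun i => (A.line i).rep (x 1) / (A.line i).rep (x 0)
  obtain ⟨v, hv, hv'⟩ := exists_phase_avoiding (Sum.elim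
    (fun i => (A.line i).rep (x 2) / (A.line i).rep (x 0))
    (fun i => (A.line i).rep (x 2) / (A.line i).rep (u • x 1)))
  have hw : ∀ a, ‖(![1, u, v] : Fin 3 → ℂ) a‖ = 1 := by
    intro a
    fin_cases a
    exacts [by simp, hu, hv]
  have hF : A.Frame fun a => (![1, u, v] : Fin 3 → ℂ) a • x a := by
    refine h.smul fun a h0 => ?_
    have := hw a
    rw [h0, norm_zero] at this
    exact zero_ne_one this
  refine ⟨_, hF, fun a => by rw [norm_smul, hw, h1, one_mul], fun i hi => ?_⟩
  have h01 : ∀ r : ℝ, 0 < r → (A.line i).rep ((![1, u, v] : Fin 3 → ℂ) 1 • x 1) /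
      (A.line i).rep ((![1, u, v] : Fin 3 → ℂ) 0 • x 0) ≠ -r := by
    intro r hr
    have := hu' i r hr
    simpa [mul_div_assoc] using this
  have h02 : ∀ r : ℝ, 0 < r → (A.line i).rep ((![1, u, v] : Fin 3 → ℂ) 2 • x 2) /
      (A.line i).rep ((![1, u, v] : Fin 3 → ℂ) 0 • x 0) ≠ -r := by
    intro r hr
    have := hv' (.inl i) r hr
    simpa [mul_div_assoc] using this
  have h12 : ∀ r : ℝ, 0 < r → (A.line i).rep ((![1, u, v] : Fin 3 → ℂ) 2 • x 2) /
      (A.line i).rep ((![1, u, v] : Fin 3 → ℂ) 1 • x 1) ≠ -r := by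
    intro r hr
    have := hv' (.inr i) r hr
    simpa [mul_div_assoc] using this
  have key : ∀ a b : Fin 3, a < b → ∀ s t : ℝ, 0 < s → 0 < t →
      (s : ℂ) * (A.line i).rep ((![1, u, v] : Fin 3 → ℂ) a • x a) +
        t * (A.line i).rep ((![1, u, v] : Fin 3 → ℂ) b • x b) ≠ 0 := by
    intro a b hab s t hs ht
    refine add_ne_zero_of_not_neg (hF.rep_ne_zero_of_eq_zero hi hab.ne) ?_ hs ht
    fin_cases a <;> fin_cases b <;> first | exact absurd hab (by decide) | assumption
  intro a b hab s t hs ht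
  rcases lt_or_gt_of_ne hab with hab | hab
  · exact key a b hab s t hs ht
  · rw [add_comm]
    exact key b a hab t s ht hs

end Arrangement

/-! ### Compactness -/

/-- The maximum of f and g is positive on a compact set, hence bounded below. This is the source of
all separation constants: near the zero set of f, g is not small. -/
theorem IsCompact.eventually_le_max {X : Type*} [TopologicalSpace X] {K : Set X} (hK : IsCompact K)
    {f g : X → ℝ} (hf : Continuous f) (hg : Continuous g) (h0 : ∀ p ∈ K, 0 ≤ f p)
    (h : ∀ p ∈ K, f p = 0 → 0 < g p) :
    ∀ᶠ d in 𝓝[>] (0 : ℝ), ∀ p ∈ K, d ≤ max (f p) (g p) := by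
  rcases K.eq_empty_or_nonempty with rfl | hne
  · simp
  obtain ⟨p, hp, hmin⟩ := hK.exists_isMinOn hne (hf.max hg).continuousOn
  have hpos : 0 < max (f p) (g p) := by
    rcases (h0 p hp).eq_or_lt with h1 | h1
    · exact lt_max_of_lt_right (h p hp h1.symm)
    · exact lt_max_of_lt_left h1
  filter_upwards [Ioo_mem_nhdsGT hpos] with d hd q hq
  exact hd.2.le.trans (hmin hq)

/-- By homogeneity it suffices to bound the norm below on the segment s + t = 1, which is compact
and avoids 0. -/
theorem eventually_mul_add_le_norm {E : Type*} [NormedAddCommGroup E] [NormedSpace ℂ E] {p q : E}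
    (h : ∀ s t : ℝ, 0 ≤ s → 0 ≤ t → (s : ℂ) • p + (t : ℂ) • q = 0 → s + t = 0) :
    ∀ᶠ d in 𝓝[>] (0 : ℝ), ∀ s t : ℝ, 0 ≤ s → 0 ≤ t → d * (s + t) ≤ ‖(s : ℂ) • p + (t : ℂ) • q‖ := by
  have h1 := (isCompact_Icc (a := (0 : ℝ)) (b := 1)).eventually_le_max (f := fun _ => 0)
    (g := fun s : ℝ => ‖(s : ℂ) • p + ((1 - s : ℝ) : ℂ) • q‖) continuous_const
    (by fun_prop) (fun _ _ => le_rfl) (by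
      intro s hs _
      refine norm_pos_iff.2 fun h0 => ?_
      have := h s (1 - s) hs.1 (by linarith [hs.2]) h0
      linarith)
  filter_upwards [h1] with d hd s t hs ht
  rcases (add_nonneg hs ht).eq_or_lt with h0 | hpos
  · rw [← h0, mul_zero]; exact norm_nonneg _
  · have h2 := hd (s / (s + t)) ⟨by positivity, by rw [div_le_one hpos]; linarith⟩
    rw [max_eq_right (norm_nonneg _)] at h2
    have h3 : (s : ℂ) • p + (t : ℂ) • q = ((s + t : ℝ) : ℂ) •
        (((s / (s + t) : ℝ) : ℂ) • p + ((1 - s / (s + t) : ℝ) : ℂ) • q) := by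
      have : ((s + t : ℝ) : ℂ) ≠ 0 := by exact_mod_cast hpos.ne'
      push_cast at this
      rw [smul_add, smul_smul, smul_smul]
      push_cast
      congr 2
      · field_simp
      · field_simp; ring
    rw [h3, norm_smul, Complex.norm_real, Real.norm_of_nonneg hpos.le, mul_comm]
    exact mul_le_mul_of_nonneg_left h2 hpos.le

/-! ### Positive roots of quadratic equations -/

section Root

variable {E : Type*} [NormedAddCommGroup E] [InnerProductSpace ℂ E]

theorem norm_sq_real_smul_add (r : ℝ) (u v : E) :
    ‖(r : ℂ) • u + v‖ ^ 2 = r ^ 2 * ‖u‖ ^ 2 + 2 * r * (inner ℂ u v : ℂ).re + ‖v‖ ^ 2 := by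
  rw [norm_add_sq (𝕜 := ℂ), norm_smul, inner_smul_left, Complex.norm_real, mul_pow,
    Real.norm_eq_abs, sq_abs]
  simp
  ring

/-- Squaring gives a quadratic in r with negative constant term ‖v‖² - k², so its roots cannot both
be nonnegative unless they coincide. -/
theorem root_unique {u v : E} {k r r' : ℝ} (hv : ‖v‖ < k) (hr : 0 ≤ r) (hr' : 0 ≤ r')
    (h : ‖(r : ℂ) • u + v‖ = k) (h' : ‖(r' : ℂ) • u + v‖ = k) : r = r' := by
  have e := norm_sq_real_smul_add r u v
  have e' := norm_sq_real_smul_add r' u v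
  rw [h] at e
  rw [h'] at e'
  have hvk : ‖v‖ ^ 2 < k ^ 2 := pow_lt_pow_left₀ hv (norm_nonneg _) two_ne_zero
  have hmul : (r - r') * ((r + r') * ‖u‖ ^ 2 + 2 * (inner ℂ u v : ℂ).re) = 0 := by
    linear_combination e' - e
  rcases mul_eq_zero.1 hmul with h1 | h1
  · linarith
  · exfalso
    have : k ^ 2 - ‖v‖ ^ 2 = - (r * r' * ‖u‖ ^ 2) := by linear_combination e + r * h1
    have : 0 ≤ r * r' * ‖u‖ ^ 2 := by positivity
    linarith

/-- The positive solution `r` of `‖r u + v‖ = k`, if `‖v‖ < k`. -/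
def posRoot (u v : E) (k : ℝ) : ℝ :=
  (Real.sqrt ((inner ℂ u v : ℂ).re ^ 2 + ‖u‖ ^ 2 * (k ^ 2 - ‖v‖ ^ 2)) - (inner ℂ u v : ℂ).re) /
    ‖u‖ ^ 2

theorem posRoot_spec {u v : E} {k : ℝ} (hv : ‖v‖ < k) (hu : u ≠ 0) :
    0 < posRoot u v k ∧ ‖(posRoot u v k : ℂ) • u + v‖ = k := by
  have hu' := norm_pos_iff.2 hu
  have hvk : ‖v‖ ^ 2 < k ^ 2 := pow_lt_pow_left₀ hv (norm_nonneg _) two_ne_zero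
  have hk : 0 < k := (norm_nonneg _).trans_lt hv
  have hpos : 0 < ‖u‖ ^ 2 * (k ^ 2 - ‖v‖ ^ 2) := mul_pos (by positivity) (by linarith)
  have hs := Real.sq_sqrt (add_nonneg (sq_nonneg (inner ℂ u v : ℂ).re) hpos.le)
  constructor
  · refine div_pos (sub_pos.2 ?_) (by positivity)
    refine (le_abs_self _).trans_lt ?_
    rw [← Real.sqrt_sq_eq_abs]
    exact Real.sqrt_lt_sqrt (sq_nonneg _) (by linarith)
  · have h1 : ‖(posRoot u v k : ℂ) • u + v‖ ^ 2 = k ^ 2 := by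
      rw [norm_sq_real_smul_add, posRoot]
      set s := Real.sqrt ((inner ℂ u v : ℂ).re ^ 2 + ‖u‖ ^ 2 * (k ^ 2 - ‖v‖ ^ 2))
      field_simp
      linear_combination hs
    exact (pow_left_inj₀ (norm_nonneg _) hk.le two_ne_zero).1 h1

theorem continuousOn_posRoot {X : Type*} [TopologicalSpace X] {K : Set X} {u v : X → E} {k : ℝ}
    (hu : ContinuousOn u K) (hv : ContinuousOn v K) (h0 : ∀ p ∈ K, u p ≠ 0) :
    ContinuousOn (fun p => posRoot (u p) (v p) k) K := by
  unfold posRoot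
  refine ContinuousOn.div ?_ (by fun_prop) fun p hp => pow_ne_zero 2 (norm_ne_zero_iff.2 (h0 p hp))
  have h1 : ContinuousOn (fun p => (inner ℂ (u p) (v p) : ℂ).re) K :=
    Complex.continuous_re.comp_continuousOn (hu.inner hv)
  exact (Real.continuous_sqrt.comp_continuousOn (by fun_prop)).sub h1

end Root

/-! ### The real triangle -/

/-- The vector with given real coordinates. -/
def realComb (x : Fin 3 → C3) (q : Fin 3 → ℝ) : C3 := ∑ a, (q a : ℂ) • x a

theorem continuous_realComb (x : Fin 3 → C3) : Continuous (realComb x) := by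
  unfold realComb; fun_prop

theorem sum_fin_three {M : Type*} [AddCommMonoid M] {a b c : Fin 3} (hab : a ≠ b) (hac : a ≠ c)
    (hbc : b ≠ c) (f : Fin 3 → M) : ∑ i, f i = f a + f b + f c := by
  have : (Finset.univ : Finset (Fin 3)) = {a, b, c} := by revert a b c; decide
  rw [this, Finset.sum_insert (by simp [hab, hac]), Finset.sum_pair hbc, add_assoc]

theorem realComb_eq (x : Fin 3 → C3) {a b c : Fin 3} (hab : a ≠ b) (hac : a ≠ c)
    (hbc : b ≠ c) (q : Fin 3 → ℝ) :
    realComb x q = (q a : ℂ) • x a + ((q b : ℂ) • x b + (q c : ℂ) • x c) := by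
  rw [realComb, sum_fin_three hab hac hbc, add_assoc]

/-- The real triangle: the unit vectors with nonnegative real coordinates. -/
def realTriangle (x : Fin 3 → C3) : Set (Fin 3 → ℝ) := {q | (∀ a, 0 ≤ q a) ∧ ‖realComb x q‖ = 1}

theorem realComb_ne_zero {x : Fin 3 → C3} {q : Fin 3 → ℝ} (hq : q ∈ realTriangle x) :
    realComb x q ≠ 0 := by
  intro h
  have := hq.2
  rw [h, norm_zero] at this
  exact zero_ne_one this

/-- The sine of the distance to the vertex `x a`. -/
def cornerDist (x : Fin 3 → C3) (a : Fin 3) (q : Fin 3 → ℝ) : ℝ := ‖perp (x a) (realComb x q)‖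

theorem continuous_cornerDist (x : Fin 3 → C3) (a : Fin 3) : Continuous (cornerDist x a) :=
  ((continuous_perp _).comp (continuous_realComb x)).norm

theorem perp_add (u v w : C3) : perp u (v + w) = perp u v + perp u w :=
  (isLinearMap_perp u).map_add v w

theorem perp_smul (u : C3) (c : ℂ) (v : C3) : perp u (c • v) = c • perp u v :=
  (isLinearMap_perp u).map_smul c v

theorem perp_self {u : C3} (hu : ‖u‖ = 1) : perp u u = 0 := by
  rw [perp, inner_self_eq_norm_sq_to_K, hu]
  simp

/-- The constant speed at which one leaves the side `{ℓ = 0}` in the direction of `v`. -/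
def sideSlope (L : ProjLine) (v : C3) : ℝ := ‖L.rep v‖ / ‖L.rep‖

namespace Arrangement

variable {n : ℕ} {A : Arrangement n} {x : Fin 3 → C3}

theorem finite_singularPoint (A : Arrangement n) : Finite A.SingularPoint := by
  have : Function.Surjective fun p : {p : Fin n × Fin n // p.1 ≠ p.2} => A.meet p.1.1 p.1.2 p.2 := by
    rintro ⟨p, i, j, hij, hi, hj⟩
    exact ⟨⟨(i, j), hij⟩, Subtype.ext (onLine_unique (A.injective.ne hij)
      (A.meet_onLine i j hij).1 (A.meet_onLine i j hij).2 hi hj)⟩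
  exact Finite.of_surjective _ this

theorem lineDist_realComb (L : ProjLine) {q : Fin 3 → ℝ} (hq : q ∈ realTriangle x) :
    lineDist L (Projectivization.mk ℂ _ (realComb_ne_zero hq)) = sideSlope L (realComb x q) := by
  rw [lineDist_mk, hq.2, mul_one, sideSlope]

namespace GenericFrame

theorem slope_pos (h : A.GenericFrame x) (a : Fin 3) : 0 < sideSlope (A.line (A.tri a)) (x a) :=
  div_pos (norm_pos_iff.2 (h.diag a)) (norm_pos_iff.2 (Projectivization.rep_nonzero _))

theorem sideSlope_tri (h : A.GenericFrame x) (a : Fin 3) {q : Fin 3 → ℝ} (hq : q ∈ realTriangle x) :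
    sideSlope (A.line (A.tri a)) (realComb x q) = sideSlope (A.line (A.tri a)) (x a) * q a := by
  have h1 : (A.line (A.tri a)).rep (realComb x q) = q a * (A.line (A.tri a)).rep (x a) :=
    h.rep_sum (fun b => (q b : ℂ)) a
  rw [sideSlope, h1, norm_mul, Complex.norm_real, Real.norm_of_nonneg (hq.1 a), sideSlope]
  ring

theorem pointDist_corner (h : A.GenericFrame x) (a : Fin 3) {q : Fin 3 → ℝ}
    (hq : q ∈ realTriangle x) : pointDist (A.corner a).1
      (Projectivization.mk ℂ _ (realComb_ne_zero hq)) = cornerDist x a q := by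
  rw [h.corner_eq, pointDist_mk_perp (h.norm_one a), hq.2, div_one, cornerDist]

theorem cornerDist_eq (h : A.GenericFrame x) {a b c : Fin 3} (hab : a ≠ b) (hac : a ≠ c)
    (hbc : b ≠ c) (q : Fin 3 → ℝ) : cornerDist x a q =
      ‖(q b : ℂ) • perp (x a) (x b) + (q c : ℂ) • perp (x a) (x c)‖ := by
  rw [cornerDist, realComb_eq x hab hac hbc, perp_add, perp_add, perp_smul, perp_smul, perp_smul,
    perp_self (h.norm_one a), smul_zero, zero_add]

theorem cornerDist_le (h : A.GenericFrame x) {a b c : Fin 3} (hab : a ≠ b) (hac : a ≠ c)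
    (hbc : b ≠ c) {q : Fin 3 → ℝ} (hq : ∀ a, 0 ≤ q a) : cornerDist x a q ≤ q b + q c := by
  rw [h.cornerDist_eq hab hac hbc]
  refine (norm_add_le _ _).trans (add_le_add ?_ ?_)
  · rw [norm_smul, Complex.norm_real, Real.norm_of_nonneg (hq b)]
    have := norm_perp_le (h.norm_one a) (x b)
    rw [h.norm_one b] at this
    exact mul_le_of_le_one_right (hq b) this
  · rw [norm_smul, Complex.norm_real, Real.norm_of_nonneg (hq c)]
    have := norm_perp_le (h.norm_one a) (x c)
    rw [h.norm_one c] at this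
    exact mul_le_of_le_one_right (hq c) this

/-- A vanishing orthogonal component places the combination on the line spanned by `x a`, and the
equations of the other two sides kill `x a`. -/
theorem coord_eq_zero_of_perp (h : A.GenericFrame x) {a b c : Fin 3} (hab : a ≠ b) (hac : a ≠ c)
    (hbc : b ≠ c) {s t : ℂ} (h0 : s • perp (x a) (x b) + t • perp (x a) (x c) = 0) :
    s = 0 ∧ t = 0 := by
  have h1 : s • x b + t • x c =
      (s * inner ℂ (x a) (x b) + t * inner ℂ (x a) (x c) : ℂ) • x a := by
    simp only [perp, smul_sub, smul_smul] at h0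
    rw [add_smul, ← sub_eq_zero, ← h0]
    abel
  have h2 := congrArg (A.line (A.tri b)).rep h1
  have h3 := congrArg (A.line (A.tri c)).rep h1
  simp only [map_add, map_smul, h.off_diag hab, h.off_diag hac, h.off_diag hbc, h.off_diag hbc.symm,
    smul_eq_mul, mul_zero, add_zero, zero_add, mul_eq_zero, h.diag, or_false] at h2 h3
  exact ⟨h2, h3⟩

theorem coord_of_cornerDist_eq_zero (h : A.GenericFrame x) {a b : Fin 3} (hab : a ≠ b)
    {q : Fin 3 → ℝ} (h0 : cornerDist x a q = 0) : q b = 0 := by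
  obtain ⟨c, hac, hbc⟩ := Frame.exists_third a b hab
  rw [h.cornerDist_eq hab hac hbc, norm_eq_zero] at h0
  exact_mod_cast (h.coord_eq_zero_of_perp hab hac hbc h0).1

/-- Each coordinate is a multiple of the value of a linear form on a unit vector, hence bounded. -/
theorem isCompact_realTriangle (h : A.GenericFrame x) : IsCompact (realTriangle x) := by
  refine IsCompact.of_isClosed_subset (isCompact_Icc (a := (0 : Fin 3 → ℝ))
    (b := fun a => (sideSlope (A.line (A.tri a)) (x a))⁻¹)) ?_ fun q hq => ⟨hq.1, fun a => ?_⟩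
  · have : realTriangle x = (⋂ a, {q | 0 ≤ q a}) ∩ {q | ‖realComb x q‖ = 1} := by
      ext q; simp [realTriangle]
    rw [this]
    exact (isClosed_iInter fun a => isClosed_le continuous_const (continuous_apply a)).inter
      (isClosed_eq (continuous_realComb x).norm continuous_const)
  · have h1 := h.sideSlope_tri a hq
    have h2 : sideSlope (A.line (A.tri a)) (realComb x q) ≤ 1 := by
      rw [sideSlope, div_le_one (norm_pos_iff.2 (Projectivization.rep_nonzero _))]
      simpa [hq.2] using (A.line (A.tri a)).rep.le_opNorm (realComb x q)
    rw [h1] at h2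
    show q a ≤ (sideSlope (A.line (A.tri a)) (x a))⁻¹
    rw [← one_div, le_div_iff₀ (h.slope_pos a)]
    linarith

theorem exists_pos_coord {q : Fin 3 → ℝ} (hq : q ∈ realTriangle x) :
    ∃ a, 0 < q a := by
  by_contra! hn
  apply realComb_ne_zero hq
  refine Finset.sum_eq_zero fun a _ => ?_
  rw [le_antisymm (hn a) (hq.1 a)]
  simp

/-- The other lines meet the boundary of the real triangle at most at the vertices. -/
theorem rep_ne_zero (h : A.GenericFrame x) {i : Fin n} (hi : ∀ a, i ≠ A.tri a) {q : Fin 3 → ℝ}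
    (hq : q ∈ realTriangle x) {c : Fin 3} (hc : q c = 0)
    (hx : ∀ a, 0 < q a → (∀ b ≠ a, q b = 0) → (A.line i).rep (x a) ≠ 0) :
    (A.line i).rep (realComb x q) ≠ 0 := by
  obtain ⟨a, ha⟩ := exists_pos_coord hq
  have hac : a ≠ c := by rintro rfl; exact ha.ne' hc
  obtain ⟨b, hab, hcb⟩ := Frame.exists_third a c hac
  rw [realComb_eq x hab hac hcb.symm, hc, map_add, map_add, map_smul, map_smul, map_smul]
  simp only [Complex.ofReal_zero, zero_mul, add_zero, smul_eq_mul]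
  rcases (hq.1 b).eq_or_lt with hb | hb
  · rw [← hb]
    simp only [Complex.ofReal_zero, zero_mul, add_zero]
    refine mul_ne_zero (by exact_mod_cast ha.ne') (hx a ha fun d hd => ?_)
    have key : ∀ a b c d : Fin 3, a ≠ b → c ≠ b → a ≠ c → d ≠ a → d = b ∨ d = c := by decide
    rcases key a b c d hab hcb hac hd with rfl | rfl
    exacts [hb.symm, hc]
  · exact h.generic i hi hab ha hb

end GenericFrame

/-- Uniform bounds for the real triangle, ensuring that the neighbourhoods of the lines and
of the singular points are far apart. -/
structure TriangleBound (A : Arrangement n) (x : Fin 3 → C3) (d : ℝ) : Prop where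
  coord_corner : ∀ a, ∀ q ∈ realTriangle x, d ≤ max (q a) (cornerDist x a q)
  corner_corner : ∀ {a b}, a ≠ b → ∀ q ∈ realTriangle x, d ≤ max (cornerDist x a q) (cornerDist x b q)
  perp_ge : ∀ {a b c}, a ≠ b → a ≠ c → b ≠ c → ∀ s t : ℝ, 0 ≤ s → 0 ≤ t →
    d * (s + t) ≤ ‖(s : ℂ) • perp (x a) (x b) + (t : ℂ) • perp (x a) (x c)‖
  coord_line : ∀ i, (∀ a, i ≠ A.tri a) → (∀ a, (A.line i).rep (x a) ≠ 0) → ∀ c, ∀ q ∈ realTriangle x,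
    d ≤ max (q c) (sideSlope (A.line i) (realComb x q))
  corner_line : ∀ i a, (A.line i).rep (x a) ≠ 0 → ∀ q ∈ realTriangle x,
    d ≤ max (cornerDist x a q) (sideSlope (A.line i) (realComb x q))
  line_through : ∀ i, (∀ a, i ≠ A.tri a) → ∀ a, (A.line i).rep (x a) = 0 → ∀ q ∈ realTriangle x,
    d * cornerDist x a q ≤ sideSlope (A.line i) (realComb x q)
  coord_point : ∀ P : A.SingularPoint, (∀ a, P ≠ A.corner a) → ∀ c, ∀ q, ∀ hq : q ∈ realTriangle x,
    d ≤ max (q c) (pointDist P.1 (Projectivization.mk ℂ _ (realComb_ne_zero hq)))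
  corner_point : ∀ P : A.SingularPoint, (∀ a, P ≠ A.corner a) → ∀ a, ∀ q, ∀ hq : q ∈ realTriangle x,
    d ≤ max (cornerDist x a q) (pointDist P.1 (Projectivization.mk ℂ _ (realComb_ne_zero hq)))

theorem continuous_sideSlope_realComb (L : ProjLine) (x : Fin 3 → C3) :
    Continuous fun q => sideSlope L (realComb x q) :=
  ((L.rep.continuous.comp (continuous_realComb x)).norm).div_const _

theorem sideSlope_pos {L : ProjLine} {v : C3} (h : L.rep v ≠ 0) : 0 < sideSlope L v :=
  div_pos (norm_pos_iff.2 h) (norm_pos_iff.2 L.rep_nonzero)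

theorem realComb_of_eq_zero {q : Fin 3 → ℝ} {a : Fin 3} (h : ∀ b ≠ a, q b = 0) :
    realComb x q = (q a : ℂ) • x a := by
  rw [realComb, Finset.sum_eq_single a]
  · intro b _ hb
    rw [h b hb]; simp
  · simp

/-- A point of the boundary of the real triangle that is a singular point is a vertex. -/
theorem GenericFrame.eq_corner (h : A.GenericFrame x) (P : A.SingularPoint) {q : Fin 3 → ℝ}
    (hq : q ∈ realTriangle x) {c : Fin 3} (hc : q c = 0)
    (hP : P.1 = Projectivization.mk ℂ _ (realComb_ne_zero hq)) : ∃ a, P = A.corner a := by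
  by_contra! hn
  obtain ⟨i, j, hij, hi, hj⟩ := P.2
  -- A point of the boundary of the triangle that is not a vertex lies on no line but the sides. A
  -- singular point lies on two lines, so here on two sides, which makes it a vertex.
  have key : ∀ k, OnLine P.1 (A.line k) → ∃ a, k = A.tri a := by
    intro k hk
    by_contra! hk'
    rw [hP, onLine_mk_iff] at hk
    refine h.rep_ne_zero hk' hq hc (fun a ha hb => ?_) hk
    exfalso
    apply hn a
    apply Subtype.ext
    rw [hP, h.corner_eq, Projectivization.mk_eq_mk_iff']
    exact ⟨q a, (realComb_of_eq_zero hb).symm⟩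
  obtain ⟨a, rfl⟩ := key i hi
  obtain ⟨b, rfl⟩ := key j hj
  have hab : a ≠ b := fun h => hij (by rw [h])
  obtain ⟨c, hac, hbc⟩ := Frame.exists_third a b hab
  exact hn c (Subtype.ext (onLine_unique (A.injective.ne hij) hi hj (A.corner_onLine hac.symm)
    (A.corner_onLine hbc.symm)))

theorem pointDist_pos {p q : CP2} (h : p ≠ q) : 0 < pointDist p q := by
  obtain ⟨u, hu, rfl, hu1⟩ := mk_surjective_unit p
  obtain ⟨v, hv, rfl⟩ := mk_surjective q
  rw [pointDist_mk_perp hu1]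
  refine div_pos (norm_pos_iff.2 fun h0 => h ?_) (norm_pos_iff.2 hv)
  rw [Eq.comm, Projectivization.mk_eq_mk_iff']
  exact ⟨_, (sub_eq_zero.1 h0).symm⟩

theorem exists_continuous_pointDist_realComb (P : CP2) (x : Fin 3 → C3) : ∃ f : (Fin 3 → ℝ) → ℝ, Continuous f ∧
    ∀ q, ∀ hq : q ∈ realTriangle x,
      pointDist P (Projectivization.mk ℂ _ (realComb_ne_zero hq)) = f q := by
  obtain ⟨u, hu, rfl, hu1⟩ := mk_surjective_unit P
  refine ⟨fun q => ‖perp u (realComb x q)‖,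
    ((continuous_perp _).comp (continuous_realComb x)).norm, fun q hq => ?_⟩
  rw [pointDist_mk_perp hu1, hq.2, div_one]

theorem GenericFrame.eventually_triangleBound (h : A.GenericFrame x) :
    ∀ᶠ d in 𝓝[>] (0 : ℝ), A.TriangleBound x d := by
  have hK := h.isCompact_realTriangle
  have e1 : ∀ᶠ d in 𝓝[>] (0 : ℝ), ∀ a, ∀ q ∈ realTriangle x, d ≤ max (q a) (cornerDist x a q) := by
    rw [eventually_all]
    intro a
    refine hK.eventually_le_max (continuous_apply a) (continuous_cornerDist x a)
      (fun q hq => hq.1 a) fun q hq h0 => (norm_nonneg _).lt_of_ne' fun h1 => ?_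
    obtain ⟨b, hb⟩ := exists_pos_coord hq
    by_cases hab : a = b
    · subst hab; exact hb.ne' h0
    · exact hb.ne' (h.coord_of_cornerDist_eq_zero hab h1)
  have e2 : ∀ᶠ d in 𝓝[>] (0 : ℝ), ∀ a b, a ≠ b → ∀ q ∈ realTriangle x,
      d ≤ max (cornerDist x a q) (cornerDist x b q) := by
    simp only [eventually_all]
    intro a b hab
    refine hK.eventually_le_max (continuous_cornerDist x a) (continuous_cornerDist x b)
      (fun q hq => norm_nonneg _) fun q hq h0 => (norm_nonneg _).lt_of_ne' fun h1 => ?_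
    obtain ⟨c, hc⟩ := exists_pos_coord hq
    by_cases hac : a = c
    · exact hc.ne' (h.coord_of_cornerDist_eq_zero (fun hbc => hab (hac.trans hbc.symm)) h1)
    · exact hc.ne' (h.coord_of_cornerDist_eq_zero hac h0)
  have e3 : ∀ᶠ d in 𝓝[>] (0 : ℝ), ∀ a b c, a ≠ b → a ≠ c → b ≠ c → ∀ s t : ℝ, 0 ≤ s → 0 ≤ t →
      d * (s + t) ≤ ‖(s : ℂ) • perp (x a) (x b) + (t : ℂ) • perp (x a) (x c)‖ := by
    simp only [eventually_all]
    intro a b c hab hac hbc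
    refine eventually_mul_add_le_norm fun s t _ _ h0 => ?_
    obtain ⟨h1, h2⟩ := h.coord_eq_zero_of_perp hab hac hbc h0
    have h1' : s = 0 := by exact_mod_cast h1
    have h2' : t = 0 := by exact_mod_cast h2
    rw [h1', h2', add_zero]
  have e4 : ∀ᶠ d in 𝓝[>] (0 : ℝ), ∀ i, (∀ a, i ≠ A.tri a) → (∀ a, (A.line i).rep (x a) ≠ 0) →
      ∀ c, ∀ q ∈ realTriangle x, d ≤ max (q c) (sideSlope (A.line i) (realComb x q)) := by
    simp only [eventually_all]
    intro i hi hix c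
    exact hK.eventually_le_max (continuous_apply c) (continuous_sideSlope_realComb _ x)
      (fun q hq => hq.1 c) fun q hq h0 =>
        sideSlope_pos (h.rep_ne_zero hi hq h0 fun a _ _ => hix a)
  have e5 : ∀ᶠ d in 𝓝[>] (0 : ℝ), ∀ i a, (A.line i).rep (x a) ≠ 0 → ∀ q ∈ realTriangle x,
      d ≤ max (cornerDist x a q) (sideSlope (A.line i) (realComb x q)) := by
    simp only [eventually_all]
    intro i a hia
    refine hK.eventually_le_max (continuous_cornerDist x a)
      (continuous_sideSlope_realComb (A.line i) x) (fun q hq => norm_nonneg _)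
      fun q hq h0 => sideSlope_pos fun h1 => ?_
    have hb : ∀ b ≠ a, q b = 0 := fun b hb => h.coord_of_cornerDist_eq_zero hb.symm h0
    have h2 := realComb_ne_zero hq
    rw [realComb_of_eq_zero hb] at h1 h2
    rw [map_smul, smul_eq_mul, mul_eq_zero] at h1
    exact (smul_ne_zero_iff.1 h2).1 (h1.resolve_right hia)
  have e6 : ∀ᶠ d in 𝓝[>] (0 : ℝ), ∀ i, (∀ a, i ≠ A.tri a) → ∀ a, (A.line i).rep (x a) = 0 →
      ∀ q ∈ realTriangle x, d * cornerDist x a q ≤ sideSlope (A.line i) (realComb x q) := by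
    simp only [eventually_all]
    intro i hi a hia
    have key : ∀ a : Fin 3, ∃ b c, a ≠ b ∧ a ≠ c ∧ b ≠ c := by decide
    obtain ⟨b, c, hab, hac, hbc⟩ := key a
    have hib := h.rep_ne_zero_of_eq_zero hi hab hia
    have hic := h.rep_ne_zero_of_eq_zero hi hac hia
    have hL := norm_pos_iff.2 (A.line i).rep_nonzero
    have hL' : (‖(A.line i).rep‖ : ℂ) ≠ 0 := by exact_mod_cast hL.ne'
    -- On the real triangle, the equation of a line through `x a` is a nonnegative combination of
    -- its values at the other two vertices. Genericity keeps this cone away from 0, so the equation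
    -- grows at least linearly with the distance to `x a`.
    have hcone : ∀ s t : ℝ, 0 ≤ s → 0 ≤ t → (s : ℂ) • ((A.line i).rep (x b) / ‖(A.line i).rep‖ : ℂ) +
        (t : ℂ) • ((A.line i).rep (x c) / ‖(A.line i).rep‖ : ℂ) = 0 → s + t = 0 := by
      intro s t hs ht h0
      by_contra hst
      have h0' : (s : ℂ) * (A.line i).rep (x b) + t * (A.line i).rep (x c) = 0 := by
        simp only [smul_eq_mul, mul_div_assoc', ← add_div, div_eq_zero_iff] at h0
        exact h0.resolve_right hL'
      rcases hs.eq_or_lt with rfl | hs'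
      · rcases ht.eq_or_lt with rfl | ht'
        · simp at hst
        · simp [ht'.ne', hic] at h0'
      · rcases ht.eq_or_lt with rfl | ht'
        · simp [hs'.ne', hib] at h0'
        · exact h.generic i hi hbc hs' ht' h0'
    filter_upwards [eventually_mul_add_le_norm hcone, self_mem_nhdsWithin] with d hd hd0 q hq
    refine (mul_le_mul_of_nonneg_left (h.cornerDist_le hab hac hbc hq.1) (le_of_lt hd0)).trans ?_
    refine (hd _ _ (hq.1 b) (hq.1 c)).trans (le_of_eq ?_)
    rw [sideSlope, realComb_eq x hab hac hbc, map_add, map_add, map_smul, map_smul, map_smul, hia,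
      smul_zero, zero_add, smul_eq_mul, smul_eq_mul, smul_eq_mul, smul_eq_mul, mul_div_assoc',
      mul_div_assoc', ← add_div, norm_div, Complex.norm_real, norm_norm]
  have := A.finite_singularPoint
  have e7 : ∀ᶠ d in 𝓝[>] (0 : ℝ), ∀ P : A.SingularPoint, (∀ a, P ≠ A.corner a) →
      (∀ c, ∀ q, ∀ hq : q ∈ realTriangle x,
        d ≤ max (q c) (pointDist P.1 (Projectivization.mk ℂ _ (realComb_ne_zero hq)))) ∧
      (∀ a, ∀ q, ∀ hq : q ∈ realTriangle x,
        d ≤ max (cornerDist x a q)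
          (pointDist P.1 (Projectivization.mk ℂ _ (realComb_ne_zero hq)))) := by
    simp only [eventually_all, eventually_and]
    intro P hP
    obtain ⟨f, hf, hfq⟩ := exists_continuous_pointDist_realComb P.1 x
    have hpos : ∀ q ∈ realTriangle x, ∀ c, q c = 0 → 0 < f q := by
      intro q hq c hc
      rw [← hfq q hq]
      refine pointDist_pos fun h1 => ?_
      obtain ⟨a, ha⟩ := h.eq_corner P hq hc h1
      exact hP a ha
    refine ⟨fun c => ?_, fun a => ?_⟩
    · filter_upwards [hK.eventually_le_max (continuous_apply c) hf (fun q hq => hq.1 c)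
        fun q hq h0 => hpos q hq c h0] with d hd q hq
      rw [hfq q hq]
      exact hd q hq
    · have ha : ∀ a : Fin 3, a ≠ a + 1 := by decide
      filter_upwards [hK.eventually_le_max (continuous_cornerDist x a) hf (fun q hq => norm_nonneg _)
        fun q hq h0 => hpos q hq (a + 1) (h.coord_of_cornerDist_eq_zero (ha a) h0)] with d hd q hq
      rw [hfq q hq]
      exact hd q hq
  filter_upwards [e1, e2, e3, e4, e5, e6, e7] with d h1 h2 h3 h4 h5 h6 h7
  exact ⟨h1, h2 _ _, h3 _ _ _, h4, h5, h6, fun P hP => (h7 P hP).1, fun P hP => (h7 P hP).2⟩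

end Arrangement

/-! ### Arcs between two thresholds -/

/-- A second passage on the wrong side of the level would force another crossing by the intermediate
value theorem. -/
theorem exists_last_crossing {g : ℝ → ℝ} (hg : ContinuousOn g (Set.Icc 0 1)) {k : ℝ}
    (h0 : g 0 < k) (h1 : k < g 1)
    (hu : ∀ s ∈ Set.Icc (0 : ℝ) 1, ∀ t ∈ Set.Icc (0 : ℝ) 1, g s = k → g t = k → s = t) :
    ∃ τ ∈ Set.Icc (0 : ℝ) 1, g τ = k ∧ (∀ t ∈ Set.Icc (0 : ℝ) 1, t ≤ τ → g t ≤ k) ∧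
      ∀ t ∈ Set.Icc (0 : ℝ) 1, τ ≤ t → k ≤ g t := by
  obtain ⟨τ, hτ, hgτ⟩ := intermediate_value_Icc zero_le_one hg ⟨h0.le, h1.le⟩
  refine ⟨τ, hτ, hgτ, fun t ht htτ => ?_, fun t ht htτ => ?_⟩
  · by_contra! hlt
    obtain ⟨s, hs, hgs⟩ := intermediate_value_Icc ht.1
      (hg.mono (Set.Icc_subset_Icc_right ht.2)) ⟨h0.le, hlt.le⟩
    have := hu s ⟨hs.1, hs.2.trans ht.2⟩ τ hτ hgs hgτ
    have h2 : t = τ := le_antisymm htτ (this ▸ hs.2)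
    rw [h2, hgτ] at hlt
    exact lt_irrefl _ hlt
  · by_contra! hlt
    obtain ⟨s, hs, hgs⟩ := intermediate_value_Icc ht.2
      (hg.mono (Set.Icc_subset_Icc_left ht.1)) ⟨hlt.le, h1.le⟩
    have := hu s ⟨ht.1.trans hs.1, hs.2⟩ τ hτ hgs hgτ
    have h2 : t = τ := le_antisymm (this ▸ hs.1) htτ
    rw [h2, hgτ] at hlt
    exact lt_irrefl _ hlt

/-- An injective arc on `[0, 1]`, with `g = k` only at the start, `h = k'` only at the end, and
`g ≥ k`, `h ≥ k'` everywhere. -/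
structure IsArc {X : Type*} [TopologicalSpace X] (f : ℝ → X) (g h : X → ℝ) (k k' : ℝ) : Prop where
  continuousOn : ContinuousOn f (Set.Icc 0 1)
  injOn : Set.InjOn f (Set.Icc 0 1)
  start_eq : g (f 0) = k
  end_eq : h (f 1) = k'
  start_le : ∀ t ∈ Set.Icc (0 : ℝ) 1, k ≤ g (f t)
  end_le : ∀ t ∈ Set.Icc (0 : ℝ) 1, k' ≤ h (f t)
  eq_start : ∀ t ∈ Set.Icc (0 : ℝ) 1, g (f t) = k → t = 0
  eq_end : ∀ t ∈ Set.Icc (0 : ℝ) 1, h (f t) = k' → t = 1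

/-- The arc is the part of F between its crossing of the level of g and its crossing of the level of
h, reparametrized by [0, 1]. The last hypothesis ensures that these crossings occur in this order.
-/
theorem exists_isArc {X : Type*} [TopologicalSpace X] {F : ℝ → X} {g h : X → ℝ} {k k' : ℝ}
    (hF : ContinuousOn F (Set.Icc 0 1)) (hFi : Set.InjOn F (Set.Icc 0 1)) (hg : Continuous g)
    (hh : Continuous h) (g0 : g (F 0) < k) (g1 : k < g (F 1)) (h0 : k' < h (F 0))
    (h1 : h (F 1) < k')
    (gu : ∀ s ∈ Set.Icc (0 : ℝ) 1, ∀ t ∈ Set.Icc (0 : ℝ) 1, g (F s) = k → g (F t) = k → F s = F t)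
    (hu : ∀ s ∈ Set.Icc (0 : ℝ) 1, ∀ t ∈ Set.Icc (0 : ℝ) 1, h (F s) = k' → h (F t) = k' → F s = F t)
    (hno : ∀ t ∈ Set.Icc (0 : ℝ) 1, g (F t) ≤ k → k' < h (F t)) :
    ∃ f, IsArc f g h k k' ∧ ∀ t ∈ Set.Icc (0 : ℝ) 1, f t ∈ F '' Set.Icc 0 1 := by
  obtain ⟨σ, hσ, hgσ, hσl, hσr⟩ := exists_last_crossing (g := fun t => g (F t))
    (hg.comp_continuousOn hF) g0 g1 fun s hs t ht hs' ht' => hFi hs ht (gu s hs t ht hs' ht')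
  have hneg : ∀ t : ℝ, t ∈ Set.Icc (0 : ℝ) 1 → 1 - t ∈ Set.Icc (0 : ℝ) 1 := fun t ht =>
    ⟨by linarith [ht.2], by linarith [ht.1]⟩
  obtain ⟨τ', hτ', hhτ', hτl, hτr⟩ := exists_last_crossing (g := fun t => h (F (1 - t)))
    (hh.comp_continuousOn (hF.comp (by fun_prop) fun t ht => hneg t ht)) (by simpa using h1)
    (by simpa using h0) fun s hs t ht hs' ht' => by
      have := hFi (hneg s hs) (hneg t ht) (hu _ (hneg s hs) _ (hneg t ht) hs' ht')
      linarith
  obtain ⟨τ, rfl⟩ : ∃ τ, τ' = 1 - τ := ⟨1 - τ', by ring⟩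
  have hτ : τ ∈ Set.Icc (0 : ℝ) 1 := by simpa using hneg _ hτ'
  rw [sub_sub_cancel] at hhτ'
  have hστ : σ < τ := by
    by_contra! hlt
    have := hno τ hτ (hσl τ hτ hlt)
    rw [hhτ'] at this
    exact lt_irrefl _ this
  have hmem : ∀ t ∈ Set.Icc (0 : ℝ) 1, σ + t * (τ - σ) ∈ Set.Icc σ τ := fun t ht =>
    ⟨by nlinarith [ht.1], by nlinarith [ht.2]⟩
  have hmem' : ∀ t ∈ Set.Icc (0 : ℝ) 1, σ + t * (τ - σ) ∈ Set.Icc (0 : ℝ) 1 := fun t ht =>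
    ⟨hσ.1.trans (hmem t ht).1, (hmem t ht).2.trans hτ.2⟩
  refine ⟨fun t => F (σ + t * (τ - σ)), ⟨?_, ?_, ?_, ?_, ?_, ?_, ?_, ?_⟩, ?_⟩
  · exact hF.comp (by fun_prop) hmem'
  · intro s hs t ht hst
    have := hFi (hmem' s hs) (hmem' t ht) hst
    exact mul_right_cancel₀ (sub_pos.2 hστ).ne' (add_left_cancel this)
  · simpa using hgσ
  · simpa using hhτ'
  · exact fun t ht => hσr _ (hmem' t ht) (hmem t ht).1
  · intro t ht
    have := hτr _ (hneg _ (hmem' t ht)) (by linarith [(hmem t ht).2])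
    simpa using this
  · intro t ht hgt
    have := hFi (hmem' t ht) hσ (gu _ (hmem' t ht) _ hσ hgt hgσ)
    have h2 : t * (τ - σ) = 0 := by linarith
    exact (mul_eq_zero.1 h2).resolve_right (sub_pos.2 hστ).ne'
  · intro t ht hht
    have := hFi (hmem' t ht) hτ (hu _ (hmem' t ht) _ hτ hht hhτ')
    have h2 : (t - 1) * (τ - σ) = 0 := by linarith
    linarith [(mul_eq_zero.1 h2).resolve_right (sub_pos.2 hστ).ne']
  · exact fun t ht => ⟨_, hmem' t ht, rfl⟩

/-- The triple of real numbers with given values at three indices. -/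
def triple (a b : Fin 3) (α β γ : ℝ) : Fin 3 → ℝ := fun i => if i = a then α else if i = b then β else γ

theorem triple_nonneg {a b : Fin 3} {α β γ : ℝ} (hα : 0 ≤ α) (hβ : 0 ≤ β) (hγ : 0 ≤ γ) (i : Fin 3) :
    0 ≤ triple a b α β γ i := by
  unfold triple; split_ifs <;> assumption

theorem triple_apply {a b c : Fin 3} (hab : a ≠ b) (hac : a ≠ c) (hbc : b ≠ c) (α β γ : ℝ) :
    triple a b α β γ a = α ∧ triple a b α β γ b = β ∧ triple a b α β γ c = γ := by
  simp [triple, hab.symm, hac.symm, hbc.symm]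

theorem ext_fin_three {a b c : Fin 3} (hab : a ≠ b) (hac : a ≠ c) (hbc : b ≠ c)
    {q q' : Fin 3 → ℝ} (ha : q a = q' a) (hb : q b = q' b) (hc : q c = q' c) : q = q' := by
  have key : ∀ a b c : Fin 3, a ≠ b → a ≠ c → b ≠ c → ∀ i, i = a ∨ i = b ∨ i = c := by decide
  funext i
  rcases key a b c hab hac hbc i with rfl | rfl | rfl <;> assumption

theorem continuousOn_triple {X : Type*} [TopologicalSpace X] {K : Set X} (a b : Fin 3)
    {f g h : X → ℝ} (hf : ContinuousOn f K) (hg : ContinuousOn g K) (hh : ContinuousOn h K) :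
    ContinuousOn (fun p => triple a b (f p) (g p) (h p)) K := by
  rw [continuousOn_pi]
  intro i
  unfold triple
  split_ifs <;> assumption

/-! ### Arcs of the real triangle on the spheres and tubes -/

namespace Arrangement

variable {n : ℕ} {A : Arrangement n} {x : Fin 3 → C3}

/-- The ratio between the radius of the tubes and the corresponding coordinate. -/
def sideCoord (A : Arrangement n) (x : Fin 3 → C3) (ε : ℝ) (a : Fin 3) : ℝ :=
  ε / sideSlope (A.line (A.tri a)) (x a)

/-- Sufficiently small radii. -/
structure SmallRadii (A : Arrangement n) (x : Fin 3 → C3) (d δ ε : ℝ) : Prop where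
  bound : A.TriangleBound x d
  d_le : d ≤ 1
  delta_pos : 0 < δ
  delta_lt : 8 * δ < d
  eps_pos : 0 < ε
  eps_lt : ε < d * δ
  coord_lt : ∀ a, 4 * A.sideCoord x ε a < δ

namespace SmallRadii

variable {d δ ε : ℝ}

theorem d_pos (hs : A.SmallRadii x d δ ε) : 0 < d := by linarith [hs.delta_pos, hs.delta_lt]

theorem coord_pos (hs : A.SmallRadii x d δ ε) (h : A.GenericFrame x) (a : Fin 3) :
    0 < A.sideCoord x ε a := div_pos hs.eps_pos (h.slope_pos a)

theorem norm_smul_x (h : A.GenericFrame x) {r : ℝ} (hr : 0 ≤ r) (a : Fin 3) : ‖(r : ℂ) • x a‖ = r := by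
  rw [norm_smul, h.norm_one, mul_one, Complex.norm_real, Real.norm_of_nonneg hr]

theorem norm_smul_perp_le (h : A.GenericFrame x) {r : ℝ} (hr : 0 ≤ r) (a b : Fin 3) :
    ‖(r : ℂ) • perp (x a) (x b)‖ ≤ r := by
  rw [norm_smul, Complex.norm_real, Real.norm_of_nonneg hr]
  have := norm_perp_le (h.norm_one a) (x b)
  rw [h.norm_one] at this
  exact mul_le_of_le_one_right hr this

/-- The orthogonal component has norm δ and dominates d (q b + q c), while 8δ < d. -/
theorem add_lt_of_cornerDist_eq (hs : A.SmallRadii x d δ ε) (h : A.GenericFrame x) {a b c : Fin 3}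
    (hab : a ≠ b) (hac : a ≠ c) (hbc : b ≠ c) {q : Fin 3 → ℝ} (hq : ∀ a, 0 ≤ q a)
    (hD : cornerDist x a q = δ) : 8 * (q b + q c) < 1 := by
  have h1 := hs.bound.perp_ge hab hac hbc (q b) (q c) (hq b) (hq c)
  rw [← h.cornerDist_eq hab hac hbc, hD] at h1
  have := hs.delta_lt
  have := hs.d_pos
  by_contra! h2
  nlinarith

/-- A point of the real triangle at distance `δ` of a vertex and `ε` of a side is unique. -/
theorem corner_unique (hs : A.SmallRadii x d δ ε) (h : A.GenericFrame x) {a c : Fin 3}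
    (hac : a ≠ c) {q q' : Fin 3 → ℝ} (hq : q ∈ realTriangle x)
    (hq' : q' ∈ realTriangle x) (hD : cornerDist x a q = δ) (hD' : cornerDist x a q' = δ)
    (hc : q c = A.sideCoord x ε c) (hc' : q' c = A.sideCoord x ε c) : q = q' := by
  obtain ⟨b, hab, hcb⟩ := Frame.exists_third a c hac
  have hbc := hcb.symm
  have hcc := hs.coord_lt c
  have hcp := hs.coord_pos h c
  -- Two quadratic equations are solved in turn: the distance δ to the vertex determines the
  -- coordinate b, then the unit norm determines the coordinate a.
  have hb : q b = q' b := by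
    have e := hD
    have e' := hD'
    rw [h.cornerDist_eq hab hac hbc] at e e'
    rw [hc] at e
    rw [hc'] at e'
    refine root_unique ?_ (hq.1 b) (hq'.1 b) e e'
    refine (norm_smul_perp_le h hcp.le a c).trans_lt ?_
    linarith
  have ha : q a = q' a := by
    have e := hq.2
    have e' := hq'.2
    rw [realComb_eq x hab hac hbc] at e e'
    rw [← hb, hc', ← hc] at e'
    refine root_unique ?_ (hq.1 a) (hq'.1 a) e e'
    refine (norm_add_le _ _).trans_lt ?_
    rw [norm_smul_x h (hq.1 b), norm_smul_x h (hq.1 c)]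
    have := hs.add_lt_of_cornerDist_eq h hab hac hbc hq.1 hD
    have := hq.1 b
    have := hq.1 c
    linarith
  exact ext_fin_three hab hac hbc ha hb (hc.trans hc'.symm)

/-- The arc on the sphere around a vertex of the triangle. -/
theorem exists_ballArc (hs : A.SmallRadii x d δ ε) (h : A.GenericFrame x) {a b c : Fin 3}
    (hab : a ≠ b) (hac : a ≠ c) (hbc : b ≠ c) :
    ∃ f : ℝ → Fin 3 → ℝ, IsArc f (fun q => q b) (fun q => q c) (A.sideCoord x ε b)
      (A.sideCoord x ε c) ∧ ∀ t ∈ Set.Icc (0 : ℝ) 1, f t ∈ realTriangle x ∧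
        cornerDist x a (f t) = δ := by
  -- The direction seen from the vertex turns from c to b; σ rescales it to distance δ, and the
  -- coordinate along `x a` is then the root that gives a unit vector.
  let v : ℝ → C3 := fun t => (t : ℂ) • perp (x a) (x b) + ((1 - t : ℝ) : ℂ) • perp (x a) (x c)
  have hvc : Continuous v := by fun_prop
  have hvd : ∀ t ∈ Set.Icc (0 : ℝ) 1, d ≤ ‖v t‖ := fun t ht => by
    have := hs.bound.perp_ge hab hac hbc t (1 - t) ht.1 (by linarith [ht.2])
    simpa [v] using this
  have hv0 : ∀ t ∈ Set.Icc (0 : ℝ) 1, ‖v t‖ ≠ 0 := fun t ht => (hs.d_pos.trans_le (hvd t ht)).ne'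
  let σ : ℝ → ℝ := fun t => δ / ‖v t‖
  have hσ : ∀ t ∈ Set.Icc (0 : ℝ) 1, 0 < σ t ∧ σ t < 1 := fun t ht => by
    refine ⟨div_pos hs.delta_pos (hs.d_pos.trans_le (hvd t ht)), ?_⟩
    rw [div_lt_one (hs.d_pos.trans_le (hvd t ht))]
    linarith [hvd t ht, hs.delta_lt, hs.delta_pos]
  have hσc : ContinuousOn σ (Set.Icc 0 1) := continuousOn_const.div hvc.norm.continuousOn hv0
  let w : ℝ → C3 := fun t => ((σ t * t : ℝ) : ℂ) • x b + ((σ t * (1 - t) : ℝ) : ℂ) • x c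
  have hwc : ContinuousOn w (Set.Icc 0 1) := by
    have h1 : ContinuousOn (fun t => ((σ t * t : ℝ) : ℂ)) (Set.Icc 0 1) :=
      Complex.continuous_ofReal.comp_continuousOn (hσc.mul continuousOn_id)
    have h2 : ContinuousOn (fun t => ((σ t * (1 - t) : ℝ) : ℂ)) (Set.Icc 0 1) :=
      Complex.continuous_ofReal.comp_continuousOn (hσc.mul (continuousOn_const.sub continuousOn_id))
    exact (h1.smul continuousOn_const).add (h2.smul continuousOn_const)
  have hw : ∀ t ∈ Set.Icc (0 : ℝ) 1, ‖w t‖ < 1 := fun t ht => by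
    obtain ⟨h1, h2⟩ := hσ t ht
    refine (norm_add_le _ _).trans_lt ?_
    rw [norm_smul_x h (mul_nonneg h1.le ht.1), norm_smul_x h (mul_nonneg h1.le (by linarith [ht.2]))]
    linarith
  let F : ℝ → Fin 3 → ℝ := fun t => triple a b (posRoot (x a) (w t) 1) (σ t * t) (σ t * (1 - t))
  have hF : ∀ t, F t a = posRoot (x a) (w t) 1 ∧ F t b = σ t * t ∧ F t c = σ t * (1 - t) :=
    fun t => triple_apply hab hac hbc _ _ _
  have hFc : ContinuousOn F (Set.Icc 0 1) := by
    refine continuousOn_triple a b ?_ (hσc.mul continuousOn_id)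
      (hσc.mul (continuousOn_const.sub continuousOn_id))
    exact continuousOn_posRoot continuousOn_const hwc fun _ _ => h.ne_zero a
  have hFT : ∀ t ∈ Set.Icc (0 : ℝ) 1, F t ∈ realTriangle x := fun t ht => by
    obtain ⟨h1, h2⟩ := posRoot_spec (hw t ht) (h.ne_zero a)
    refine ⟨triple_nonneg h1.le (mul_nonneg (hσ t ht).1.le ht.1)
      (mul_nonneg (hσ t ht).1.le (by linarith [ht.2])), ?_⟩
    rw [realComb_eq x hab hac hbc, (hF t).1, (hF t).2.1, (hF t).2.2]
    exact h2
  have hFD : ∀ t ∈ Set.Icc (0 : ℝ) 1, cornerDist x a (F t) = δ := fun t ht => by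
    rw [h.cornerDist_eq hab hac hbc, (hF t).2.1, (hF t).2.2]
    have : ((σ t * t : ℝ) : ℂ) • perp (x a) (x b) + ((σ t * (1 - t) : ℝ) : ℂ) • perp (x a) (x c) =
        (σ t : ℂ) • v t := by
      simp only [v, smul_add, smul_smul]
      push_cast
      rfl
    rw [this, norm_smul, Complex.norm_real, Real.norm_of_nonneg (hσ t ht).1.le]
    exact div_mul_cancel₀ _ (hv0 t ht)
  have hFi : Set.InjOn F (Set.Icc 0 1) := by
    intro s hs' t ht hst
    have e1 := congrFun hst b
    have e2 := congrFun hst c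
    rw [(hF s).2.1, (hF t).2.1] at e1
    rw [(hF s).2.2, (hF t).2.2] at e2
    have e3 : σ s = σ t := by linarith
    rw [e3] at e1
    exact mul_left_cancel₀ (hσ t ht).1.ne' e1
  have m0 : (0 : ℝ) ∈ Set.Icc (0 : ℝ) 1 := by simp
  have m1 : (1 : ℝ) ∈ Set.Icc (0 : ℝ) 1 := by simp
  have hlarge : ∀ t ∈ Set.Icc (0 : ℝ) 1, δ ≤ F t b + F t c := fun t ht => by
    rw [← hFD t ht]
    exact h.cornerDist_le hab hac hbc (hFT t ht).1
  have hb0 : F 0 b = 0 := by rw [(hF 0).2.1, mul_zero]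
  have hc1 : F 1 c = 0 := by rw [(hF 1).2.2, sub_self, mul_zero]
  have hcb := hs.coord_lt b
  have hcc := hs.coord_lt c
  have hpb := hs.coord_pos h b
  have hpc := hs.coord_pos h c
  obtain ⟨f, hf, hfF⟩ := exists_isArc (g := fun q => q b) (h := fun q => q c)
    (k := A.sideCoord x ε b) (k' := A.sideCoord x ε c) hFc hFi (continuous_apply b)
    (continuous_apply c) (by rw [hb0]; exact hpb) (by linarith [hlarge 1 m1])
    (by linarith [hlarge 0 m0]) (by rw [hc1]; exact hpc)
    (fun s hs' t ht e1 e2 => hs.corner_unique h hab (hFT s hs') (hFT t ht) (hFD s hs') (hFD t ht) e1 e2)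
    (fun s hs' t ht e1 e2 => hs.corner_unique h hac (hFT s hs') (hFT t ht) (hFD s hs') (hFD t ht) e1 e2)
    (fun t ht e1 => by linarith [hlarge t ht])
  refine ⟨f, hf, fun t ht => ?_⟩
  obtain ⟨s, hs', hst⟩ := hfF t ht
  rw [← hst]
  exact ⟨hFT s hs', hFD s hs'⟩

/-- The arc on the tube around a side of the triangle. -/
theorem exists_tubeArc (hs : A.SmallRadii x d δ ε) (h : A.GenericFrame x) {a b c : Fin 3}
    (hab : a ≠ b) (hac : a ≠ c) (hbc : b ≠ c) :
    ∃ f : ℝ → Fin 3 → ℝ, IsArc f (cornerDist x a) (cornerDist x b) δ δ ∧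
      ∀ t ∈ Set.Icc (0 : ℝ) 1, f t ∈ realTriangle x ∧ f t c = A.sideCoord x ε c := by
  set e := A.sideCoord x ε c with he
  have hcc := hs.coord_lt c
  have hpc := hs.coord_pos h c
  have hd := hs.delta_lt
  have hd1 := hs.d_le
  have hd0 := hs.delta_pos
  -- The path runs along the side from a to b with the coordinate c frozen at e; ρ is the scaling
  -- that restores the unit norm.
  let u : ℝ → C3 := fun t => ((1 - t : ℝ) : ℂ) • x a + (t : ℂ) • x b
  have huc : Continuous u := by fun_prop
  have hu0 : ∀ t, u t ≠ 0 := fun t h0 => by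
    have h1 := congrArg (A.line (A.tri a)).rep h0
    have h2 := congrArg (A.line (A.tri b)).rep h0
    simp only [u, map_add, map_smul, h.off_diag hab, h.off_diag hab.symm, smul_eq_mul, mul_zero,
      add_zero, zero_add, map_zero, mul_eq_zero, h.diag, or_false, Complex.ofReal_eq_zero] at h1 h2
    linarith
  have hv1 : ‖(e : ℂ) • x c‖ < 1 := by
    rw [norm_smul_x h hpc.le]; linarith
  let ρ : ℝ → ℝ := fun t => posRoot (u t) ((e : ℂ) • x c) 1
  have hρ : ∀ t, 0 < ρ t ∧ ‖(ρ t : ℂ) • u t + (e : ℂ) • x c‖ = 1 := fun t =>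
    posRoot_spec hv1 (hu0 t)
  have hρc : Continuous ρ := by
    rw [← continuousOn_univ]
    exact continuousOn_posRoot huc.continuousOn continuousOn_const fun t _ => hu0 t
  let F : ℝ → Fin 3 → ℝ := fun t => triple a b (ρ t * (1 - t)) (ρ t * t) e
  have hF : ∀ t, F t a = ρ t * (1 - t) ∧ F t b = ρ t * t ∧ F t c = e :=
    fun t => triple_apply hab hac hbc _ _ _
  have hFc : ContinuousOn F (Set.Icc 0 1) :=
    continuousOn_triple a b (by fun_prop) (by fun_prop) (by fun_prop)
  have hFT : ∀ t ∈ Set.Icc (0 : ℝ) 1, F t ∈ realTriangle x := fun t ht => by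
    refine ⟨triple_nonneg (mul_nonneg (hρ t).1.le (by linarith [ht.2]))
      (mul_nonneg (hρ t).1.le ht.1) hpc.le, ?_⟩
    rw [realComb_eq x hab hac hbc, (hF t).1, (hF t).2.1, (hF t).2.2, ← add_assoc]
    convert (hρ t).2 using 3
    simp only [u, smul_add, smul_smul]
    push_cast
    rfl
  have hFi : Set.InjOn F (Set.Icc 0 1) := by
    intro s _ t _ hst
    have e1 := congrFun hst a
    have e2 := congrFun hst b
    rw [(hF s).1, (hF t).1] at e1
    rw [(hF s).2.1, (hF t).2.1] at e2
    have e3 : ρ s = ρ t := by linarith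
    rw [e3] at e2
    exact mul_left_cancel₀ (hρ t).1.ne' e2
  have m0 : (0 : ℝ) ∈ Set.Icc (0 : ℝ) 1 := by simp
  have m1 : (1 : ℝ) ∈ Set.Icc (0 : ℝ) 1 := by simp
  have ha1 : F 1 a = 0 := by rw [(hF 1).1, sub_self, mul_zero]
  have hb0 : F 0 b = 0 := by rw [(hF 0).2.1, mul_zero]
  have hA0 : cornerDist x a (F 0) < δ := by
    have := h.cornerDist_le hab hac hbc (hFT 0 m0).1
    rw [hb0, (hF 0).2.2] at this
    linarith
  have hB1 : cornerDist x b (F 1) < δ := by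
    have := h.cornerDist_le hab.symm hbc hac (hFT 1 m1).1
    rw [ha1, (hF 1).2.2] at this
    linarith
  have hno : ∀ t ∈ Set.Icc (0 : ℝ) 1, cornerDist x a (F t) ≤ δ → δ < cornerDist x b (F t) := by
    intro t ht h1
    rcases le_max_iff.1 (hs.bound.corner_corner hab _ (hFT t ht)) with h2 | h2
    · linarith
    · linarith
  have hA1 : δ < cornerDist x a (F 1) := by
    by_contra! h1
    exact lt_asymm (hno 1 m1 h1) hB1
  obtain ⟨f, hf, hfF⟩ := exists_isArc (g := cornerDist x a) (h := cornerDist x b)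
    (k := δ) (k' := δ) hFc hFi (continuous_cornerDist x a) (continuous_cornerDist x b) hA0 hA1
    (hno 0 m0 hA0.le) hB1
    (fun s hs' t ht e1 e2 => hs.corner_unique h hac (hFT s hs') (hFT t ht) e1 e2 (hF s).2.2 (hF t).2.2)
    (fun s hs' t ht e1 e2 => hs.corner_unique h hbc (hFT s hs') (hFT t ht) e1 e2 (hF s).2.2 (hF t).2.2)
    hno
  refine ⟨f, hf, fun t ht => ?_⟩
  obtain ⟨s, hs', hst⟩ := hfF t ht
  rw [← hst]
  exact ⟨hFT s hs', (hF s).2.2⟩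

end SmallRadii

end Arrangement

/-! ### Concatenation of arcs -/

theorem exists_concatenation {X : Type*} [TopologicalSpace X] (f : ℕ → ℝ → X)
    (hf : ∀ j, ContinuousOn (f j) (Set.Icc 0 1)) (hm : ∀ j, f j 1 = f (j + 1) 0) (N : ℕ) :
    ∃ F : ℝ → X, Continuous F ∧ ∀ j ≤ N, ∀ t ∈ Set.Icc (0 : ℝ) 1, F (j + t) = f j t := by
  have hext : ∀ j, ∃ g : ℝ → X, Continuous g ∧ ∀ t ∈ Set.Icc (0 : ℝ) 1, g t = f j t := fun j =>
    ⟨fun t => f j (Set.projIcc 0 1 zero_le_one t), (hf j).comp_continuous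
      (continuous_subtype_val.comp (continuous_projIcc (h := zero_le_one))) fun t => Subtype.coe_prop _, fun t ht => by
      beta_reduce
      rw [Set.projIcc_of_mem zero_le_one ht]⟩
  induction N with
  | zero =>
    obtain ⟨g, hg, hgf⟩ := hext 0
    refine ⟨g, hg, fun j hj t ht => ?_⟩
    obtain rfl : j = 0 := by omega
    simpa using hgf t ht
  | succ N ih =>
    obtain ⟨F, hF, hFf⟩ := ih
    obtain ⟨g, hg, hgf⟩ := hext (N + 1)
    have hend : F (N + 1) = f (N + 1) 0 := by
      rw [← hm N]
      exact hFf N le_rfl 1 (by simp)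
    refine ⟨fun t => if t ≤ N + 1 then F t else g (t - (N + 1)), ?_, fun j hj t ht => ?_⟩
    · refine Continuous.if_le hF (by fun_prop) continuous_id continuous_const fun t ht => ?_
      rw [ht, sub_self, hgf 0 (by simp), hend]
    · rcases hj.lt_or_eq with hj | rfl
      · have h1 : (j : ℝ) ≤ N := by exact_mod_cast Nat.lt_succ_iff.1 hj
        beta_reduce
        rw [if_pos (by linarith [ht.2])]
        exact hFf j (Nat.lt_succ_iff.1 hj) t ht
      · push_cast
        split_ifs with h1
        · have : t = 0 := le_antisymm (by linarith) ht.1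
          rw [this, add_zero, hend]
        · rw [add_sub_cancel_left, hgf t ht]

theorem exists_fin_six_add {s : ℝ} (hs : s ∈ Set.Ico (0 : ℝ) 6) :
    ∃ j : Fin 6, ∃ t ∈ Set.Ico (0 : ℝ) 1, s = (j : ℕ) + t := by
  have h1 := Nat.floor_le hs.1
  have h2 := Nat.lt_floor_add_one s
  have h3 : ⌊s⌋₊ < 6 := by
    rw [Nat.floor_lt hs.1]; exact hs.2
  exact ⟨⟨⌊s⌋₊, h3⟩, s - ⌊s⌋₊, ⟨by linarith, by linarith⟩, by simp⟩

/-- A closed chain of six arcs, each of which lies in its own region and meets the regions of the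
other arcs only at the common end points, is an embedded circle. -/
theorem exists_circle_of_arcs {X : Type*} [TopologicalSpace X] (f : Fin 6 → ℝ → X)
    (hf : ∀ j, ContinuousOn (f j) (Set.Icc 0 1)) (hi : ∀ j, Set.InjOn (f j) (Set.Icc 0 1))
    (hm : ∀ j, f j 1 = f (j + 1) 0) (Γ : Fin 6 → X → Prop)
    (hself : ∀ j, ∀ t ∈ Set.Icc (0 : ℝ) 1, Γ j (f j t))
    (hother : ∀ j k, ∀ t ∈ Set.Icc (0 : ℝ) 1, Γ k (f j t) →
      k = j ∨ (k = j + 1 ∧ t = 1) ∨ (k + 1 = j ∧ t = 0)) :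
    ∃ F : ℝ → X, Continuous F ∧ F 6 = F 0 ∧ Set.InjOn F (Set.Ico 0 6) ∧
      ∀ j : Fin 6, ∀ t ∈ Set.Icc (0 : ℝ) 1, F ((j : ℕ) + t) = f j t := by
  obtain ⟨F, hF, hFf⟩ := exists_concatenation (fun j : ℕ => f (Fin.ofNat 6 j)) (fun j => hf _)
    (fun j => by
      rw [hm]
      congr 1
      ext
      simp [Fin.val_add]) 5
  have hFf' : ∀ j : Fin 6, ∀ t ∈ Set.Icc (0 : ℝ) 1, F ((j : ℕ) + t) = f j t := by
    intro j t ht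
    have := hFf j (by omega) t ht
    simpa using this
  refine ⟨F, hF, ?_, ?_, hFf'⟩
  · have h1 := hFf' 5 1 (by simp)
    have h2 := hFf' 0 0 (by simp)
    norm_num at h1 h2
    rw [h1, h2]
    exact hm 5
  · intro s hs t ht hst
    obtain ⟨j, s', hs', rfl⟩ := exists_fin_six_add hs
    obtain ⟨k, t', ht', rfl⟩ := exists_fin_six_add ht
    have ms : s' ∈ Set.Icc (0 : ℝ) 1 := ⟨hs'.1, hs'.2.le⟩
    have mt : t' ∈ Set.Icc (0 : ℝ) 1 := ⟨ht'.1, ht'.2.le⟩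
    rw [hFf' j s' ms, hFf' k t' mt] at hst
    have h1 := hother j k s' ms (by rw [hst]; exact hself k t' mt)
    have h2 := hother k j t' mt (by rw [← hst]; exact hself j s' ms)
    have h3 : k = j ∨ k + 1 = j := by
      rcases h1 with h1 | h1 | h1
      · exact Or.inl h1
      · exact absurd h1.2 hs'.2.ne
      · exact Or.inr h1.1
    have h4 : j = k ∨ j + 1 = k := by
      rcases h2 with h1 | h1 | h1
      · exact Or.inl h1
      · exact absurd h1.2 ht'.2.ne
      · exact Or.inr h1.1
    -- Otherwise j and k would each be the successor of the other, which is impossible modulo 6.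
    have h5 : j = k := by
      clear * - h3 h4
      revert j k; decide
    subst h5
    rw [hi j ms mt hst]

/-! ### Points of the boundary manifold in the real triangle -/

/-- Lying outside the open tube does not suffice for being on its frontier; this exhibits a point as
a limit of points of the tube along a path of vectors. -/
theorem mk_mem_closure {S : Set CP2} {γ : ℝ → C3} (hγ : Continuous γ) (h0 : γ 0 ≠ 0)
    (hS : ∀ t ∈ Set.Ioo (0 : ℝ) 1, ∀ h : γ t ≠ 0, Projectivization.mk ℂ (γ t) h ∈ S) :
    Projectivization.mk ℂ (γ 0) h0 ∈ closure S := by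
  classical
  let m : C3 → CP2 := fun v => if h : v ≠ 0 then Projectivization.mk ℂ v h else
    Projectivization.mk ℂ (γ 0) h0
  have hm : ∀ v (h : v ≠ 0), m v = Projectivization.mk ℂ v h := fun v h => dif_pos h
  have hmc : ContinuousAt m (γ 0) := by
    have hop : IsOpen {v : C3 | v ≠ 0} := isOpen_ne
    refine ContinuousOn.continuousAt (s := {v : C3 | v ≠ 0}) ?_ (hop.mem_nhds h0)
    rw [continuousOn_iff_continuous_domRestrict]
    exact CP2.isOpenQuotientMap_mk.continuous.congr fun v => (hm v v.2).symm
  have ht : Tendsto (fun t => m (γ t)) (𝓝[>] 0) (𝓝 (m (γ 0))) :=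
    (hmc.tendsto.comp hγ.continuousAt.tendsto).mono_left nhdsWithin_le_nhds
  rw [← hm (γ 0) h0]
  refine mem_closure_of_tendsto ht ?_
  filter_upwards [Ioo_mem_nhdsGT (zero_lt_one' ℝ),
    nhdsWithin_le_nhds (hγ.continuousAt.eventually_ne h0)] with t ht h
  rw [hm _ h]
  exact hS t ht h

namespace Arrangement

variable {n : ℕ} {A : Arrangement n} {x : Fin 3 → C3}

/-- A point of the real triangle outside of the neighbourhood of the arrangement, and far from the
lines and singular points that are not part of the triangle. -/
structure IsClear (A : Arrangement n) (x : Fin 3 → C3) (δ ε : ℝ) (q : Fin 3 → ℝ) : Prop where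
  mem : q ∈ realTriangle x
  coord_le : ∀ a, A.sideCoord x ε a ≤ q a
  delta_le : ∀ a, δ ≤ cornerDist x a q
  line_lt : ∀ i, (∀ a, i ≠ A.tri a) → ε < lineDist (A.line i) (Projectivization.mk ℂ _ (realComb_ne_zero mem))
  point_lt : ∀ P : A.SingularPoint, (∀ a, P ≠ A.corner a) →
    δ < pointDist P.1 (Projectivization.mk ℂ _ (realComb_ne_zero mem))

theorem GenericFrame.lineDist_tri (h : A.GenericFrame x) (a : Fin 3) (ε : ℝ) {q : Fin 3 → ℝ}
    (hq : q ∈ realTriangle x) :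
    lineDist (A.line (A.tri a)) (Projectivization.mk ℂ _ (realComb_ne_zero hq)) - ε =
      sideSlope (A.line (A.tri a)) (x a) * (q a - A.sideCoord x ε a) := by
  rw [lineDist_realComb _ hq, h.sideSlope_tri a hq, sideCoord, mul_sub,
    mul_div_cancel₀ _ (h.slope_pos a).ne']

theorem GenericFrame.mk_injOn (h : A.GenericFrame x) {q q' : Fin 3 → ℝ} (hq : q ∈ realTriangle x)
    (hq' : q' ∈ realTriangle x) (he : Projectivization.mk ℂ _ (realComb_ne_zero hq) =
      Projectivization.mk ℂ _ (realComb_ne_zero hq')) : q = q' := by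
  rw [Projectivization.mk_eq_mk_iff'] at he
  obtain ⟨c, hc⟩ := he
  have hc1 : ‖c‖ = 1 := by
    have := congrArg norm hc
    rwa [norm_smul, hq.2, hq'.2, mul_one] at this
  funext a
  have h1 : ∀ r : Fin 3 → ℝ, (A.line (A.tri a)).rep (realComb x r) =
      r a * (A.line (A.tri a)).rep (x a) := fun r => h.rep_sum (fun b => (r b : ℂ)) a
  have h2 := congrArg (A.line (A.tri a)).rep hc
  rw [map_smul, h1, h1, smul_eq_mul, ← mul_assoc] at h2
  have h3 := congrArg norm (mul_right_cancel₀ (h.diag a) h2)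
  rw [norm_mul, hc1, one_mul, Complex.norm_real, Complex.norm_real, Real.norm_of_nonneg (hq.1 a),
    Real.norm_of_nonneg (hq'.1 a)] at h3
  exact h3.symm

namespace SmallRadii

variable {d δ ε : ℝ}

/-- The coordinate c is below d, so the compactness bounds keep the opposite vertex and the foreign
objects away. Lines through a vertex stay outside their tubes since ε < dδ. The coordinates a and b
are large because the distances to the vertices b and a are at least δ while q c < δ/4. -/
theorem isClear_of_tube (hs : A.SmallRadii x d δ ε) (h : A.GenericFrame x) {a b c : Fin 3}
    (hab : a ≠ b) (hac : a ≠ c) (hbc : b ≠ c) {q : Fin 3 → ℝ} (hq : q ∈ realTriangle x)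
    (hc : q c = A.sideCoord x ε c) (ha : δ ≤ cornerDist x a q) (hb : δ ≤ cornerDist x b q) :
    A.IsClear x δ ε q ∧ A.sideCoord x ε a < q a ∧ A.sideCoord x ε b < q b ∧
      δ < cornerDist x c q := by
  have hca := hs.coord_lt a
  have hcb := hs.coord_lt b
  have hcc := hs.coord_lt c
  have hd := hs.delta_lt
  have hd0 := hs.delta_pos
  have hε := hs.eps_lt
  have hdd := hs.d_le
  have hqd : q c < d := by rw [hc]; linarith
  have hεd : ε < d := by nlinarith
  have hpos := hs.coord_pos h a
  have hpos' := hs.coord_pos h b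
  have hpos'' := hs.coord_pos h c
  have hC : d ≤ cornerDist x c q := (le_max_iff.1 (hs.bound.coord_corner c q hq)).resolve_left
    hqd.not_ge
  have h1 : A.sideCoord x ε a < q a := by
    have := h.cornerDist_le hab.symm hbc hac hq.1
    linarith
  have h2 : A.sideCoord x ε b < q b := by
    have := h.cornerDist_le hab hac hbc hq.1
    linarith
  have key : ∀ a b c : Fin 3, a ≠ b → a ≠ c → b ≠ c → ∀ i, i = a ∨ i = b ∨ i = c := by decide
  have hD : ∀ i, δ ≤ cornerDist x i q := by
    intro i
    rcases key a b c hab hac hbc i with rfl | rfl | rfl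
    exacts [ha, hb, by linarith]
  refine ⟨⟨hq, fun i => ?_, hD, fun i hi => ?_, fun P hP => ?_⟩, h1, h2, by linarith⟩
  · rcases key a b c hab hac hbc i with rfl | rfl | rfl
    exacts [h1.le, h2.le, hc.ge]
  · rw [lineDist_realComb _ hq]
    by_cases hix : ∀ a, (A.line i).rep (x a) ≠ 0
    · have := (le_max_iff.1 (hs.bound.coord_line i hi hix c q hq)).resolve_left hqd.not_ge
      linarith
    · push Not at hix
      obtain ⟨a', ha'⟩ := hix
      have h3 := hs.bound.line_through i hi a' ha' q hq
      have h4 := mul_le_mul_of_nonneg_left (hD a') hs.d_pos.le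
      linarith
  · have := (le_max_iff.1 (hs.bound.coord_point P hP c q hq)).resolve_left hqd.not_ge
    linarith

/-- At distance δ < d of one vertex, the bounds keep away the other vertices, the opposite side and
all foreign points and lines, except for lines through the vertex, which are handled by ε < dδ. -/
theorem isClear_of_ball (hs : A.SmallRadii x d δ ε) {a b c : Fin 3}
    (hab : a ≠ b) (hac : a ≠ c) (hbc : b ≠ c) {q : Fin 3 → ℝ} (hq : q ∈ realTriangle x)
    (ha : cornerDist x a q = δ) (hb : A.sideCoord x ε b ≤ q b) (hc : A.sideCoord x ε c ≤ q c) :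
    A.IsClear x δ ε q ∧ A.sideCoord x ε a < q a ∧ δ < cornerDist x b q ∧
      δ < cornerDist x c q := by
  have hca := hs.coord_lt a
  have hd := hs.delta_lt
  have hd0 := hs.delta_pos
  have hε := hs.eps_lt
  have hdd := hs.d_le
  have had : cornerDist x a q < d := by rw [ha]; linarith
  have hεd : ε < d := by nlinarith
  have hB : d ≤ cornerDist x b q :=
    (le_max_iff.1 (hs.bound.corner_corner hab q hq)).resolve_left had.not_ge
  have hC : d ≤ cornerDist x c q :=
    (le_max_iff.1 (hs.bound.corner_corner hac q hq)).resolve_left had.not_ge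
  have hA : d ≤ q a := (le_max_iff.1 (hs.bound.coord_corner a q hq)).resolve_right had.not_ge
  have key : ∀ a b c : Fin 3, a ≠ b → a ≠ c → b ≠ c → ∀ i, i = a ∨ i = b ∨ i = c := by decide
  have hD : ∀ i, δ ≤ cornerDist x i q := by
    intro i
    rcases key a b c hab hac hbc i with rfl | rfl | rfl
    exacts [ha.ge, by linarith, by linarith]
  refine ⟨⟨hq, fun i => ?_, hD, fun i hi => ?_, fun P hP => ?_⟩, by linarith, by linarith, by linarith⟩
  · rcases key a b c hab hac hbc i with rfl | rfl | rfl
    exacts [by linarith, hb, hc]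
  · rw [lineDist_realComb _ hq]
    by_cases hix : (A.line i).rep (x a) = 0
    · have h3 := hs.bound.line_through i hi a hix q hq
      rw [ha] at h3
      linarith
    · have := (le_max_iff.1 (hs.bound.corner_line i a hix q hq)).resolve_left had.not_ge
      linarith
  · have := (le_max_iff.1 (hs.bound.corner_point P hP a q hq)).resolve_left had.not_ge
    linarith

theorem mk_mem_closure_of_tube (hs : A.SmallRadii x d δ ε) (h : A.GenericFrame x) {c : Fin 3}
    {q : Fin 3 → ℝ} (hq : q ∈ realTriangle x) (hc : q c = A.sideCoord x ε c) :
    Projectivization.mk ℂ _ (realComb_ne_zero hq) ∈ closure (A.tube δ ε) := by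
  have hd := hs.delta_lt
  have hdd := hs.d_le
  have hcc := hs.coord_lt c
  have hcp := hs.coord_pos h c
  have key := mk_mem_closure (S := A.tube δ ε)
    -- Shrinking the coordinate c multiplies the equation of the side by 1 - t, whereas the norm
    -- stays above 1 - t because q c < 1.
    (γ := fun t : ℝ => realComb x q - ((t * q c : ℝ) : ℂ) • x c) (by fun_prop)
    (by simpa using realComb_ne_zero hq) fun t ht h0 => by
      refine Or.inl ⟨A.tri c, ?_⟩
      rw [lineDist_mk, div_lt_iff₀ (mul_pos (norm_pos_iff.2 (Projectivization.rep_nonzero _))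
        (norm_pos_iff.2 h0))]
      have h1 : (A.line (A.tri c)).rep (realComb x q) = q c * (A.line (A.tri c)).rep (x c) :=
        h.rep_sum (fun b => (q b : ℂ)) c
      have h2 : ‖(A.line (A.tri c)).rep (realComb x q - ((t * q c : ℝ) : ℂ) • x c)‖ =
          (1 - t) * (ε * ‖(A.line (A.tri c)).rep‖) := by
        rw [map_sub, h1, map_smul, smul_eq_mul, ← sub_mul, norm_mul, ← Complex.ofReal_sub,
          Complex.norm_real, show q c - t * q c = (1 - t) * q c by ring,
          Real.norm_of_nonneg (mul_nonneg (by linarith [ht.2]) (hq.1 c)), hc, sideCoord, sideSlope]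
        have : ‖(A.line (A.tri c)).rep‖ ≠ 0 := norm_ne_zero_iff.2 (Projectivization.rep_nonzero _)
        have : ‖(A.line (A.tri c)).rep (x c)‖ ≠ 0 := norm_ne_zero_iff.2 (h.diag c)
        field_simp
      have h3 : 1 - t < ‖realComb x q - ((t * q c : ℝ) : ℂ) • x c‖ := by
        have h4 := norm_sub_norm_le (realComb x q) (((t * q c : ℝ) : ℂ) • x c)
        rw [hq.2, norm_smul_x h (mul_nonneg ht.1.le (hq.1 c)), hc] at h4
        rw [hc]
        nlinarith [ht.1]
      refine (h2.trans_lt (mul_lt_mul_of_pos_right h3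
        (mul_pos hs.eps_pos (norm_pos_iff.2 (Projectivization.rep_nonzero _))))).trans_eq ?_
      ring
  simpa using key

theorem mk_mem_closure_of_ball (hs : A.SmallRadii x d δ ε) (h : A.GenericFrame x) {a : Fin 3}
    {q : Fin 3 → ℝ} (hq : q ∈ realTriangle x) (ha : cornerDist x a q = δ) :
    Projectivization.mk ℂ _ (realComb_ne_zero hq) ∈ closure (A.tube δ ε) := by
  have hd := hs.delta_lt
  have hdd := hs.d_le
  have hd0 := hs.delta_pos
  have key := mk_mem_closure (S := A.tube δ ε)
    -- Stretching the component along `x a` leaves the orthogonal one unchanged and increases the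
    -- norm, so the distance to the vertex drops below δ.
    (γ := fun t : ℝ => realComb x q + ((t : ℂ) * inner ℂ (x a) (realComb x q)) • x a)
    (continuous_const.add ((Complex.continuous_ofReal.mul continuous_const).smul continuous_const))
    (by simpa using realComb_ne_zero hq) fun t ht h0 => by
      refine Or.inr ⟨A.corner a, ?_⟩
      rw [h.corner_eq, pointDist_mk_perp (h.norm_one a), div_lt_iff₀ (norm_pos_iff.2 h0)]
      have h1 : perp (x a) (realComb x q + ((t : ℂ) * inner ℂ (x a) (realComb x q)) • x a) =
          perp (x a) (realComb x q) := by
        rw [perp_add, perp_smul, perp_self (h.norm_one a), smul_zero, add_zero]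
      have h2 := norm_sq_eq_perp (h.norm_one a)
        (realComb x q + ((t : ℂ) * inner ℂ (x a) (realComb x q)) • x a)
      have h3 := norm_sq_eq_perp (h.norm_one a) (realComb x q)
      rw [h1] at h2 ⊢
      have h4 : (inner ℂ (x a) (realComb x q + ((t : ℂ) * inner ℂ (x a) (realComb x q)) • x a) : ℂ) =
          ((1 + t : ℝ) : ℂ) * inner ℂ (x a) (realComb x q) := by
        rw [inner_add_right, inner_smul_right, inner_self_eq_norm_sq_to_K, h.norm_one]
        push_cast
        simp
        ring
      rw [h4, norm_mul, Complex.norm_real, Real.norm_of_nonneg (by linarith [ht.1]), mul_pow] at h2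
      have ha' : ‖perp (x a) (realComb x q)‖ = δ := ha
      rw [hq.2, ha'] at h3
      rw [ha'] at h2 ⊢
      have h5 : 1 < ‖realComb x q + ((t : ℂ) * inner ℂ (x a) (realComb x q)) • x a‖ := by
        have hpos : 0 < ‖(inner ℂ (x a) (realComb x q) : ℂ)‖ ^ 2 := by nlinarith
        have h6 : (1 : ℝ) ^ 2 < ‖realComb x q + ((t : ℂ) * inner ℂ (x a) (realComb x q)) • x a‖ ^ 2 := by
          rw [h2, h3]
          nlinarith [mul_pos ht.1 hpos, mul_pos (mul_pos ht.1 ht.1) hpos]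
        exact lt_of_pow_lt_pow_left₀ 2 (norm_nonneg _) h6
      nlinarith
  simpa using key

end SmallRadii

theorem IsClear.mem_boundary (h : A.GenericFrame x) {δ ε : ℝ} {q : Fin 3 → ℝ}
    (hq : A.IsClear x δ ε q) (hcl : Projectivization.mk ℂ _ (realComb_ne_zero hq.mem) ∈
      closure (A.tube δ ε)) :
    Projectivization.mk ℂ _ (realComb_ne_zero hq.mem) ∈ A.boundary δ ε := by
  rw [mem_boundary_iff]
  refine ⟨hcl, fun i => ?_, fun P => ?_⟩
  · by_cases hi : ∀ a, i ≠ A.tri a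
    · exact (hq.line_lt i hi).le
    · push Not at hi
      obtain ⟨a, rfl⟩ := hi
      rw [← sub_nonneg, h.lineDist_tri a ε hq.mem]
      exact mul_nonneg (h.slope_pos a).le (sub_nonneg.2 (hq.coord_le a))
  · by_cases hP : ∀ a, P ≠ A.corner a
    · exact (hq.point_lt P hP).le
    · push Not at hP
      obtain ⟨a, rfl⟩ := hP
      rw [h.pointDist_corner a hq.mem]
      exact hq.delta_le a

end Arrangement

/-! ### Assembling six arcs into a nearby cycle -/

namespace Arrangement

variable {n : ℕ} {A : Arrangement n} {x : Fin 3 → C3} {d δ ε : ℝ}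

/-- The arc of a nearby cycle around a vertex `a`, from the side opposite to `b` to the side opposite
to `c`. -/
structure IsBallArc (A : Arrangement n) (x : Fin 3 → C3) (δ ε : ℝ) (a b c : Fin 3)
    (f : ℝ → Fin 3 → ℝ) : Prop where
  continuousOn : ContinuousOn f (Set.Icc 0 1)
  injOn : Set.InjOn f (Set.Icc 0 1)
  clear : ∀ t ∈ Set.Icc (0 : ℝ) 1, A.IsClear x δ ε (f t)
  dist : ∀ t ∈ Set.Icc (0 : ℝ) 1, cornerDist x a (f t) = δ
  dist_b : ∀ t ∈ Set.Icc (0 : ℝ) 1, cornerDist x b (f t) ≠ δ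
  dist_c : ∀ t ∈ Set.Icc (0 : ℝ) 1, cornerDist x c (f t) ≠ δ
  coord_a : ∀ t ∈ Set.Icc (0 : ℝ) 1, f t a ≠ A.sideCoord x ε a
  coord_b : ∀ t ∈ Set.Icc (0 : ℝ) 1, f t b = A.sideCoord x ε b → t = 0
  coord_c : ∀ t ∈ Set.Icc (0 : ℝ) 1, f t c = A.sideCoord x ε c → t = 1
  start : f 0 b = A.sideCoord x ε b
  finish : f 1 c = A.sideCoord x ε c

/-- The arc of a nearby cycle along the side opposite to `c`, from the vertex `a` to the
vertex `b`. -/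
structure IsTubeArc (A : Arrangement n) (x : Fin 3 → C3) (δ ε : ℝ) (a b c : Fin 3)
    (f : ℝ → Fin 3 → ℝ) : Prop where
  continuousOn : ContinuousOn f (Set.Icc 0 1)
  injOn : Set.InjOn f (Set.Icc 0 1)
  clear : ∀ t ∈ Set.Icc (0 : ℝ) 1, A.IsClear x δ ε (f t)
  coord : ∀ t ∈ Set.Icc (0 : ℝ) 1, f t c = A.sideCoord x ε c
  coord_a : ∀ t ∈ Set.Icc (0 : ℝ) 1, f t a ≠ A.sideCoord x ε a
  coord_b : ∀ t ∈ Set.Icc (0 : ℝ) 1, f t b ≠ A.sideCoord x ε b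
  dist_c : ∀ t ∈ Set.Icc (0 : ℝ) 1, cornerDist x c (f t) ≠ δ
  dist_a : ∀ t ∈ Set.Icc (0 : ℝ) 1, cornerDist x a (f t) = δ → t = 0
  dist_b : ∀ t ∈ Set.Icc (0 : ℝ) 1, cornerDist x b (f t) = δ → t = 1
  start : cornerDist x a (f 0) = δ
  finish : cornerDist x b (f 1) = δ

namespace SmallRadii

theorem exists_isBallArc (hs : A.SmallRadii x d δ ε) (h : A.GenericFrame x) {a b c : Fin 3}
    (hab : a ≠ b) (hac : a ≠ c) (hbc : b ≠ c) : ∃ f, A.IsBallArc x δ ε a b c f := by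
  obtain ⟨f, hf, hfT⟩ := hs.exists_ballArc h hab hac hbc
  have hcl := fun t ht => hs.isClear_of_ball hab hac hbc (hfT t ht).1 (hfT t ht).2
    (hf.start_le t ht) (hf.end_le t ht)
  exact ⟨f, hf.continuousOn, hf.injOn, fun t ht => (hcl t ht).1, fun t ht => (hfT t ht).2,
    fun t ht => (hcl t ht).2.2.1.ne', fun t ht => (hcl t ht).2.2.2.ne',
    fun t ht => (hcl t ht).2.1.ne', hf.eq_start, hf.eq_end, hf.start_eq, hf.end_eq⟩

theorem exists_isTubeArc (hs : A.SmallRadii x d δ ε) (h : A.GenericFrame x) {a b c : Fin 3}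
    (hab : a ≠ b) (hac : a ≠ c) (hbc : b ≠ c) : ∃ f, A.IsTubeArc x δ ε a b c f := by
  obtain ⟨f, hf, hfT⟩ := hs.exists_tubeArc h hab hac hbc
  have hcl := fun t ht => hs.isClear_of_tube h hab hac hbc (hfT t ht).1 (hfT t ht).2
    (hf.start_le t ht) (hf.end_le t ht)
  exact ⟨f, hf.continuousOn, hf.injOn, fun t ht => (hcl t ht).1, fun t ht => (hfT t ht).2,
    fun t ht => (hcl t ht).2.1.ne', fun t ht => (hcl t ht).2.2.1.ne',
    fun t ht => (hcl t ht).2.2.2.ne', hf.eq_start, hf.eq_end, hf.start_eq, hf.end_eq⟩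

end SmallRadii

/-- The region of the real triangle corresponding to the piece of a line or of a vertex. -/
def region (A : Arrangement n) (x : Fin 3 → C3) (δ ε : ℝ) : Fin 3 ⊕ Fin 3 → (Fin 3 → ℝ) → Prop
  | .inl c, q => q c = A.sideCoord x ε c
  | .inr a, q => cornerDist x a q = δ

/-- The order in which a nearby cycle runs through the pieces. -/
def itinerary : Fin 6 → Fin 3 ⊕ Fin 3 := ![.inr 2, .inl 1, .inr 0, .inl 2, .inr 1, .inl 0]

/-- Consecutive arcs agree at their ends because a point at distance δ of a vertex and ε of an
adjacent side is unique; the strict inequalities of the clear position keep nonconsecutive arcs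
apart. -/
theorem SmallRadii.exists_circle (hs : A.SmallRadii x d δ ε) (h : A.GenericFrame x) :
    ∃ F : ℝ → Fin 3 → ℝ, Continuous F ∧ F 6 = F 0 ∧ Set.InjOn F (Set.Ico 0 6) ∧
      ∀ j : Fin 6, ∀ t ∈ Set.Icc (0 : ℝ) 1, A.IsClear x δ ε (F ((j : ℕ) + t)) ∧
        A.region x δ ε (itinerary j) (F ((j : ℕ) + t)) := by
  obtain ⟨b0, hb0⟩ := hs.exists_isBallArc h (a := 0) (b := 1) (c := 2) (by decide) (by decide) (by decide)
  obtain ⟨b1, hb1⟩ := hs.exists_isBallArc h (a := 1) (b := 2) (c := 0) (by decide) (by decide) (by decide)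
  obtain ⟨b2, hb2⟩ := hs.exists_isBallArc h (a := 2) (b := 0) (c := 1) (by decide) (by decide) (by decide)
  obtain ⟨s0, hs0⟩ := hs.exists_isTubeArc h (a := 1) (b := 2) (c := 0) (by decide) (by decide) (by decide)
  obtain ⟨s1, hs1⟩ := hs.exists_isTubeArc h (a := 2) (b := 0) (c := 1) (by decide) (by decide) (by decide)
  obtain ⟨s2, hs2⟩ := hs.exists_isTubeArc h (a := 0) (b := 1) (c := 2) (by decide) (by decide) (by decide)
  have m0 : (0 : ℝ) ∈ Set.Icc (0 : ℝ) 1 := by simp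
  have m1 : (1 : ℝ) ∈ Set.Icc (0 : ℝ) 1 := by simp
  have glue1 : ∀ {a b c : Fin 3} {f g : ℝ → Fin 3 → ℝ}, a ≠ c → A.IsBallArc x δ ε a b c f →
      A.IsTubeArc x δ ε a b c g → f 1 = g 0 := fun hac hf hg =>
    hs.corner_unique h hac (hf.clear 1 m1).mem (hg.clear 0 m0).mem (hf.dist 1 m1) hg.start hf.finish
      (hg.coord 0 m0)
  have glue2 : ∀ {a b c : Fin 3} {f g : ℝ → Fin 3 → ℝ}, b ≠ c → A.IsTubeArc x δ ε a b c f →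
      A.IsBallArc x δ ε b c a g → f 1 = g 0 := fun hac hf hg =>
    hs.corner_unique h hac (hf.clear 1 m1).mem (hg.clear 0 m0).mem hf.finish (hg.dist 0 m0)
      (hf.coord 1 m1) hg.start
  let f : Fin 6 → ℝ → Fin 3 → ℝ := ![b2, s1, b0, s2, b1, s0]
  have hclear : ∀ j, ∀ t ∈ Set.Icc (0 : ℝ) 1, A.IsClear x δ ε (f j t) := by
    intro j
    fin_cases j
    exacts [hb2.clear, hs1.clear, hb0.clear, hs2.clear, hb1.clear, hs0.clear]
  have hself : ∀ j, ∀ t ∈ Set.Icc (0 : ℝ) 1, A.region x δ ε (itinerary j) (f j t) := by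
    intro j
    fin_cases j
    exacts [hb2.dist, hs1.coord, hb0.dist, hs2.coord, hb1.dist, hs0.coord]
  obtain ⟨F, hF, hF6, hFi, hFf⟩ := exists_circle_of_arcs f
    (by
      intro j
      fin_cases j
      exacts [hb2.continuousOn, hs1.continuousOn, hb0.continuousOn, hs2.continuousOn,
        hb1.continuousOn, hs0.continuousOn])
    (by
      intro j
      fin_cases j
      exacts [hb2.injOn, hs1.injOn, hb0.injOn, hs2.injOn, hb1.injOn, hs0.injOn])
    (by
      intro j
      fin_cases j
      exacts [glue1 (by decide) hb2 hs1, glue2 (by decide) hs1 hb0, glue1 (by decide) hb0 hs2,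
        glue2 (by decide) hs2 hb1, glue1 (by decide) hb1 hs0, glue2 (by decide) hs0 hb2])
    (fun j => A.region x δ ε (itinerary j)) hself
    (by
      intro j k t ht
      have ball : ∀ {a b c : Fin 3} {g : ℝ → Fin 3 → ℝ} {j : Fin 6}, A.IsBallArc x δ ε a b c g →
          itinerary j = .inr a → itinerary (j + 1) = .inl c → itinerary (j + 5) = .inl b →
          itinerary (j + 2) = .inr b → itinerary (j + 3) = .inl a → itinerary (j + 4) = .inr c →
          A.region x δ ε (itinerary k) (g t) → k = j ∨ (k = j + 1 ∧ t = 1) ∨ (k + 1 = j ∧ t = 0) := by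
        intro a b c g j hg e0 e1 e5 e2 e3 e4 hr
        -- The six regions are compared by their offset from j: only the neighbours, at offsets 1
        -- and 5, are touched, and at one end of the arc each.
        obtain ⟨i, rfl⟩ : ∃ i, k = j + i := ⟨k - j, by abel⟩
        fin_cases i
        · left; simp
        · rw [show j + (fun i => i) (⟨1, by omega⟩ : Fin 6) = j + 1 from rfl, e1] at hr
          exact Or.inr (Or.inl ⟨rfl, hg.coord_c t ht hr⟩)
        · rw [show j + (fun i => i) (⟨2, by omega⟩ : Fin 6) = j + 2 from rfl, e2] at hr
          exact absurd hr (hg.dist_b t ht)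
        · rw [show j + (fun i => i) (⟨3, by omega⟩ : Fin 6) = j + 3 from rfl, e3] at hr
          exact absurd hr (hg.coord_a t ht)
        · rw [show j + (fun i => i) (⟨4, by omega⟩ : Fin 6) = j + 4 from rfl, e4] at hr
          exact absurd hr (hg.dist_c t ht)
        · rw [show j + (fun i => i) (⟨5, by omega⟩ : Fin 6) = j + 5 from rfl, e5] at hr
          refine Or.inr (Or.inr ⟨?_, hg.coord_b t ht hr⟩)
          clear * -
          revert j; decide
      have tube : ∀ {a b c : Fin 3} {g : ℝ → Fin 3 → ℝ} {j : Fin 6}, A.IsTubeArc x δ ε a b c g →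
          itinerary j = .inl c → itinerary (j + 1) = .inr b → itinerary (j + 5) = .inr a →
          itinerary (j + 2) = .inl a → itinerary (j + 3) = .inr c → itinerary (j + 4) = .inl b →
          A.region x δ ε (itinerary k) (g t) → k = j ∨ (k = j + 1 ∧ t = 1) ∨ (k + 1 = j ∧ t = 0) := by
        intro a b c g j hg e0 e1 e5 e2 e3 e4 hr
        obtain ⟨i, rfl⟩ : ∃ i, k = j + i := ⟨k - j, by abel⟩
        fin_cases i
        · left; simp
        · rw [show j + (fun i => i) (⟨1, by omega⟩ : Fin 6) = j + 1 from rfl, e1] at hr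
          exact Or.inr (Or.inl ⟨rfl, hg.dist_b t ht hr⟩)
        · rw [show j + (fun i => i) (⟨2, by omega⟩ : Fin 6) = j + 2 from rfl, e2] at hr
          exact absurd hr (hg.coord_a t ht)
        · rw [show j + (fun i => i) (⟨3, by omega⟩ : Fin 6) = j + 3 from rfl, e3] at hr
          exact absurd hr (hg.dist_c t ht)
        · rw [show j + (fun i => i) (⟨4, by omega⟩ : Fin 6) = j + 4 from rfl, e4] at hr
          exact absurd hr (hg.coord_b t ht)
        · rw [show j + (fun i => i) (⟨5, by omega⟩ : Fin 6) = j + 5 from rfl, e5] at hr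
          refine Or.inr (Or.inr ⟨?_, hg.dist_a t ht hr⟩)
          clear * -
          revert j; decide
      fin_cases j
      exacts [ball hb2 rfl rfl rfl rfl rfl rfl, tube hs1 rfl rfl rfl rfl rfl rfl,
        ball hb0 rfl rfl rfl rfl rfl rfl, tube hs2 rfl rfl rfl rfl rfl rfl,
        ball hb1 rfl rfl rfl rfl rfl rfl, tube hs0 rfl rfl rfl rfl rfl rfl])
  refine ⟨F, hF, hF6, hFi, fun j t ht => ?_⟩
  rw [hFf j t ht]
  exact ⟨hclear j t ht, hself j t ht⟩

/-- The vertex of the incidence graph corresponding to a side or a vertex of the triangle. -/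
def triVertex (A : Arrangement n) : Fin 3 ⊕ Fin 3 → A.Vertex := Sum.map A.tri A.corner

theorem SmallRadii.mem_piece (hs : A.SmallRadii x d δ ε) (h : A.GenericFrame x) {q : Fin 3 → ℝ}
    (hq : A.IsClear x δ ε q) {v : Fin 3 ⊕ Fin 3} (hv : A.region x δ ε v q) :
    Projectivization.mk ℂ _ (realComb_ne_zero hq.mem) ∈ A.piece δ ε (A.triVertex v) := by
  rcases v with c | a
  · refine ⟨hq.mem_boundary h (hs.mk_mem_closure_of_tube h hq.mem hv), ?_⟩
    rw [← sub_eq_zero]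
    refine (h.lineDist_tri c ε hq.mem).trans ?_
    rw [show q c = A.sideCoord x ε c from hv, sub_self, mul_zero]
  · exact ⟨hq.mem_boundary h (hs.mk_mem_closure_of_ball h hq.mem hv),
      (h.pointDist_corner a hq.mem).trans hv⟩

theorem GenericFrame.not_mem_piece (h : A.GenericFrame x) {q : Fin 3 → ℝ}
    (hq : A.IsClear x δ ε q) {v : A.Vertex} (hv : v ∉ chainVertices A.triangle) :
    Projectivization.mk ℂ _ (realComb_ne_zero hq.mem) ∉ A.piece δ ε v := by
  rw [h.mem_chainVertices] at hv
  push Not at hv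
  rcases v with i | P
  · intro hp
    exact (hq.line_lt i fun a ha => hv.1 a (by rw [ha])).ne' hp.2
  · intro hp
    exact (hq.point_lt P fun a ha => hv.2 a (by rw [ha])).ne' hp.2

theorem adj_corner (A : Arrangement n) {a b : Fin 3} (h : a ≠ b) :
    A.incidenceGraph.Adj (.inl (A.tri b)) (.inr (A.corner a)) :=
  A.corner_onLine h

/-- The closed walk around the triangle. -/
def triangleWalk (A : Arrangement n) : A.incidenceGraph.Walk (.inl (A.tri 0)) (.inl (A.tri 0)) :=
  .cons (A.adj_corner (a := 2) (by decide)) <| .cons (A.adj_corner (b := 1) (by decide)).symm <|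
  .cons (A.adj_corner (a := 0) (by decide)) <| .cons (A.adj_corner (b := 2) (by decide)).symm <|
  .cons (A.adj_corner (a := 1) (by decide)) <| .cons (A.adj_corner (b := 0) (by decide)).symm .nil

theorem walkChain_triangleWalk (A : Arrangement n) : walkChain A.triangleWalk = A.triangle := by
  simp only [triangleWalk, walkChain_cons, triangle_eq]
  simp only [walkChain, SimpleGraph.Walk.darts_nil, List.map_nil, List.sum_nil, add_zero, add_assoc]

/-- The walk starts at side 0, which the itinerary reaches last, hence the shift by one. -/
theorem getVert_triangleWalk (A : Arrangement n) (j : Fin 6) :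
    A.triangleWalk.getVert (j + 1) = A.triVertex (itinerary j) := by
  fin_cases j <;> rfl

theorem SmallRadii.exists_nearbyCycle (hs : A.SmallRadii x d δ ε) (h : A.GenericFrame x) :
    ∃ (b : A.Complement) (c : Path b b), A.IsNearbyCycle δ ε A.triangle c := by
  obtain ⟨F, hF, hF6, hFi, hFr⟩ := hs.exists_circle h
  have hdecomp : ∀ t : unitInterval, ∃ j : Fin 6, ∃ r ∈ Set.Icc (0 : ℝ) 1, 6 * (t : ℝ) = (j : ℕ) + r := by
    intro t
    rcases eq_or_ne (t : ℝ) 1 with ht | ht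
    · exact ⟨5, 1, by simp, by rw [ht]; norm_num⟩
    · obtain ⟨j, r, hr, e⟩ := exists_fin_six_add (s := 6 * (t : ℝ))
        ⟨by linarith [t.2.1], by linarith [lt_of_le_of_ne t.2.2 ht]⟩
      exact ⟨j, r, ⟨hr.1, hr.2.le⟩, e⟩
  have hclear : ∀ t : unitInterval, A.IsClear x δ ε (F (6 * (t : ℝ))) := fun t => by
    obtain ⟨j, r, hr, e⟩ := hdecomp t
    rw [e]
    exact (hFr j r hr).1
  let p : unitInterval → CP2 := fun t => Projectivization.mk ℂ _ (realComb_ne_zero (hclear t).mem)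
  have hpb : ∀ t, p t ∈ A.boundary δ ε := fun t => by
    obtain ⟨j, r, hr, e⟩ := hdecomp t
    have := (hFr j r hr).2
    rw [← e] at this
    have h1 := hs.mem_piece h (hclear t) this
    rcases hv : A.triVertex (itinerary j) with v | v <;> rw [hv] at h1 <;> exact h1.1
  have hpc : Continuous p := by
    refine CP2.isOpenQuotientMap_mk.continuous.comp (f := fun t : unitInterval =>
      (⟨_, realComb_ne_zero (hclear t).mem⟩ : {v : C3 // v ≠ 0})) ?_
    exact Continuous.subtype_mk ((continuous_realComb x).comp (by fun_prop)) _
  have hpA : ∀ t i, ¬ OnLine (p t) (A.line i) := by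
    intro t i hi
    have h1 := ((A.mem_boundary_iff δ ε _).1 (hpb t)).2.1 i
    rw [lineDist, show (A.line i).rep (p t).rep = 0 from hi, norm_zero, zero_div] at h1
    exact absurd hs.eps_pos h1.not_gt
  have hinj : ∀ s t : unitInterval, p s = p t → F (6 * (s : ℝ)) = F (6 * (t : ℝ)) := fun s t hst =>
    h.mk_injOn (hclear s).mem (hclear t).mem hst
  have hp01 : p 1 = p 0 := by
    have : F (6 * ((1 : unitInterval) : ℝ)) = F (6 * ((0 : unitInterval) : ℝ)) := by simpa using hF6
    simp only [p, this]
  let c : Path (⟨p 0, hpA 0⟩ : A.Complement) ⟨p 0, hpA 0⟩ :=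
    ⟨⟨fun t => ⟨p t, hpA t⟩, hpc.subtype_mk _⟩, rfl, Subtype.ext hp01⟩
  have hIco : ∀ t : unitInterval, t ≠ 1 → 6 * (t : ℝ) ∈ Set.Ico (0 : ℝ) 6 := fun t ht => by
    have : (t : ℝ) ≠ 1 := fun h => ht (Subtype.ext h)
    exact ⟨by linarith [t.2.1], by linarith [lt_of_le_of_ne t.2.2 this]⟩
  have hFeq : ∀ s t : unitInterval, s ≠ 1 → t ≠ 1 → p s = p t → s = t := by
    intro s t hs1 ht1 hst
    have := hFi (hIco s hs1) (hIco t ht1) (hinj s t hst)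
    exact Subtype.ext (by linarith)
  refine ⟨_, c, hpb, ?_, fun v hv t => h.not_mem_piece (hclear t) hv, _, A.triangleWalk, ?_,
    A.walkChain_triangleWalk⟩
  · intro s t hst
    have hst' : p s = p t := congrArg Subtype.val hst
    by_cases hs1 : s = 1
    · by_cases ht1 : t = 1
      · exact Or.inl (hs1.trans ht1.symm)
      · rw [hs1, hp01] at hst'
        exact Or.inr (Or.inr ⟨hs1, (hFeq 0 t zero_ne_one ht1 hst').symm⟩)
    · by_cases ht1 : t = 1
      · rw [ht1, hp01] at hst'
        exact Or.inr (Or.inl ⟨hFeq s 0 hs1 zero_ne_one hst', ht1⟩)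
      · exact Or.inl (hFeq s t hs1 ht1 hst')
  · have hval : ∀ j : ℕ, j ≤ 6 →
        ((Set.projIcc (0 : ℝ) 1 zero_le_one ((j : ℝ) / 6) : unitInterval) : ℝ) = j / 6 := by
      intro j hj
      have : (j : ℝ) ≤ 6 := by exact_mod_cast hj
      rw [Set.projIcc_of_mem zero_le_one ⟨by positivity, by linarith⟩]
    have hreg : ∀ (j : Fin 6) (s : unitInterval), ((j : ℕ) : ℝ) / 6 ≤ s → (s : ℝ) ≤ ((j : ℕ) + 1) / 6 →
        p s ∈ A.piece δ ε (A.triVertex (itinerary j)) := by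
      intro j s h1 h2
      refine hs.mem_piece h (hclear s) ?_
      have := (hFr j (6 * s - (j : ℕ)) ⟨by linarith, by linarith⟩).2
      rwa [add_sub_cancel] at this
    -- Truncated subtraction makes the first interval the single time 0, spent on side 0. This is
    -- legitimate because the circle closes up on that side, where its last arc ends.
    refine ⟨fun j => Set.projIcc (0 : ℝ) 1 zero_le_one (((j - 1 : ℕ) : ℝ) / 6), ?_, ?_, ?_, ?_⟩
    · intro j k hjk
      refine Set.monotone_projIcc _ ?_
      have : ((j - 1 : ℕ) : ℝ) ≤ (k - 1 : ℕ) := by exact_mod_cast Nat.sub_le_sub_right hjk 1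
      linarith
    · exact Subtype.ext (by simp)
    · refine Subtype.ext ((hval 6 le_rfl).trans ?_)
      norm_num
    · intro j hj s hsj
      have hj6 : j ≤ 6 := hj
      have h1 : ((j - 1 : ℕ) : ℝ) / 6 ≤ s := by
        rw [← hval (j - 1) (by omega)]; exact hsj.1
      have h2 : (s : ℝ) ≤ (j : ℝ) / 6 := by
        rw [← hval j hj6]; exact hsj.2
      rcases j with _ | j
      · have hs0 : (s : ℝ) = 0 := le_antisymm (by simpa using h2) s.2.1
        have hs0' : s = 0 := Subtype.ext hs0
        have h3 : p 1 ∈ A.piece δ ε (A.triVertex (itinerary 5)) := hreg 5 1 (by norm_num) (by norm_num)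
        rw [hp01] at h3
        rw [hs0']
        exact h3
      · have h3 := hreg ⟨j, by omega⟩ s (by simpa using h1) (by simpa using h2)
        rw [← getVert_triangleWalk] at h3
        exact h3

/-- The constant d is fixed first by compactness, then δ is chosen below d/8, then ε in terms of d
and δ, in accordance with the order of quantifiers in the invariant. -/
theorem GenericFrame.eventually_smallRadii (h : A.GenericFrame x) :
    ∃ d, ∀ᶠ δ in 𝓝[>] (0 : ℝ), ∀ᶠ ε in 𝓝[>] (0 : ℝ), A.SmallRadii x d δ ε := by
  obtain ⟨d, hd, hd01⟩ := (h.eventually_triangleBound.and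
    (Ioo_mem_nhdsGT (zero_lt_one' ℝ))).exists
  refine ⟨d, ?_⟩
  filter_upwards [Ioo_mem_nhdsGT (div_pos hd01.1 (by norm_num : (0 : ℝ) < 8))] with δ hδ
  have hcoord : ∀ᶠ ε in 𝓝[>] (0 : ℝ), ∀ a, 4 * A.sideCoord x ε a < δ := by
    rw [eventually_all]
    intro a
    have hc : ContinuousAt (fun ε => 4 * A.sideCoord x ε a) 0 := by
      unfold sideCoord
      fun_prop
    exact nhdsWithin_le_nhds (hc.eventually_lt continuousAt_const (by simpa [sideCoord] using hδ.1))
  filter_upwards [hcoord, Ioo_mem_nhdsGT (mul_pos hd01.1 hδ.1)] with ε h1 h2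
  exact ⟨hd, hd01.2.le, hδ.1, by linarith [hδ.2], h2.1, h2.2, h1⟩

/-- Being a nearby cycle does not involve a frame, so the generic frame serves the construction only
and the given one is kept for the formula. -/
theorem Frame.eventually_exists_nearbyCycle (h : A.Frame x) :
    ∀ᶠ δ in 𝓝[>] (0 : ℝ), ∀ᶠ ε in 𝓝[>] (0 : ℝ),
      ∃ (b : A.Complement) (c : Path b b), A.IsNearbyCycle δ ε A.triangle c := by
  obtain ⟨y, hy⟩ := h.exists_genericFrame
  obtain ⟨d, hd⟩ := hy.eventually_smallRadii
  filter_upwards [hd] with δ h1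
  filter_upwards [h1] with ε h2
  exact h2.exists_nearbyCycle hy

end Arrangement

/-! ### The invariant of a triangular inner-cyclic arrangement -/

namespace Arrangement

variable {n k l : ℕ} {A : Arrangement n} {A' : Arrangement k} {ξ : LineCharacter n}
  {ξ' : LineCharacter k} {x : Fin 3 → C3} {φ : C3 ≃L[ℂ] C3}

/-- Both conditions hold for some common radii, where a nearby cycle exists; evaluate the character
on it. -/
theorem IsInvariantValue.unique {γ : A.Vertex × A.Vertex →₀ ℤ} {z w : ℂˣ}
    (hz : A.IsInvariantValue ξ γ z) (hw : A.IsInvariantValue ξ γ w) : z = w := by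
  obtain ⟨δ, h1, h2⟩ := (Eventually.and hz hw).exists
  obtain ⟨ε, ⟨⟨b, c, hc⟩, h3⟩, -, h4⟩ := (h1.and h2).exists
  rw [← h3 b c hc, ← h4 b c hc]

theorem IsInvariantValue.invariant_eq {γ : A.Vertex × A.Vertex →₀ ℤ} {z : ℂˣ}
    (hz : A.IsInvariantValue ξ γ z) : A.invariant ξ γ = z :=
  (Classical.epsilon_spec (p := A.IsInvariantValue ξ γ) ⟨z, hz⟩).unique hz

theorem TriangleTrivial.isInvariantValue (h : A.TriangleTrivial ξ x) (hx : A.Frame x) :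
    A.IsInvariantValue ξ A.triangle (A.triangleValue ξ x) := by
  filter_upwards [hx.eventually_exists_nearbyCycle, h.eventually_nearlyConstant hx] with δ h1 h2
  filter_upwards [h1, h2] with ε h3 h4
  exact ⟨h3, fun b c hc => h.character_nearbyCycle hx h4 hc⟩

end Arrangement

/-! ### Gluing -/

namespace LineCharacter

variable {n k l : ℕ} {ξ : LineCharacter n} {ξ' : LineCharacter k}

theorem glue_left (hn : l ≤ n) (hk : l ≤ k) (i : Fin n) :
    (ξ.glue l hn hk ξ').toFun (Fin.castAdd _ i) =
      if hi : (i : ℕ) < l then ξ.toFun i * ξ'.toFun ⟨i, hi.trans_le hk⟩ else ξ.toFun i := by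
  simp [glue]

theorem glue_right (hn : l ≤ n) (hk : l ≤ k) (j : Fin (k - l)) :
    (ξ.glue l hn hk ξ').toFun (Fin.natAdd _ j) = ξ'.toFun ⟨l + j, by omega⟩ := by
  simp [glue]

end LineCharacter

namespace Arrangement

variable {n k l : ℕ} {A : Arrangement n} {A' : Arrangement k} {ξ : LineCharacter n}
  {ξ' : LineCharacter k} {x : Fin 3 → C3} {φ : C3 ≃L[ℂ] C3}

theorem exists_mapLine_rep (φ : C3 ≃L[ℂ] C3) (L : ProjLine) :
    ∃ a : ℂ, a ≠ 0 ∧ ∀ v, (mapLine φ L).rep v = a * L.rep (φ.symm v) := by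
  have h0 : formMap φ L.rep ≠ 0 :=
    fun h => L.rep_nonzero (formMap_injective φ (h.trans (map_zero _).symm))
  obtain ⟨a, ha⟩ := Projectivization.exists_smul_eq_mk_rep ℂ (formMap φ L.rep) h0
  have h1 : mapLine φ L = Projectivization.mk ℂ (formMap φ L.rep) h0 := by
    conv_lhs => rw [← L.mk_rep]
    rfl
  refine ⟨a, a.ne_zero, fun v => ?_⟩
  rw [h1, ← ha]
  rfl

theorem onLine_mapLine_iff (φ : C3 ≃L[ℂ] C3) (p : CP2) (L : ProjLine) :
    OnLine p (mapLine φ L) ↔ OnLine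
      (Projectivization.map (φ.symm.toLinearEquiv : C3 →ₗ[ℂ] C3) φ.symm.injective p) L := by
  obtain ⟨v, hv, rfl⟩ := mk_surjective p
  obtain ⟨a, ha, h⟩ := exists_mapLine_rep φ L
  rw [Projectivization.map_mk, onLine_mk_iff, onLine_mk_iff, h]
  simp [ha]

theorem triangleExponent_mul {a : ℂ} (ha : a ≠ 0) (α β γ : ℂ) :
    triangleExponent (a * α) (a * β) (a * γ) = triangleExponent α β γ := by
  simp only [triangleExponent, mul_div_mul_left _ _ ha]

theorem triangleExponent_mapLine (φ : C3 ≃L[ℂ] C3) (L : ProjLine) (u v w : C3) :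
    triangleExponent ((mapLine φ L).rep u) ((mapLine φ L).rep v) ((mapLine φ L).rep w) =
      triangleExponent (L.rep (φ.symm u)) (L.rep (φ.symm v)) (L.rep (φ.symm w)) := by
  obtain ⟨a, ha, h⟩ := exists_mapLine_rep φ L
  rw [h, h, h, triangleExponent_mul ha]

theorem rep_mapLine_eq_zero_iff (φ : C3 ≃L[ℂ] C3) (L : ProjLine) (v : C3) :
    (mapLine φ L).rep v = 0 ↔ L.rep (φ.symm v) = 0 := by
  obtain ⟨a, ha, h⟩ := exists_mapLine_rep φ L
  simp [h, ha]

/-- A product over the lines of a glued arrangement, of factors that are multiplicative in the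
values of the character. -/
theorem prod_glue (hn : l ≤ n) (hk : l ≤ k) (F : Fin (n + (k - l)) → ℂˣ →* ℂˣ)
    (f : Fin n → ℂˣ →* ℂˣ) (g : Fin k → ℂˣ →* ℂˣ) (hf : ∀ i, F (Fin.castAdd _ i) = f i)
    (hg : ∀ j : Fin (k - l), F (Fin.natAdd _ j) = g ⟨l + j, by omega⟩)
    (hfg : ∀ (i : ℕ) (hi : i < l), f ⟨i, hi.trans_le hn⟩ = g ⟨i, hi.trans_le hk⟩) :
    ∏ m, F m ((ξ.glue l hn hk ξ').toFun m) =
      (∏ i, f i (ξ.toFun i)) * ∏ j, g j (ξ'.toFun j) := by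
  -- The second family is extended by 1 to all integers, so that its product splits at l into the
  -- part on common lines and the part on added lines.
  let G : ℕ → ℂˣ := fun j => if h : j < k then g ⟨j, h⟩ (ξ'.toFun ⟨j, h⟩) else 1
  have h0 : ∏ j, g j (ξ'.toFun j) = ∏ j ∈ Finset.range k, G j := by
    rw [← Fin.prod_univ_eq_prod_range]
    exact Finset.prod_congr rfl fun j _ => by simp [G]
  have h1 : ∏ i : Fin n, (if (i : ℕ) < l then G i else 1) = ∏ j ∈ Finset.range l, G j := by
    rw [Fin.prod_univ_eq_prod_range (fun j => if j < l then G j else 1), ← Finset.prod_filter]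
    refine Finset.prod_congr ?_ fun _ _ => rfl
    ext j
    simp only [Finset.mem_filter, Finset.mem_range]
    omega
  have h2 : ∀ i : Fin n, F (Fin.castAdd _ i) ((ξ.glue l hn hk ξ').toFun (Fin.castAdd _ i)) =
      f i (ξ.toFun i) * if (i : ℕ) < l then G i else 1 := by
    intro i
    rw [hf, LineCharacter.glue_left]
    split_ifs with hi
    · rw [map_mul]
      congr 1
      rw [show f i = _ from hfg i hi]
      simp [G, hi.trans_le hk]
    · rw [mul_one]
  have h3 : ∀ j : Fin (k - l), F (Fin.natAdd _ j) ((ξ.glue l hn hk ξ').toFun (Fin.natAdd _ j)) =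
      G (l + j) := by
    intro j
    have : l + (j : ℕ) < k := by omega
    rw [hg, LineCharacter.glue_right]
    simp [G, this]
  rw [Fin.prod_univ_add, Finset.prod_congr rfl fun i _ => h2 i, Finset.prod_congr rfl fun j _ => h3 j,
    Finset.prod_mul_distrib, h1, Fin.prod_univ_eq_prod_range (fun j => G (l + j)), mul_assoc,
    ← Finset.prod_range_add, Nat.add_sub_cancel' hk, h0]

namespace IsGluing

theorem glue_line_left (h : IsGluing A A' l φ) (i : Fin n) :
    (A.glue A' φ h).line (Fin.castAdd _ i) = A.line i := by
  simp [glue]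

theorem glue_line_right (h : IsGluing A A' l φ) (j : Fin (k - l)) :
    (A.glue A' φ h).line (Fin.natAdd _ j) = mapLine φ (A'.line ⟨l + j, by omega⟩) := by
  simp [glue]

theorem glue_line_tri (h : IsGluing A A' l φ) (a : Fin 3) :
    (A.glue A' φ h).line ((A.glue A' φ h).tri a) = A.line (A.tri a) := by
  have : (A.glue A' φ h).tri a = Fin.castAdd _ (A.tri a) := by
    fin_cases a <;> rfl
  rw [this, h.glue_line_left]

theorem mapLine_tri (h : IsGluing A A' l φ) (a : Fin 3) :
    mapLine φ (A'.line (A'.tri a)) = A.line (A.tri a) := by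
  have := h.three_le
  fin_cases a
  exacts [h.map_eq 0 (by omega), h.map_eq 1 (by omega), h.map_eq 2 (by omega)]

theorem frame_glue (h : IsGluing A A' l φ) (hx : A.Frame x) : (A.glue A' φ h).Frame x where
  diag a := by rw [h.glue_line_tri]; exact hx.diag a
  off_diag hab := by rw [h.glue_line_tri]; exact hx.off_diag hab

theorem frame_right (h : IsGluing A A' l φ) (hx : A.Frame x) :
    A'.Frame fun a => φ.symm (x a) where
  diag a := by rw [Ne, ← rep_mapLine_eq_zero_iff, h.mapLine_tri]; exact hx.diag a
  off_diag hab := by rw [← rep_mapLine_eq_zero_iff, h.mapLine_tri]; exact hx.off_diag hab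

/-- The factor of a line, the identity or the trivial homomorphism according to incidence with p,
depends on the line only, so `prod_glue` applies. -/
theorem pointValue_glue (h : IsGluing A A' l φ) (p : CP2) :
    (A.glue A' φ h).pointValue (ξ.glue l h.le_left h.le_right ξ') p = A.pointValue ξ p *
      A'.pointValue ξ'
        (Projectivization.map (φ.symm.toLinearEquiv : C3 →ₗ[ℂ] C3) φ.symm.injective p) := by
  classical
  let F (L : ProjLine) : ℂˣ →* ℂˣ := if OnLine p L then MonoidHom.id _ else 1
  have key : ∀ (L : ProjLine) (z : ℂˣ), (if OnLine p L then z else 1) = F L z := by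
    intro L z
    by_cases hL : OnLine p L <;> simp [F, hL]
  simp only [pointValue, ← onLine_mapLine_iff]
  convert prod_glue (ξ := ξ) (ξ' := ξ') h.le_left h.le_right (fun m => F ((A.glue A' φ h).line m))
    (fun i => F (A.line i)) (fun j => F (mapLine φ (A'.line j)))
    (fun i => by rw [h.glue_line_left]) (fun j => by rw [h.glue_line_right])
    (fun i hi => by rw [h.map_eq i hi]) using 1
  · exact Finset.prod_congr rfl fun _ _ => key _ _
  · congr 1 <;> exact Finset.prod_congr rfl fun _ _ => key _ _

/-- The exponent attached to a line depends only on the line and the frame, and the map φ transports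
it. The product therefore splits over the two arrangements even where lines are shared. -/
theorem triangleValue_glue (h : IsGluing A A' l φ) (x : Fin 3 → C3) :
    (A.glue A' φ h).triangleValue (ξ.glue l h.le_left h.le_right ξ') x =
      A.triangleValue ξ x * A'.triangleValue ξ' fun a => φ.symm (x a) := by
  let F (L : ProjLine) : ℂˣ →* ℂˣ :=
    zpowGroupHom (triangleExponent (L.rep (x 0)) (L.rep (x 1)) (L.rep (x 2)))
  simp only [triangleValue, ← triangleExponent_mapLine]
  exact prod_glue h.le_left h.le_right (fun m => F ((A.glue A' φ h).line m))
    (fun i => F (A.line i)) (fun j => F (mapLine φ (A'.line j)))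
    (fun i => by rw [h.glue_line_left]) (fun j => by rw [h.glue_line_right])
    (fun i hi => by rw [h.map_eq i hi])

theorem triangleTrivial_glue (h : IsGluing A A' l φ) (hA : A.TriangleTrivial ξ x)
    (hA' : A'.TriangleTrivial ξ' fun a => φ.symm (x a)) :
    (A.glue A' φ h).TriangleTrivial (ξ.glue l h.le_left h.le_right ξ') x where
  line m a hm := by
    induction m using Fin.addCases with
    | left i =>
      rw [h.glue_line_left] at hm
      rw [LineCharacter.glue_left]
      split_ifs with hi
      · rw [hA.line i a hm, one_mul]
        refine hA'.line _ a ?_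
        rw [← rep_mapLine_eq_zero_iff, h.map_eq i hi]
        exact hm
      · exact hA.line i a hm
    | right j =>
      rw [h.glue_line_right, rep_mapLine_eq_zero_iff] at hm
      rw [LineCharacter.glue_right]
      exact hA'.line _ a hm
  point p a hp := by
    rw [h.glue_line_tri] at hp
    rw [h.pointValue_glue, hA.point p a hp, one_mul]
    refine hA'.point _ a ?_
    rwa [← onLine_mapLine_iff, h.mapLine_tri]

end IsGluing

end Arrangement

end

/-! ### The gluing theorem -/

theorem theorem2p2 {n k l : ℕ} (A : Arrangement n) (A' : Arrangement k)
    (ξ : LineCharacter n) (ξ' : LineCharacter k)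
    (hA : A.IsInnerCyclic ξ A.triangle) (hA' : A'.IsInnerCyclic ξ' A'.triangle)
    (φ : C3 ≃L[ℂ] C3) (hφ : Arrangement.IsGluing A A' l φ) :
    let B : Arrangement (n + (k - l)) := A.glue A' φ hφ
    let χ : LineCharacter (n + (k - l)) := ξ.glue l hφ.le_left hφ.le_right ξ'
    B.IsInnerCyclic χ B.triangle ∧
      A.IsInvariantValue ξ A.triangle (A.invariant ξ A.triangle) ∧
      A'.IsInvariantValue ξ' A'.triangle (A'.invariant ξ' A'.triangle) ∧
      B.IsInvariantValue χ B.triangle (B.invariant χ B.triangle) ∧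
      B.invariant χ B.triangle = A.invariant ξ A.triangle * A'.invariant ξ' A'.triangle := by
  intro B χ
  -- One frame serves all three arrangements, pulled back by φ for the second one, so the three
  -- explicit values can be compared factor by factor.
  obtain ⟨x, hx⟩ := Arrangement.exists_frame A hA.2.1
  have hx' := hφ.frame_right hx
  have hxB := hφ.frame_glue hx
  have ht := (hx.isInnerCyclic_iff ξ).1 hA
  have ht' := (hx'.isInnerCyclic_iff ξ').1 hA'
  have htB := hφ.triangleTrivial_glue ht ht'
  have hv := ht.isInvariantValue hx
  have hv' := ht'.isInvariantValue hx'
  have hvB := htB.isInvariantValue hxB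
  refine ⟨(hxB.isInnerCyclic_iff χ).2 htB, ?_⟩
  rw [hv.invariant_eq, hv'.invariant_eq, show B.invariant χ B.triangle = _ from hvB.invariant_eq]
  exact ⟨hv, hv', hvB, hφ.triangleValue_glue x⟩
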